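/- Let $d\ge 2$, let $\Omega\subset\mathbb R^d$ be a bounded Lipschitz domain (an open set which near its boundary coincides, up to rigid motions, with the region above the graph of a Lipschitz function), and put $\delta(x)=\operatorname{dist}(x,\partial\Omega)$. Let $s\in(0,1)$ with $2s>1$. For $u\in L^2(\Omega)$ let $$|u|^2=\int_\Omega\int_{\Omega\cap B_{\delta(x)}(x)}\frac{|u(y)-u(x)|^2}{\delta(x)^{d+2s}}\,dy\,dx,\qquad \|u\|=\bigl(\|u\|_{L^2(\Omega)}^2+|u|^2\bigr)^{1/2},$$ and let $\mathfrak W^{s,2}(\Omega)$ and $\mathring{\mathfrak W}^{s,2}(\Omega)$ be the closures, with respect to $\|\cdot\|$, of $C^{0,1}(\overline\Omega)$ and of $C^{0,1}_c(\Omega)$ (Lipschitz functions with compact support in $\Omega$). Let $W^{s,2}(\Omega)$ be the space of $u\in L^2(\Omega)$ with $\int_\Omega\int_\Omega |u(y)-u(x)|^2|y-x|^{-d-2s}\,dy\,dx<\infty$. Let $A:\Omega\times\Omega\to\mathbb R$ be measurable and symmetric with $0<\alpha_1\le A(x,y)\le\alpha_2<\infty$. Let $\Omega_0$ be open and compactly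 contained in $\Omega$, $\phi\in W^{s,2}(\Omega)$, $0\le h\in L^2(\Omega)\setminus W^{s,2}(\Omega)$, and let $f$ be a bounded linear functional on $\mathfrak W^{s,2}(\Omega)$. Put $$K_\phi(2,h)=\{u\in\mathfrak W^{s,2}(\Omega):\ u\ge h \text{ a.e. in }\Omega_0,\ u-\phi\in\mathring{\mathfrak W}^{s,2}(\Omega)\},$$ $$E(u)=\int_\Omega\int_{\Omega\cap B_{\delta(x)}(x)}\frac{A(x,y)}{\delta(x)^{d+2s}}\,(u(y)-u(x))^2\,dy\,dx,$$ $$B(u,v)=\frac12\int_\Omega\int_\Omega G(x,y)(u(x)-u(y))(v(x)-v(y))\,dy\,dx,\qquad G(x,y)=A(x,y)\left(\frac{\chi_{B_{\delta(x)}(0)}(x-y)}{\delta(x)^{d+2s}}+\frac{\chi_{B_{\delta(y)}(0)}(x-y)}{\delta(y)^{d+2s}}\right).$$ Then the integrals defining $E(u)$ and $B(u,v)$ converge absolutely for all $u,v\in\mathfrak W^{s,2}(\Omega)$, and there is a unique $u\in K_\phi(2,h)$ with $$E(u)-\langle f,u\rangle=\min_{v\in K_\phi(2,h)}\bigl(E(v)-\langle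 f,v\rangle\bigr).$$ Moreover, an element $u\in K_\phi(2,h)$ is this minimizer if and only if $$2B(u,v-u)\ge\langle f,v-u\rangle\qquad\text{for all } v\in K_\phi(2,h).$$ -/

import Mathlib

open MeasureTheory Set Metric
open scoped ENNReal NNReal

noncomputable section

namespace NonlocalObstacle

/-- The Euclidean space `ℝ^d`. -/
abbrev E (d : ℕ) : Type := EuclideanSpace ℝ (Fin d)

/-- The space `L²(Ω)` (classes of functions modulo equality almost everywhere on `Ω`). -/
abbrev L2 {d : ℕ} (Ω : Set (E d)) : Type := Lp ℝ 2 (volume.restrict Ω)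

/-- A Lipschitz hypograph up to a rigid motion: after an isometric change of coordinates
`x = (x', x_d) ∈ ℝ^(d-1) × ℝ` the set is `{x_d > ζ(x')}` with `ζ` Lipschitz. -/
def IsLipschitzHypograph {d : ℕ} (U : Set (E d)) : Prop :=
  ∃ (T : WithLp 2 (E (d - 1) × ℝ) ≃ᵃⁱ[ℝ] E d) (ζ : E (d - 1) → ℝ) (L : ℝ≥0),
    LipschitzWith L ζ ∧ U = T '' {z | ζ z.fst < z.snd}

/-- Open sets with compact boundary which near the boundary coincide with Lipschitz hypographs. -/
def IsLipschitzDomain {d : ℕ} (Ω : Set (E d)) : Prop :=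
  IsOpen Ω ∧ IsCompact (frontier Ω) ∧
    ∃ (N : ℕ) (O U : Fin N → Set (E d)),
      (∀ j, IsOpen (O j) ∧ Bornology.IsBounded (O j)) ∧
      frontier Ω ⊆ ⋃ j, O j ∧
      (∀ j, IsLipschitzHypograph (U j)) ∧
      ∀ j, Ω ∩ O j = U j ∩ O j

/-- `δ(x) = dist(x, ∂Ω)`. -/
def bdist {d : ℕ} (Ω : Set (E d)) (x : E d) : ℝ := infDist x (frontier Ω)

/-- The square of the seminorm:
`∫_Ω ∫_{Ω ∩ B(x, δ(x))} |u(y) - u(x)|² / δ(x)^(d+2s) dy dx`. -/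
def nlSemiSq {d : ℕ} (s : ℝ) (Ω : Set (E d)) (u : E d → ℝ) : ℝ≥0∞ :=
  ∫⁻ x in Ω, ∫⁻ y in Ω ∩ ball x (bdist Ω x),
    ENNReal.ofReal (|u y - u x| ^ 2 / bdist Ω x ^ ((d : ℝ) + 2 * s))

/-- The norm `(‖u‖²_{L²(Ω)} + |u|²)^(1/2)` of the nonlocal space. -/
def nlNorm {d : ℕ} (s : ℝ) (Ω : Set (E d)) (u : E d → ℝ) : ℝ≥0∞ :=
  (eLpNorm u 2 (volume.restrict Ω) ^ 2 + nlSemiSq s Ω u) ^ (1 / 2 : ℝ)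

/-- `C_c^{0,1}(X)`: functions that are Lipschitz on `X` and vanish on `X` outside a compact subset
of `X`. (The values outside `X` are irrelevant.) -/
def lipschitzCc {d : ℕ} (X : Set (E d)) : Submodule ℝ (E d → ℝ) where
  carrier := {g | (∃ L : ℝ≥0, LipschitzOnWith L g X) ∧
    ∃ K : Set (E d), IsCompact K ∧ K ⊆ X ∧ ∀ x ∈ X, x ∉ K → g x = 0}
  zero_mem' := ⟨⟨0, (LipschitzWith.const 0).lipschitzOnWith⟩,
    ∅, isCompact_empty, empty_subset _, fun _ _ _ => rfl⟩
  add_mem' := by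
    rintro g g' ⟨⟨L, hL⟩, K, hK, hKX, h0⟩ ⟨⟨L', hL'⟩, K', hK', hKX', h0'⟩
    refine ⟨⟨L + L', hL.add hL'⟩, K ∪ K', hK.union hK', union_subset hKX hKX', ?_⟩
    intro x hx hxK
    simp only [mem_union, not_or] at hxK
    simp [h0 x hx hxK.1, h0' x hx hxK.2]
  smul_mem' := by
    rintro c g ⟨⟨L, hL⟩, K, hK, hKX, h0⟩
    refine ⟨⟨‖c‖₊ * L, ?_⟩, K, hK, hKX, fun x hx hxK => by simp [h0 x hx hxK]⟩
    intro x hx y hy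
    have h := hL hx hy
    rw [Pi.smul_apply, Pi.smul_apply, edist_smul₀, ENNReal.smul_def, smul_eq_mul,
      ENNReal.coe_mul, mul_assoc]
    gcongr

section helpers

variable {d : ℕ} {s : ℝ} {Ω : Set (E d)}

theorem nlSemiSq_congr {u v : E d → ℝ} (h : u =ᵐ[volume.restrict Ω] v) :
    nlSemiSq s Ω u = nlSemiSq s Ω v := by
  unfold nlSemiSq
  refine lintegral_congr_ae ?_
  filter_upwards [h] with x hx
  refine lintegral_congr_ae ?_
  filter_upwards [ae_restrict_of_ae_restrict_of_subset inter_subset_left h] with y hy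
  rw [hx, hy]

theorem nlNorm_congr {u v : E d → ℝ} (h : u =ᵐ[volume.restrict Ω] v) :
    nlNorm s Ω u = nlNorm s Ω v := by
  unfold nlNorm
  rw [nlSemiSq_congr h, eLpNorm_congr_ae h]

theorem nlNorm_sq (u : E d → ℝ) :
    nlNorm s Ω u ^ 2 = eLpNorm u 2 (volume.restrict Ω) ^ 2 + nlSemiSq s Ω u := by
  unfold nlNorm
  rw [← ENNReal.rpow_natCast, ← ENNReal.rpow_mul]
  norm_num

theorem measurable_bdist : Measurable (bdist Ω) :=
  (continuous_infDist_pt _).measurable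

theorem measurable_kernel {u : E d → ℝ} (hu : Measurable u) :
    Measurable fun x => ∫⁻ y in Ω ∩ ball x (bdist Ω x),
      ENNReal.ofReal (|u y - u x| ^ 2 / bdist Ω x ^ ((d : ℝ) + 2 * s)) := by
  have hδ : Measurable (bdist Ω) := measurable_bdist
  have hS : MeasurableSet {q : E d × E d | dist q.2 q.1 < bdist Ω q.1} :=
    measurableSet_lt (by fun_prop) (by fun_prop)
  have hF : Measurable fun q : E d × E d => ENNReal.ofReal
      (|u q.2 - u q.1| ^ 2 / bdist Ω q.1 ^ ((d : ℝ) + 2 * s)) := by fun_prop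
  have key := (hF.indicator hS).lintegral_prod_right' (ν := volume.restrict Ω)
  convert key using 2 with x
  rw [inter_comm, ← Measure.restrict_restrict measurableSet_ball,
    ← lintegral_indicator measurableSet_ball]
  rfl

theorem nlSemiSq_add_le {u v : E d → ℝ} (hu : Measurable u) (_ : Measurable v) :
    nlSemiSq s Ω (u + v) ≤ 2 * (nlSemiSq s Ω u + nlSemiSq s Ω v) := by
  unfold nlSemiSq
  rw [← lintegral_add_left (measurable_kernel hu), ← lintegral_const_mul' _ _ (by simp)]
  refine lintegral_mono fun x => ?_
  have hm : Measurable fun y => ENNReal.ofReal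
      (|u y - u x| ^ 2 / bdist Ω x ^ ((d : ℝ) + 2 * s)) := by fun_prop
  dsimp only
  rw [← lintegral_add_left hm, ← lintegral_const_mul' _ _ (by simp)]
  refine lintegral_mono fun y => ?_
  have hp : 0 ≤ bdist Ω x ^ ((d : ℝ) + 2 * s) := Real.rpow_nonneg infDist_nonneg _
  have h2 : (2 : ℝ≥0∞) = ENNReal.ofReal 2 := by simp
  rw [← ENNReal.ofReal_add (by positivity) (by positivity), h2,
    ← ENNReal.ofReal_mul (by norm_num)]
  refine ENNReal.ofReal_le_ofReal ?_
  rw [← add_div, mul_div_assoc']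
  refine div_le_div_of_nonneg_right ?_ hp
  simp only [sq_abs, Pi.add_apply]
  nlinarith [sq_nonneg ((u y - u x) - (v y - v x))]

theorem nlSemiSq_smul (c : ℝ) (u : E d → ℝ) :
    nlSemiSq s Ω (c • u) = ENNReal.ofReal (c ^ 2) * nlSemiSq s Ω u := by
  unfold nlSemiSq
  rw [← lintegral_const_mul' _ _ (by simp)]
  refine lintegral_congr fun x => ?_
  rw [← lintegral_const_mul' _ _ (by simp)]
  refine lintegral_congr fun y => ?_
  rw [← ENNReal.ofReal_mul (sq_nonneg c), mul_div_assoc']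
  congr 2
  simp only [sq_abs, Pi.smul_apply, smul_eq_mul]
  ring

theorem nlNorm_add_le (u v : L2 Ω) :
    nlNorm s Ω (u + v : L2 Ω) ≤ 2 * (nlNorm s Ω u + nlNorm s Ω v) := by
  rw [nlNorm_congr (Lp.coeFn_add u v), ← ENNReal.pow_le_pow_left_iff two_ne_zero, nlNorm_sq]
  have hu := (Lp.stronglyMeasurable u).measurable
  have hv := (Lp.stronglyMeasurable v).measurable
  have h1 : eLpNorm (⇑u + ⇑v) 2 (volume.restrict Ω) ≤
      nlNorm s Ω u + nlNorm s Ω v := by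
    refine (eLpNorm_add_le (Lp.aestronglyMeasurable u) (Lp.aestronglyMeasurable v)
      (by norm_num)).trans ?_
    refine add_le_add ?_ ?_ <;>
    · rw [← ENNReal.pow_le_pow_left_iff two_ne_zero, nlNorm_sq]
      exact le_self_add
  have h2 : nlSemiSq s Ω (⇑u + ⇑v) ≤ 2 * (nlNorm s Ω u + nlNorm s Ω v) ^ 2 := by
    refine (nlSemiSq_add_le hu hv).trans ?_
    gcongr
    calc nlSemiSq s Ω u + nlSemiSq s Ω v ≤ nlNorm s Ω u ^ 2 + nlNorm s Ω v ^ 2 := by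
          rw [nlNorm_sq, nlNorm_sq]
          exact add_le_add le_add_self le_add_self
      _ ≤ nlNorm s Ω u ^ 2 + nlNorm s Ω v ^ 2 + 2 * nlNorm s Ω u * nlNorm s Ω v := le_self_add
      _ = (nlNorm s Ω u + nlNorm s Ω v) ^ 2 := by ring
  calc _ ≤ (nlNorm s Ω u + nlNorm s Ω v) ^ 2 + 2 * (nlNorm s Ω u + nlNorm s Ω v) ^ 2 := by
        gcongr
    _ ≤ (nlNorm s Ω u + nlNorm s Ω v) ^ 2 + 2 * (nlNorm s Ω u + nlNorm s Ω v) ^ 2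
        + (nlNorm s Ω u + nlNorm s Ω v) ^ 2 := le_self_add
    _ = (2 * (nlNorm s Ω u + nlNorm s Ω v)) ^ 2 := by ring

theorem nlNorm_smul (c : ℝ) (u : L2 Ω) :
    nlNorm s Ω (c • u : L2 Ω) = ENNReal.ofReal |c| * nlNorm s Ω u := by
  rw [nlNorm_congr (Lp.coeFn_smul c u), ← (ENNReal.pow_right_strictMono two_ne_zero).injective.eq_iff]
  simp only [mul_pow]
  rw [nlNorm_sq, nlNorm_sq, nlSemiSq_smul, eLpNorm_const_smul, mul_pow, mul_add,
    ← ENNReal.ofReal_pow (abs_nonneg c), sq_abs, ← ofReal_norm, Real.norm_eq_abs,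
    ← ENNReal.ofReal_pow (abs_nonneg c), sq_abs]

end helpers

/-- The closure of a space `D` of functions with respect to `nlNorm`: the `u ∈ L²(Ω)` which are
limits, in this norm, of elements of `L²(Ω)` represented by functions in `D`. -/
def nlClosure {d : ℕ} (s : ℝ) (Ω : Set (E d)) (D : Submodule ℝ (E d → ℝ)) :
    Submodule ℝ (L2 Ω) where
  carrier := {u | ∀ ε : ℝ≥0∞, 0 < ε → ∃ g : L2 Ω,
    (∃ g₀ ∈ D, g =ᵐ[volume.restrict Ω] g₀) ∧ nlNorm s Ω (u - g : L2 Ω) < ε}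
  zero_mem' := by
    intro ε hε
    refine ⟨0, ⟨0, D.zero_mem, Lp.coeFn_zero _ _ _⟩, ?_⟩
    have h := nlNorm_smul (s := s) (0 : ℝ) (0 : L2 Ω)
    simp only [smul_zero, abs_zero, ENNReal.ofReal_zero, zero_mul] at h
    rwa [sub_zero, h]
  add_mem' := by
    intro u v hu hv ε hε
    by_cases hT : ε = ⊤
    · subst hT
      obtain ⟨g, ⟨g₀, hg₀, hg⟩, hN⟩ := hu ⊤ hε
      obtain ⟨g', ⟨g₀', hg₀', hg'⟩, hN'⟩ := hv ⊤ hε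
      refine ⟨g + g', ⟨g₀ + g₀', D.add_mem hg₀ hg₀', (Lp.coeFn_add g g').trans (hg.add hg')⟩, ?_⟩
      rw [add_sub_add_comm]
      exact (nlNorm_add_le _ _).trans_lt
        (ENNReal.mul_lt_top (by simp) (ENNReal.add_lt_top.2 ⟨hN, hN'⟩))
    · have hε' : 0 < ε / 4 := ENNReal.div_pos hε.ne' (by simp)
      obtain ⟨g, ⟨g₀, hg₀, hg⟩, hN⟩ := hu _ hε'
      obtain ⟨g', ⟨g₀', hg₀', hg'⟩, hN'⟩ := hv _ hε'
      refine ⟨g + g', ⟨g₀ + g₀', D.add_mem hg₀ hg₀', (Lp.coeFn_add g g').trans (hg.add hg')⟩, ?_⟩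
      rw [add_sub_add_comm]
      refine (nlNorm_add_le _ _).trans_lt ?_
      calc 2 * (nlNorm s Ω (u - g : L2 Ω) + nlNorm s Ω (v - g' : L2 Ω))
          < 2 * (ε / 4 + ε / 4) :=
            ENNReal.mul_lt_mul_right (by simp) (by simp) (ENNReal.add_lt_add hN hN')
        _ = 4 * (ε / 4) := by ring
        _ = ε := ENNReal.mul_div_cancel (by simp) (by simp)
  smul_mem' := by
    intro c u hu ε hε
    by_cases hc : c = 0
    · subst hc
      refine ⟨0, ⟨0, D.zero_mem, Lp.coeFn_zero _ _ _⟩, ?_⟩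
      rw [sub_zero, nlNorm_smul]
      simpa using hε
    · have hc' : 0 < ENNReal.ofReal |c| := by simpa using hc
      obtain ⟨g, ⟨g₀, hg₀, hg⟩, hN⟩ :=
        hu (ε / ENNReal.ofReal |c|) (ENNReal.div_pos hε.ne' (by simp))
      refine ⟨c • g, ⟨c • g₀, D.smul_mem c hg₀, (Lp.coeFn_smul c g).trans (hg.const_smul c)⟩, ?_⟩
      rw [← smul_sub, nlNorm_smul, mul_comm]
      exact (ENNReal.lt_div_iff_mul_lt (Or.inl hc'.ne') (Or.inl (by simp))).1 hN

/-- The nonlocal space: the closure of `C_c^{0,1}` of the closed set `closure Ω`. -/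
def nlSpace {d : ℕ} (s : ℝ) (Ω : Set (E d)) : Submodule ℝ (L2 Ω) :=
  nlClosure s Ω (lipschitzCc (closure Ω))

/-- The nonlocal space with zero boundary values: the closure of `C_c^{0,1}(Ω)`. -/
def nlSpaceZero {d : ℕ} (s : ℝ) (Ω : Set (E d)) : Submodule ℝ (L2 Ω) :=
  nlClosure s Ω (lipschitzCc Ω)

/-- `u ∈ L²(Ω)` lies in the fractional Sobolev space `W^{s,2}(Ω)`: finite Gagliardo seminorm. -/
def MemFracSobolev {d : ℕ} (s : ℝ) (Ω : Set (E d)) (u : L2 Ω) : Prop :=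
  ∫⁻ x in Ω, ∫⁻ y in Ω, ENNReal.ofReal (|u y - u x| ^ 2 / ‖y - x‖ ^ ((d : ℝ) + 2 * s)) < ⊤

/-- `E(u) = ∫_Ω ∫_{Ω ∩ B(x, δ(x))} A(x,y) / δ(x)^(d+2s) F(u(y) - u(x)) dy dx`. -/
def energy {d : ℕ} (s : ℝ) (Ω : Set (E d)) (A : E d → E d → ℝ) (F : ℝ → ℝ)
    (u : E d → ℝ) : ℝ :=
  ∫ x in Ω, ∫ y in Ω ∩ ball x (bdist Ω x),
    A x y / bdist Ω x ^ ((d : ℝ) + 2 * s) * F (u y - u x)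

/-- The kernel
`G(x,y) = A(x,y) (χ_{B(0,δ(x))}(x-y) / δ(x)^(d+2s) + χ_{B(0,δ(y))}(x-y) / δ(y)^(d+2s))`. -/
def kernelG {d : ℕ} (s : ℝ) (Ω : Set (E d)) (A : E d → E d → ℝ) (x y : E d) : ℝ :=
  A x y * ((ball (0 : E d) (bdist Ω x)).indicator 1 (x - y) / bdist Ω x ^ ((d : ℝ) + 2 * s) +
    (ball (0 : E d) (bdist Ω y)).indicator 1 (x - y) / bdist Ω y ^ ((d : ℝ) + 2 * s))

/-- `B(u,v) = 1/2 ∫_Ω ∫_Ω G(x,y) (u(x) - u(y)) (v(x) - v(y)) dy dx`. -/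
def formB {d : ℕ} (s : ℝ) (Ω : Set (E d)) (A : E d → E d → ℝ) (u v : E d → ℝ) : ℝ :=
  1 / 2 * ∫ x in Ω, ∫ y in Ω, kernelG s Ω A x y * (u x - u y) * (v x - v y)

/-- The admissible set `K_φ(2,h)`: elements of the nonlocal space with `u ≥ h` a.e. in `Ω₀` and
`u - φ` in the nonlocal space with zero boundary values. -/
def admissible {d : ℕ} (s : ℝ) (Ω Ω₀ : Set (E d)) (φ h : L2 Ω) : Set (nlSpace s Ω) :=
  {u | (∀ᵐ x ∂(volume.restrict Ω₀), h x ≤ (u : L2 Ω) x) ∧ (u : L2 Ω) - φ ∈ nlSpaceZero s Ω}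

/-- A linear functional on the nonlocal space is bounded, i.e. an element of the dual space. -/
def IsBoundedFunctional {d : ℕ} {s : ℝ} {Ω : Set (E d)} (f : nlSpace s Ω →ₗ[ℝ] ℝ) : Prop :=
  ∃ C : ℝ≥0, ∀ u : nlSpace s Ω, ENNReal.ofReal |f u| ≤ C * nlNorm s Ω (u : L2 Ω)

end NonlocalObstacle

end

/-! Interchanging the variables and using the symmetry of `A` shows that both halves of `G`
contribute equally, so `E(u) = B(u,u)` with `B` a symmetric bilinear form, and the bounds on `A`
make `B(u,u)` comparable to `|u|²`. The theorem is then about a quadratic functional on a convex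
set: midpoints turn minimizing sequences into Cauchy sequences, and the first variation gives the
variational inequality (`exists_isMinOn_quadratic`, `isMinOn_quadratic_iff`). Coercivity is needed
only for differences of admissible elements, and these have zero boundary values.

Three analytic facts feed this argument.

Poincaré inequality on the zero space (`exists_nlNorm_sq_le_of_mem_nlSpaceZero`). In a boundary
chart with height `H`, averages of `u` at `x` and at a point of height `c H(x)` differ by an amount
controlled by the seminorm. Integrated against `H^(-2s)`, the contraction in height gains `c^(2s)`
from the weight and loses `c⁻¹` from the volume. As `2s > 1`, the product is below `1` and the term
is absorbed; compact support makes it finite beforehand. The estimate then spreads from the boundary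
into the interior by overlapping balls.

Nonemptiness (`admissible_nonempty`). Functions in `W^{s,2}` lie in the nonlocal space, by
mollification directed into an interior cone and a partition of unity. Any `L²` function vanishing
outside a compact subset of `Ω` lies in the zero space, since the kernel is singular only at `∂Ω`.
Hence `φ + 1_{Ω₀}(|h| + |φ|)` is admissible, however rough `h` is.

Completeness (`exists_nlNorm_limit`). Fatou's lemma carries the seminorm through almost everywhere
convergence of a subsequence. -/

noncomputable section

namespace NonlocalObstacle

/-! ### Quadratic functionals on convex sets. -/

section Quadratic
open Filter Topology

variable {V : Type*} [AddCommGroup V] [Module ℝ V] (a : V →ₗ[ℝ] V →ₗ[ℝ] ℝ)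

theorem quadratic_add (hsymm : ∀ u v, a u v = a v u) (u w : V) :
    a (u + w) (u + w) = a u u + 2 * a u w + a w w := by
  simp only [map_add, LinearMap.add_apply]
  rw [hsymm w u]; ring

/-- Young's inequality, from positivity at `t u - σ w` with `σ = ±1`, divided by `t`. It needs no
definiteness of `a`. -/
theorem two_mul_abs_bilin_le (hsymm : ∀ u v, a u v = a v u) (hpos : ∀ u, 0 ≤ a u u)
    (u w : V) {t : ℝ} (ht : 0 < t) : 2 * |a u w| ≤ t * a u u + t⁻¹ * a w w := by
  have key : ∀ σ : ℝ, σ ^ 2 = 1 → 2 * (σ * a u w) ≤ t * a u u + t⁻¹ * a w w := by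
    intro σ hσ
    have h := hpos (t • u + (-σ) • w)
    rw [quadratic_add a hsymm] at h
    simp only [map_smul, LinearMap.smul_apply, smul_eq_mul] at h
    have h2 : 0 ≤ t⁻¹ * (t * (t * a u u) + 2 * (-σ * (t * a u w)) + -σ * (-σ * a w w)) :=
      mul_nonneg (by positivity) (by linarith)
    have e : t⁻¹ * (t * (t * a u u) + 2 * (-σ * (t * a u w)) + -σ * (-σ * a w w))
        = t * a u u - 2 * (σ * a u w) + σ ^ 2 * (t⁻¹ * a w w) := by
      field_simp
      ring
    rw [e, hσ] at h2
    linarith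
  rcases abs_cases (a u w) with ⟨h, _⟩ | ⟨h, _⟩
  · simpa [h] using key 1 (by norm_num)
  · simpa [h] using key (-1) (by norm_num)

/-- A quadratic functional which is coercive along a convex set attains its minimum there, provided
the set is complete for a gauge `N` controlling the functional. -/
theorem exists_isMinOn_quadratic (hsymm : ∀ u v, a u v = a v u) (hpos : ∀ u, 0 ≤ a u u)
    (f : V →ₗ[ℝ] ℝ) (N : V → ℝ) {K : Set V} (hK : Convex ℝ K)
    (hne : K.Nonempty) {C : ℝ} (hC : 0 < C) (hf : ∀ v, |f v| ≤ C * N v)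
    (haN : ∀ v, a v v ≤ C * N v ^ 2)
    (hco : ∀ u ∈ K, ∀ v ∈ K, N (u - v) ^ 2 ≤ C * a (u - v) (u - v))
    (hcomp : ∀ v : ℕ → V, (∀ n, v n ∈ K) →
      (∀ ε > 0, ∃ n₀, ∀ n ≥ n₀, ∀ m ≥ n₀, N (v n - v m) < ε) →
      ∃ w ∈ K, Tendsto (fun n => N (v n - w)) atTop (𝓝 0)) :
    ∃ u ∈ K, IsMinOn (fun v => a v v - f v) K u := by
  set J : V → ℝ := fun v => a v v - f v with hJ
  have hexp : ∀ u w, J (u + w) = J u + 2 * a u w - f w + a w w := by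
    intro u w
    simp only [hJ]
    rw [quadratic_add a hsymm, map_add]
    ring
  obtain ⟨v₀, hv₀⟩ := hne
  have hbdd : BddBelow (J '' K) := by
    -- With `v = v₀ + w`, Young's inequality at `t = 2` costs `2 a(v₀,v₀) + a(w,w)/2`, and `|f w| ≤
    -- C N(w) ≤ a(w,w)/2 + C³/2` uses the other half of `a(w,w)`.
    refine ⟨J v₀ - 2 * a v₀ v₀ - C ^ 3 / 2, ?_⟩
    rintro _ ⟨v, hv, rfl⟩
    have h1 := hexp v₀ (v - v₀)
    rw [add_sub_cancel] at h1
    have h2 := two_mul_abs_bilin_le a hsymm hpos v₀ (v - v₀) (t := 2) two_pos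
    have h3 := hco v hv v₀ hv₀
    have h4 := hf (v - v₀)
    set w := v - v₀
    have h5 : C * N w ≤ N w ^ 2 / (2 * C) + C ^ 3 / 2 := by
      have : N w ^ 2 / (2 * C) + C ^ 3 / 2 - C * N w = (N w - C ^ 2) ^ 2 / (2 * C) := by
        field_simp
        ring
      have : 0 ≤ (N w - C ^ 2) ^ 2 / (2 * C) := by positivity
      linarith
    have h6 : N w ^ 2 / (2 * C) ≤ a w w / 2 := by
      rw [div_le_div_iff₀ (by positivity) two_pos]
      nlinarith
    have := neg_abs_le (a v₀ w)
    have := le_abs_self (f w)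
    linarith
  set m := sInf (J '' K) with hm
  have hle : ∀ v ∈ K, m ≤ J v := fun v hv => csInf_le hbdd (mem_image_of_mem _ hv)
  have hseq : ∀ n : ℕ, ∃ v ∈ K, J v < m + 1 / ((n : ℝ) + 1) := by
    intro n
    obtain ⟨_, ⟨v, hv, rfl⟩, h⟩ := exists_lt_of_csInf_lt (s := J '' K) ⟨_, mem_image_of_mem _ hv₀⟩
      (show sInf (J '' K) < m + 1 / ((n : ℝ) + 1) by rw [← hm]; linarith [Nat.one_div_pos_of_nat (n := n) (α := ℝ)])
    exact ⟨v, hv, h⟩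
  choose v hvK hv using hseq
  -- Parallelogram identity: `a(vₙ - vₖ, vₙ - vₖ)/4` is the convexity defect of `J` at the midpoint,
  -- where `J ≥ m` because the midpoint stays in `K`.
  have hdist : ∀ n k, N (v n - v k) ^ 2 ≤ 2 * C * (1 / ((n : ℝ) + 1) + 1 / ((k : ℝ) + 1)) := by
    intro n k
    have h1 := hle _ (hK (hvK n) (hvK k) (a := 1 / 2) (b := 1 / 2) (by norm_num) (by norm_num)
      (by norm_num))
    have h2 := hco _ (hvK n) _ (hvK k)
    have h3 : a (v n - v k) (v n - v k) / 4 =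
        J (v n) / 2 + J (v k) / 2 - J ((1 / 2 : ℝ) • v n + (1 / 2 : ℝ) • v k) := by
      simp only [hJ, map_add, map_sub, map_smul, LinearMap.add_apply, LinearMap.sub_apply,
        LinearMap.smul_apply, smul_eq_mul]
      rw [hsymm (v k) (v n)]
      ring
    have h4 := hv n
    have h5 := hv k
    refine h2.trans ?_
    rw [mul_comm 2 C, mul_assoc]
    refine mul_le_mul_of_nonneg_left ?_ hC.le
    linarith
  obtain ⟨w, hw, hlim⟩ := hcomp v hvK (by
    intro ε hε
    obtain ⟨n₀, hn₀⟩ := exists_nat_one_div_lt (show 0 < ε ^ 2 / (4 * C) by positivity)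
    refine ⟨n₀, fun n hn k hk => ?_⟩
    have h1 := hdist n k
    have h2 : 1 / ((n : ℝ) + 1) ≤ 1 / ((n₀ : ℝ) + 1) := Nat.one_div_le_one_div hn
    have h3 : 1 / ((k : ℝ) + 1) ≤ 1 / ((n₀ : ℝ) + 1) := Nat.one_div_le_one_div hk
    refine lt_of_pow_lt_pow_left₀ 2 hε.le ?_
    calc N (v n - v k) ^ 2 ≤ 2 * C * (1 / ((n : ℝ) + 1) + 1 / ((k : ℝ) + 1)) := h1
      _ ≤ 2 * C * (1 / ((n₀ : ℝ) + 1) + 1 / ((n₀ : ℝ) + 1)) := by gcongr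
      _ = 4 * C * (1 / ((n₀ : ℝ) + 1)) := by ring
      _ < 4 * C * (ε ^ 2 / (4 * C)) := by gcongr
      _ = ε ^ 2 := by field_simp)
  refine ⟨w, hw, ?_⟩
  have hJw : J w ≤ m := by
    -- The cross term `2 a(w, vₙ - w)` is split by Young's inequality with weight `t`. Letting `n →
    -- ∞` for fixed `t` leaves `t a(w,w)`, which disappears as `t → 0`.
    have hb : ∀ t > 0, J w ≤ m + t * a w w := by
      intro t ht
      have h1 : ∀ n : ℕ, J w ≤ m + 1 / ((n : ℝ) + 1) + t * a w w +
          t⁻¹ * (C * N (v n - w) ^ 2) + C * N (v n - w) := by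
        intro n
        have h1 := hexp w (v n - w)
        rw [add_sub_cancel] at h1
        have h2 := two_mul_abs_bilin_le a hsymm hpos w (v n - w) ht
        have h3 := hf (v n - w)
        have h4 := hpos (v n - w)
        have h5 := neg_abs_le (a w (v n - w))
        have h6 := le_abs_self (f (v n - w))
        have h7 : t⁻¹ * a (v n - w) (v n - w) ≤ t⁻¹ * (C * N (v n - w) ^ 2) :=
          mul_le_mul_of_nonneg_left (haN _) (by positivity)
        have h8 := hv n
        linarith
      refine ge_of_tendsto' (x := atTop) ?_ h1
      have h0 := tendsto_one_div_add_atTop_nhds_zero_nat (𝕜 := ℝ)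
      have := (((tendsto_const_nhds (x := m)).add h0).add_const (t * a w w)).add
        (((hlim.pow 2).const_mul C).const_mul t⁻¹) |>.add (hlim.const_mul C)
      simpa using this
    have : Tendsto (fun t : ℝ => m + t * a w w) (𝓝[>] 0) (𝓝 m) := by
      have : Tendsto (fun t : ℝ => m + t * a w w) (𝓝 0) (𝓝 (m + 0 * a w w)) :=
        (by fun_prop : Continuous fun t : ℝ => m + t * a w w).tendsto 0
      simpa using this.mono_left nhdsWithin_le_nhds
    exact ge_of_tendsto this (eventually_nhdsWithin_of_forall fun t ht => hb t ht)
  exact fun v hv => hJw.trans (hle v hv)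

/-- Minimizers of a quadratic functional on a convex set are characterized by the variational
inequality. -/
theorem isMinOn_quadratic_iff (hsymm : ∀ u v, a u v = a v u) (hpos : ∀ u, 0 ≤ a u u)
    (f : V →ₗ[ℝ] ℝ) {K : Set V} (hK : Convex ℝ K) {u : V} (hu : u ∈ K) :
    IsMinOn (fun v => a v v - f v) K u ↔ ∀ v ∈ K, 2 * a u (v - u) ≥ f (v - u) := by
  constructor
  · intro hmin v hv
    -- First variation: compare `u` with `u + t (v - u)` and divide by `t`.
    have h1 : ∀ t ∈ Ioo (0 : ℝ) 1, f (v - u) ≤ 2 * a u (v - u) + t * a (v - u) (v - u) := by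
      rintro t ⟨ht0, ht1⟩
      have hmem : u + t • (v - u) ∈ K := hK.add_smul_sub_mem hu hv ⟨ht0.le, ht1.le⟩
      have h2 := hmin hmem
      simp only [mem_ofPred_eq] at h2
      rw [quadratic_add a hsymm] at h2
      simp only [map_add, map_smul, LinearMap.smul_apply, smul_eq_mul] at h2
      refine le_of_mul_le_mul_left ?_ ht0
      linarith
    have h3 : Tendsto (fun t : ℝ => 2 * a u (v - u) + t * a (v - u) (v - u)) (𝓝[>] 0)
        (𝓝 (2 * a u (v - u))) := by
      have : Tendsto (fun t : ℝ => 2 * a u (v - u) + t * a (v - u) (v - u)) (𝓝 0)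
          (𝓝 (2 * a u (v - u) + 0 * a (v - u) (v - u))) :=
        (by fun_prop : Continuous fun t : ℝ => 2 * a u (v - u) + t * a (v - u) (v - u)).tendsto 0
      simpa using this.mono_left nhdsWithin_le_nhds
    refine ge_of_tendsto h3 ?_
    filter_upwards [Ioo_mem_nhdsGT (zero_lt_one (α := ℝ))] with t ht using h1 t ht
  · intro hvi v hv
    have h1 := hvi v hv
    have h2 := quadratic_add a hsymm u (v - u)
    have h3 := hpos (v - u)
    have h4 : f v = f u + f (v - u) := by rw [map_sub]; ring
    rw [add_sub_cancel] at h2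
    simp only [mem_ofPred_eq]
    linarith

/-- Uniqueness of minimizers when the quadratic form is definite along the convex set. -/
theorem isMinOn_quadratic_unique (hsymm : ∀ u v, a u v = a v u) (hpos : ∀ u, 0 ≤ a u u)
    (f : V →ₗ[ℝ] ℝ) {K : Set V} (hK : Convex ℝ K)
    (hdef : ∀ u ∈ K, ∀ v ∈ K, a (u - v) (u - v) ≤ 0 → u = v) {u v : V} (hu : u ∈ K) (hv : v ∈ K)
    (hmu : IsMinOn (fun v => a v v - f v) K u) (hmv : IsMinOn (fun v => a v v - f v) K v) :
    u = v := by
  -- The two variational inequalities, each tested with the other minimizer, add up to `a(u - v, u -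
  -- v) ≤ 0`.
  have h1 := (isMinOn_quadratic_iff a hsymm hpos f hK hu).1 hmu v hv
  have h2 := (isMinOn_quadratic_iff a hsymm hpos f hK hv).1 hmv u hu
  refine hdef u hu v hv ?_
  simp only [map_sub, LinearMap.sub_apply] at h1 h2 ⊢
  linarith [hsymm u v]

end Quadratic

/-! ### The energy as a symmetric bilinear form on the product space. -/

section Form
open Filter Topology

variable {d : ℕ} {s : ℝ} {Ω : Set (E d)}

/-- The product of the restrictions of Lebesgue measure to `Ω`. -/
abbrev pairMeasure (Ω : Set (E d)) : Measure (E d × E d) :=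
  (volume.restrict Ω).prod (volume.restrict Ω)

/-- The one-sided kernel `χ_{B(x, δ(x))}(y) / δ(x)^(d+2s)`. -/
def pairKernel (s : ℝ) (Ω : Set (E d)) (q : E d × E d) : ℝ :=
  {q : E d × E d | dist q.2 q.1 < bdist Ω q.1}.indicator
    (fun q => (bdist Ω q.1 ^ ((d : ℝ) + 2 * s))⁻¹) q

theorem bdist_nonneg (x : E d) : 0 ≤ bdist Ω x := infDist_nonneg

theorem measurableSet_pair : MeasurableSet {q : E d × E d | dist q.2 q.1 < bdist Ω q.1} := by
  have hδ : Measurable (bdist Ω) := measurable_bdist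
  exact measurableSet_lt (by fun_prop) (by fun_prop)

theorem measurable_pairKernel : Measurable (pairKernel s Ω) := by
  have hδ : Measurable (bdist Ω) := measurable_bdist
  exact Measurable.indicator (by fun_prop) measurableSet_pair

theorem pairKernel_nonneg (q : E d × E d) : 0 ≤ pairKernel s Ω q :=
  indicator_nonneg (fun _ _ => inv_nonneg.2 (Real.rpow_nonneg (bdist_nonneg _) _)) _

/-- Absorbing the moving ball into an indicator gives one integral over a fixed product measure,
where Fubini, the swap of variables and Fatou apply. -/
theorem nlSemiSq_eq {u : E d → ℝ} (hu : Measurable u) :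
    nlSemiSq s Ω u =
      ∫⁻ q, ENNReal.ofReal (pairKernel s Ω q * (u q.2 - u q.1) ^ 2) ∂(pairMeasure Ω) := by
  have hk := measurable_pairKernel (s := s) (Ω := Ω)
  rw [lintegral_prod _ (by fun_prop)]
  unfold nlSemiSq
  refine lintegral_congr fun x => ?_
  rw [inter_comm, ← Measure.restrict_restrict measurableSet_ball,
    ← lintegral_indicator measurableSet_ball]
  refine lintegral_congr fun y => ?_
  by_cases h : dist y x < bdist Ω x
  · have h' : y ∈ ball x (bdist Ω x) := h
    simp [pairKernel, h, h', div_eq_inv_mul]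
  · have h' : y ∉ ball x (bdist Ω x) := h
    simp [pairKernel, h, h']

theorem ae_pair {p : E d → Prop} (hp : ∀ᵐ x ∂(volume.restrict Ω), p x) :
    ∀ᵐ q ∂(pairMeasure Ω), p q.1 ∧ p q.2 :=
  (Measure.quasiMeasurePreserving_fst.ae hp).and (Measure.quasiMeasurePreserving_snd.ae hp)

theorem measurable_coe (u : L2 Ω) : Measurable (u : E d → ℝ) :=
  (Lp.stronglyMeasurable u).measurable

/-- With the square root of the kernel as a factor, the seminorm is an `L²` norm on the product.
Products of two such functions are then integrable by Hölder, which is the source of all absolute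
convergence below. -/
theorem memLp_pair {u : E d → ℝ} (hum : Measurable u) (hu : nlSemiSq s Ω u < ⊤) :
    MemLp (fun q : E d × E d => √(pairKernel s Ω q) * (u q.2 - u q.1)) 2 (pairMeasure Ω) := by
  have hk := measurable_pairKernel (s := s) (Ω := Ω)
  refine ⟨(Measurable.aestronglyMeasurable (by fun_prop)), ?_⟩
  rw [eLpNorm_lt_top_iff_lintegral_rpow_enorm_lt_top (by norm_num) (by norm_num)]
  rw [nlSemiSq_eq hum] at hu
  convert hu using 3 with q
  rw [← ofReal_norm, ENNReal.toReal_ofNat, ENNReal.ofReal_rpow_of_nonneg (norm_nonneg _) (by norm_num)]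
  congr 1
  simp [mul_pow, Real.sq_sqrt (pairKernel_nonneg q)]

theorem integrable_pair {u v : E d → ℝ} (hum : Measurable u) (hvm : Measurable v)
    (hu : nlSemiSq s Ω u < ⊤) (hv : nlSemiSq s Ω v < ⊤) :
    Integrable (fun q : E d × E d => pairKernel s Ω q * (u q.2 - u q.1) * (v q.2 - v q.1))
      (pairMeasure Ω) := by
  refine ((memLp_pair hum hu).integrable_mul (memLp_pair hvm hv)).congr
    (Eventually.of_forall fun q => ?_)
  simp only [Pi.mul_apply]
  have := Real.mul_self_sqrt (pairKernel_nonneg (s := s) (Ω := Ω) q)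
  linear_combination (u q.2 - u q.1) * (v q.2 - v q.1) * this

variable {A : E d → E d → ℝ} {α₁ α₂ : ℝ}

theorem ae_mem_pair (hΩ : IsOpen Ω) : ∀ᵐ q ∂(pairMeasure Ω), q.1 ∈ Ω ∧ q.2 ∈ Ω :=
  ae_pair (ae_restrict_mem hΩ.measurableSet)

theorem integrable_form (hΩ : IsOpen Ω)
    (hAm : AEStronglyMeasurable (fun q : E d × E d => A q.1 q.2) (pairMeasure Ω))
    (hα₁ : 0 < α₁) (hAe : ∀ x ∈ Ω, ∀ y ∈ Ω, α₁ ≤ A x y ∧ A x y ≤ α₂)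
    {u v : E d → ℝ} (hum : Measurable u) (hvm : Measurable v)
    (hu : nlSemiSq s Ω u < ⊤) (hv : nlSemiSq s Ω v < ⊤) :
    Integrable (fun q : E d × E d =>
      A q.1 q.2 * (pairKernel s Ω q * (u q.2 - u q.1) * (v q.2 - v q.1))) (pairMeasure Ω) := by
  refine (integrable_pair hum hvm hu hv).bdd_mul hAm (c := α₂) ?_
  filter_upwards [ae_mem_pair hΩ] with q hq
  have := hAe _ hq.1 _ hq.2
  rw [Real.norm_eq_abs, abs_of_nonneg (hα₁.le.trans this.1)]
  exact this.2

/-- The form `∫∫ A(x,y) χ_{B(x, δ(x))}(y) δ(x)^(-d-2s) (u(y) - u(x)) (v(y) - v(x))`. -/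
def pairForm (s : ℝ) (Ω : Set (E d)) (A : E d → E d → ℝ) (u v : E d → ℝ) : ℝ :=
  ∫ q, A q.1 q.2 * (pairKernel s Ω q * (u q.2 - u q.1) * (v q.2 - v q.1)) ∂(pairMeasure Ω)

theorem pairForm_congr {u u' v v' : E d → ℝ} (hu : u =ᵐ[volume.restrict Ω] u')
    (hv : v =ᵐ[volume.restrict Ω] v') : pairForm s Ω A u v = pairForm s Ω A u' v' := by
  refine integral_congr_ae ?_
  filter_upwards [ae_pair hu, ae_pair hv] with q h1 h2
  rw [h1.1, h1.2, h2.1, h2.2]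

theorem pairForm_comm (u v : E d → ℝ) : pairForm s Ω A u v = pairForm s Ω A v u := by
  unfold pairForm
  congr 1 with q
  ring

theorem pairForm_add_right (hΩ : IsOpen Ω)
    (hAm : AEStronglyMeasurable (fun q : E d × E d => A q.1 q.2) (pairMeasure Ω))
    (hα₁ : 0 < α₁) (hAe : ∀ x ∈ Ω, ∀ y ∈ Ω, α₁ ≤ A x y ∧ A x y ≤ α₂)
    {u v w : E d → ℝ} (hum : Measurable u) (hvm : Measurable v) (hwm : Measurable w)
    (hu : nlSemiSq s Ω u < ⊤) (hv : nlSemiSq s Ω v < ⊤) (hw : nlSemiSq s Ω w < ⊤) :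
    pairForm s Ω A u (v + w) = pairForm s Ω A u v + pairForm s Ω A u w := by
  unfold pairForm
  rw [← integral_add (integrable_form hΩ hAm hα₁ hAe hum hvm hu hv)
    (integrable_form hΩ hAm hα₁ hAe hum hwm hu hw)]
  congr 1 with q
  simp only [Pi.add_apply]
  ring

theorem pairForm_smul_right (c : ℝ) (u v : E d → ℝ) :
    pairForm s Ω A u (c • v) = c * pairForm s Ω A u v := by
  unfold pairForm
  rw [← integral_const_mul]
  congr 1 with q
  simp only [Pi.smul_apply, smul_eq_mul]
  ring

/-- `pairForm` as a bilinear form on the nonlocal space. -/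
def bilinForm (hfin : ∀ u : nlSpace s Ω, nlSemiSq s Ω (u : L2 Ω) < ⊤) (hΩ : IsOpen Ω)
    (hAm : AEStronglyMeasurable (fun q : E d × E d => A q.1 q.2) (pairMeasure Ω))
    (hα₁ : 0 < α₁) (hAe : ∀ x ∈ Ω, ∀ y ∈ Ω, α₁ ≤ A x y ∧ A x y ≤ α₂) :
    nlSpace s Ω →ₗ[ℝ] nlSpace s Ω →ₗ[ℝ] ℝ :=
  LinearMap.mk₂ ℝ (fun u v => pairForm s Ω A (u : L2 Ω) (v : L2 Ω))
    (fun u u' v => by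
      rw [pairForm_comm, Submodule.coe_add, pairForm_congr (EventuallyEq.refl _ _) (Lp.coeFn_add (u : L2 Ω) u'),
        pairForm_add_right hΩ hAm hα₁ hAe (measurable_coe _) (measurable_coe _) (measurable_coe _)
          (hfin _) (hfin _) (hfin _), pairForm_comm, pairForm_comm (_ : E d → ℝ) (u' : L2 Ω)])
    (fun c u v => by
      rw [pairForm_comm, Submodule.coe_smul,
        pairForm_congr (EventuallyEq.refl _ _) (Lp.coeFn_smul c (u : L2 Ω)),
        pairForm_smul_right, pairForm_comm, smul_eq_mul])
    (fun u v v' => by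
      rw [Submodule.coe_add, pairForm_congr (EventuallyEq.refl _ _) (Lp.coeFn_add (v : L2 Ω) v'),
        pairForm_add_right hΩ hAm hα₁ hAe (measurable_coe _) (measurable_coe _) (measurable_coe _)
          (hfin _) (hfin _) (hfin _)])
    (fun c u v => by
      rw [Submodule.coe_smul, pairForm_congr (EventuallyEq.refl _ _) (Lp.coeFn_smul c (v : L2 Ω)),
        pairForm_smul_right, smul_eq_mul])

theorem toReal_nlSemiSq {u : E d → ℝ} (hum : Measurable u) :
    (nlSemiSq s Ω u).toReal =
      ∫ q, pairKernel s Ω q * (u q.2 - u q.1) * (u q.2 - u q.1) ∂(pairMeasure Ω) := by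
  have hk := measurable_pairKernel (s := s) (Ω := Ω)
  rw [nlSemiSq_eq hum, integral_eq_lintegral_of_nonneg_ae
    (Eventually.of_forall fun q => ?_) (Measurable.aestronglyMeasurable (by fun_prop))]
  · simp only [mul_assoc, sq]
  · simp only [mul_assoc]
    exact mul_nonneg (pairKernel_nonneg q) (mul_self_nonneg _)

theorem pairForm_self_bounds (hΩ : IsOpen Ω)
    (hAm : AEStronglyMeasurable (fun q : E d × E d => A q.1 q.2) (pairMeasure Ω))
    (hα₁ : 0 < α₁) (hAe : ∀ x ∈ Ω, ∀ y ∈ Ω, α₁ ≤ A x y ∧ A x y ≤ α₂)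
    {u : E d → ℝ} (hum : Measurable u) (hu : nlSemiSq s Ω u < ⊤) :
    α₁ * (nlSemiSq s Ω u).toReal ≤ pairForm s Ω A u u ∧
      pairForm s Ω A u u ≤ α₂ * (nlSemiSq s Ω u).toReal := by
  have h1 := integrable_pair hum hum hu hu
  have h2 := integrable_form hΩ hAm hα₁ hAe hum hum hu hu
  have h3 : ∀ q, 0 ≤ pairKernel s Ω q * (u q.2 - u q.1) * (u q.2 - u q.1) := fun q => by
    rw [mul_assoc]
    exact mul_nonneg (pairKernel_nonneg q) (mul_self_nonneg _)
  rw [toReal_nlSemiSq hum, ← integral_const_mul, ← integral_const_mul]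
  constructor
  · refine integral_mono_ae (h1.const_mul _) h2 ?_
    filter_upwards [ae_mem_pair hΩ] with q hq
    exact mul_le_mul_of_nonneg_right (hAe _ hq.1 _ hq.2).1 (h3 q)
  · refine integral_mono_ae h2 (h1.const_mul _) ?_
    filter_upwards [ae_mem_pair hΩ] with q hq
    exact mul_le_mul_of_nonneg_right (hAe _ hq.1 _ hq.2).2 (h3 q)

theorem integrableOn_energy (hΩ : IsOpen Ω)
    (hAm : AEStronglyMeasurable (fun q : E d × E d => A q.1 q.2) (pairMeasure Ω))
    (hα₁ : 0 < α₁) (hAe : ∀ x ∈ Ω, ∀ y ∈ Ω, α₁ ≤ A x y ∧ A x y ≤ α₂)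
    {u : E d → ℝ} (hum : Measurable u) (hu : nlSemiSq s Ω u < ⊤) :
    IntegrableOn (fun q : E d × E d => A q.1 q.2 / bdist Ω q.1 ^ ((d : ℝ) + 2 * s) *
        (u q.2 - u q.1) ^ 2)
      {q | q.1 ∈ Ω ∧ q.2 ∈ Ω ∩ ball q.1 (bdist Ω q.1)} (volume.prod volume) := by
  have h1 : {q : E d × E d | q.1 ∈ Ω ∧ q.2 ∈ Ω ∩ ball q.1 (bdist Ω q.1)} =
      {q : E d × E d | dist q.2 q.1 < bdist Ω q.1} ∩ Ω ×ˢ Ω := by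
    ext q
    simp only [mem_ofPred_eq, mem_inter_iff, mem_ball, mem_prod]
    tauto
  rw [h1, IntegrableOn, ← Measure.restrict_restrict measurableSet_pair, ← Measure.prod_restrict]
  refine (integrable_indicator_iff measurableSet_pair).1 ?_
  refine (integrable_form hΩ hAm hα₁ hAe hum hum hu hu).congr (Eventually.of_forall fun q => ?_)
  by_cases h : dist q.2 q.1 < bdist Ω q.1
  · simp only [pairKernel, indicator_apply, mem_ofPred_eq, if_pos h]
    ring
  · simp [pairKernel, indicator_apply, mem_ofPred_eq, if_neg h]

theorem energy_eq_pairForm (hΩ : IsOpen Ω)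
    (hAm : AEStronglyMeasurable (fun q : E d × E d => A q.1 q.2) (pairMeasure Ω))
    (hα₁ : 0 < α₁) (hAe : ∀ x ∈ Ω, ∀ y ∈ Ω, α₁ ≤ A x y ∧ A x y ≤ α₂)
    {u : E d → ℝ} (hum : Measurable u) (hu : nlSemiSq s Ω u < ⊤) :
    energy s Ω A (fun t => t ^ 2) u = pairForm s Ω A u u := by
  unfold pairForm energy
  rw [integral_prod _ (integrable_form hΩ hAm hα₁ hAe hum hum hu hu)]
  congr 1 with x
  rw [inter_comm, ← Measure.restrict_restrict measurableSet_ball,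
    ← integral_indicator measurableSet_ball]
  congr 1 with y
  by_cases h : dist y x < bdist Ω x
  · have h' : y ∈ ball x (bdist Ω x) := h
    rw [indicator_of_mem h']
    simp only [pairKernel, indicator_apply, mem_ofPred_eq, if_pos h]
    ring
  · have h' : y ∉ ball x (bdist Ω x) := h
    rw [indicator_of_notMem h']
    simp only [pairKernel, indicator_apply, mem_ofPred_eq, if_neg h]
    ring

theorem kernelG_eq (x y : E d) :
    kernelG s Ω A x y = A x y * (pairKernel s Ω (x, y) + pairKernel s Ω (y, x)) := by
  have key : ∀ r c : ℝ, (ball (0 : E d) r).indicator (1 : E d → ℝ) (x - y) / c =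
      if dist x y < r then c⁻¹ else 0 := by
    intro r c
    by_cases h : dist x y < r
    · have h' : x - y ∈ ball (0 : E d) r := by simpa [← dist_eq_norm] using h
      rw [indicator_of_mem h', if_pos h, Pi.one_apply, one_div]
    · have h' : x - y ∉ ball (0 : E d) r := by
        rw [mem_ball, dist_zero_right, ← dist_eq_norm]
        exact h
      rw [indicator_of_notMem h', if_neg h, zero_div]
  unfold kernelG pairKernel
  simp only [key, indicator_apply, mem_ofPred_eq, dist_comm y x]

/-- The product of differences does not change under `q ↦ q.swap`, nor does `A` on `Ω × Ω`; only the
kernel is moved to the other variable. -/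
theorem integrable_form_swap (hΩ : IsOpen Ω)
    (hAm : AEStronglyMeasurable (fun q : E d × E d => A q.1 q.2) (pairMeasure Ω))
    (hAs : ∀ x ∈ Ω, ∀ y ∈ Ω, A x y = A y x)
    (hα₁ : 0 < α₁) (hAe : ∀ x ∈ Ω, ∀ y ∈ Ω, α₁ ≤ A x y ∧ A x y ≤ α₂)
    {u v : E d → ℝ} (hum : Measurable u) (hvm : Measurable v)
    (hu : nlSemiSq s Ω u < ⊤) (hv : nlSemiSq s Ω v < ⊤) :
    Integrable (fun q : E d × E d =>
      A q.1 q.2 * (pairKernel s Ω q.swap * (u q.2 - u q.1) * (v q.2 - v q.1))) (pairMeasure Ω) ∧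
    ∫ q, A q.1 q.2 * (pairKernel s Ω q.swap * (u q.2 - u q.1) * (v q.2 - v q.1)) ∂(pairMeasure Ω) =
      pairForm s Ω A u v := by
  have h1 := integrable_form hΩ hAm hα₁ hAe hum hvm hu hv
  have h2 : (fun q : E d × E d =>
      A q.1 q.2 * (pairKernel s Ω q.swap * (u q.2 - u q.1) * (v q.2 - v q.1)))
      =ᵐ[pairMeasure Ω] (fun q : E d × E d =>
      A q.1 q.2 * (pairKernel s Ω q * (u q.2 - u q.1) * (v q.2 - v q.1))) ∘ Prod.swap := by
    filter_upwards [ae_mem_pair hΩ] with q hq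
    simp only [Function.comp, Prod.fst_swap, Prod.snd_swap]
    rw [hAs _ hq.1 _ hq.2]
    ring
  refine ⟨h1.swap.congr h2.symm, ?_⟩
  rw [integral_congr_ae h2]
  exact integral_prod_swap (μ := volume.restrict Ω) (ν := volume.restrict Ω)
      (fun q : E d × E d => A q.1 q.2 * (pairKernel s Ω q * (u q.2 - u q.1) * (v q.2 - v q.1)))

/-- The two terms of `G` are exchanged by the swap and have equal integrals, which cancels the
factor `1/2`. -/
theorem formB_eq_pairForm (hΩ : IsOpen Ω)
    (hAm : AEStronglyMeasurable (fun q : E d × E d => A q.1 q.2) (pairMeasure Ω))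
    (hAs : ∀ x ∈ Ω, ∀ y ∈ Ω, A x y = A y x)
    (hα₁ : 0 < α₁) (hAe : ∀ x ∈ Ω, ∀ y ∈ Ω, α₁ ≤ A x y ∧ A x y ≤ α₂)
    {u v : E d → ℝ} (hum : Measurable u) (hvm : Measurable v)
    (hu : nlSemiSq s Ω u < ⊤) (hv : nlSemiSq s Ω v < ⊤) :
    IntegrableOn (fun q : E d × E d => kernelG s Ω A q.1 q.2 * (u q.1 - u q.2) * (v q.1 - v q.2))
      (Ω ×ˢ Ω) (volume.prod volume) ∧ formB s Ω A u v = pairForm s Ω A u v := by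
  have h1 := integrable_form hΩ hAm hα₁ hAe hum hvm hu hv
  obtain ⟨h2, h3⟩ := integrable_form_swap hΩ hAm hAs hα₁ hAe hum hvm hu hv
  have e : (fun q : E d × E d => kernelG s Ω A q.1 q.2 * (u q.1 - u q.2) * (v q.1 - v q.2)) =
      fun q => A q.1 q.2 * (pairKernel s Ω q * (u q.2 - u q.1) * (v q.2 - v q.1)) +
        A q.1 q.2 * (pairKernel s Ω q.swap * (u q.2 - u q.1) * (v q.2 - v q.1)) := by
    ext q
    rw [kernelG_eq, show q.swap = (q.2, q.1) from rfl, show pairKernel s Ω (q.1, q.2) =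
      pairKernel s Ω q from rfl]
    ring
  have h4 : Integrable (fun q : E d × E d => kernelG s Ω A q.1 q.2 * (u q.1 - u q.2) *
      (v q.1 - v q.2)) (pairMeasure Ω) := by
    rw [e]
    exact h1.add h2
  refine ⟨by rw [IntegrableOn, ← Measure.prod_restrict]; exact h4, ?_⟩
  unfold formB
  rw [← integral_prod (fun q : E d × E d => kernelG s Ω A q.1 q.2 * (u q.1 - u q.2) *
      (v q.1 - v q.2)) h4, e, integral_add h1 h2, h3]
  unfold pairForm
  ring

end Form

/-! ### Finiteness, closedness and completeness of the nonlocal space. -/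

section Space
open Filter Topology

variable {d : ℕ} {s : ℝ} {Ω : Set (E d)}

theorem nontrivial_E (hd : 2 ≤ d) : Nontrivial (E d) := by
  have : Nonempty (Fin d) := ⟨⟨0, by omega⟩⟩
  infer_instance

theorem frontier_nonempty (hd : 2 ≤ d) (hb : Bornology.IsBounded Ω) (hne : Ω.Nonempty) :
    (frontier Ω).Nonempty := by
  have := nontrivial_E hd
  refine nonempty_frontier_iff.2 ⟨hne, fun h => ?_⟩
  exact NormedSpace.unbounded_univ ℝ (E d) (h ▸ hb)

theorem bdist_pos (hd : 2 ≤ d) (hΩ : IsOpen Ω) (hb : Bornology.IsBounded Ω) {x : E d}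
    (hx : x ∈ Ω) : 0 < bdist Ω x := by
  refine (isClosed_frontier.notMem_iff_infDist_pos (frontier_nonempty hd hb ⟨x, hx⟩)).1 ?_
  rw [hΩ.frontier_eq]
  exact fun h => h.2 hx

/-- The ball is connected and misses `∂Ω`, so it cannot meet both open sets `Ω` and `(closure Ω)ᶜ`.
-/
theorem ball_bdist_subset (hΩ : IsOpen Ω) {x : E d} (hx : x ∈ Ω) : ball x (bdist Ω x) ⊆ Ω := by
  rcases (bdist_nonneg (Ω := Ω) x).eq_or_lt with h0 | h0
  · simp [← h0]
  by_contra hcon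
  obtain ⟨y, hy, hyΩ⟩ := not_subset.1 hcon
  have hpre : IsPreconnected (ball x (bdist Ω x)) := (convex_ball x _).isPreconnected
  have hfr : ∀ z ∈ ball x (bdist Ω x), z ∉ frontier Ω := fun z hz hzf => by
    have : bdist Ω x ≤ dist x z := infDist_le_dist_of_mem hzf
    rw [mem_ball, dist_comm] at hz
    exact absurd hz (not_lt.2 this)
  have hcov : ball x (bdist Ω x) ⊆ Ω ∪ (closure Ω)ᶜ := fun z hz => by
    have := hfr z hz
    rw [hΩ.frontier_eq] at this
    by_contra h
    rw [mem_union, not_or, notMem_compl_iff] at h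
    exact this ⟨h.2, h.1⟩
  obtain ⟨z, -, hz1, hz2⟩ := hpre Ω (closure Ω)ᶜ hΩ isClosed_closure.isOpen_compl hcov
    ⟨x, mem_ball_self h0, hx⟩ ⟨y, hy, (hcov hy).resolve_left hyΩ⟩
  exact hz2 (subset_closure hz1)

theorem bdist_le_add_dist (x y : E d) : bdist Ω x ≤ bdist Ω y + dist x y :=
  infDist_le_infDist_add_dist

theorem exists_bdist_le (hb : Bornology.IsBounded Ω) : ∃ D : ℝ, 0 < D ∧ ∀ x ∈ Ω, bdist Ω x ≤ D := by
  obtain ⟨R, hR⟩ := hb.closure.subset_closedBall (0 : E d)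
  rcases (frontier Ω).eq_empty_or_nonempty with h | ⟨z, hz⟩
  -- For an empty frontier `infDist` takes the value `0`.
  · exact ⟨1, one_pos, fun x _ => by simp [bdist, h]⟩
  refine ⟨2 * R + 1, ?_, fun x hx => ?_⟩
  · have := hR (frontier_subset_closure hz)
    rw [mem_closedBall] at this
    linarith [dist_nonneg.trans this]
  · have h1 := hR (subset_closure hx)
    have h2 := hR (frontier_subset_closure hz)
    rw [mem_closedBall] at h1 h2
    have := infDist_le_dist_of_mem (x := x) hz
    have := dist_triangle_right x z 0
    unfold bdist
    linarith

theorem volume_ball (x : E d) {r : ℝ} (hr : 0 < r) :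
    volume (ball x r) = ENNReal.ofReal (r ^ (d : ℝ)) * volume (ball (0 : E d) 1) := by
  rw [Measure.addHaar_ball_of_pos _ _ hr, finrank_euclideanSpace_fin, Real.rpow_natCast]

/-- If the integrand of the seminorm is bounded by a quantity of order `δ²`, the inner integral is
bounded. -/
theorem setLIntegral_ball_le (hs1 : s < 1) {D L : ℝ} {x : E d}
    (hx0 : 0 < bdist Ω x) (hxD : bdist Ω x ≤ D) {w : E d → ℝ}
    (hw : ∀ y ∈ Ω ∩ ball x (bdist Ω x), w y ≤ L * bdist Ω x ^ 2) :
    ∫⁻ y in Ω ∩ ball x (bdist Ω x), ENNReal.ofReal (w y / bdist Ω x ^ ((d : ℝ) + 2 * s)) ≤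
      ENNReal.ofReal (|L| * D ^ (2 - 2 * s)) * volume (ball (0 : E d) 1) := by
  have hle : ∫⁻ y in Ω ∩ ball x (bdist Ω x),
      ENNReal.ofReal (w y / bdist Ω x ^ ((d : ℝ) + 2 * s)) ≤
      ∫⁻ y in Ω ∩ ball x (bdist Ω x),
      ENNReal.ofReal (|L| * bdist Ω x ^ 2 / bdist Ω x ^ ((d : ℝ) + 2 * s)) := by
    refine setLIntegral_mono measurable_const fun y hy => ENNReal.ofReal_le_ofReal ?_
    gcongr
    exact (hw y hy).trans (by gcongr; exact le_abs_self L)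
  refine hle.trans ?_
  rw [lintegral_const, Measure.restrict_apply_univ]
  calc _ ≤ ENNReal.ofReal (|L| * bdist Ω x ^ 2 / bdist Ω x ^ ((d : ℝ) + 2 * s)) *
        volume (ball x (bdist Ω x)) := by gcongr; exact inter_subset_right
    -- The powers combine as `δ² · δ^d / δ^(d+2s) = δ^(2-2s)`, bounded because `s < 1`.
    _ = ENNReal.ofReal (|L| * bdist Ω x ^ (2 - 2 * s)) * volume (ball (0 : E d) 1) := by
        rw [volume_ball x hx0, ← mul_assoc, ← ENNReal.ofReal_mul (by positivity)]
        congr 2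
        rw [Real.rpow_add hx0, Real.rpow_sub hx0, Real.rpow_two]
        have := Real.rpow_pos_of_pos hx0 (d : ℝ)
        field_simp
    _ ≤ _ := by
        gcongr
        linarith

theorem nlSemiSq_lt_top_of_lipschitz (hd : 2 ≤ d) (hs1 : s < 1) (hΩ : IsOpen Ω)
    (hb : Bornology.IsBounded Ω) {g : E d → ℝ} {L : ℝ≥0} (hg : LipschitzOnWith L g Ω) :
    nlSemiSq s Ω g < ⊤ := by
  obtain ⟨D, -, hD⟩ := exists_bdist_le hb
  have h : nlSemiSq s Ω g ≤ ∫⁻ x in Ω, ENNReal.ofReal (|(L : ℝ) ^ 2| * D ^ (2 - 2 * s)) *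
      volume (ball (0 : E d) 1) := by
    refine setLIntegral_mono measurable_const fun x hx => ?_
    refine setLIntegral_ball_le hs1 (bdist_pos hd hΩ hb hx) (hD x hx) fun y hy => ?_
    rw [← mul_pow]
    gcongr
    have h1 := hg.dist_le_mul y hy.1 x hx
    rw [Real.dist_eq] at h1
    exact h1.trans (by gcongr; exact hy.2.le)
  refine h.trans_lt ?_
  rw [lintegral_const, Measure.restrict_apply_univ]
  exact ENNReal.mul_lt_top (ENNReal.mul_lt_top ENNReal.ofReal_lt_top measure_ball_lt_top)
    hb.measure_lt_top

theorem nlSemiSq_le_nlNorm_sq (u : E d → ℝ) : nlSemiSq s Ω u ≤ nlNorm s Ω u ^ 2 := by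
  rw [nlNorm_sq]
  exact le_add_self

theorem eLpNorm_le_nlNorm (u : E d → ℝ) : eLpNorm u 2 (volume.restrict Ω) ≤ nlNorm s Ω u := by
  rw [← ENNReal.pow_le_pow_left_iff two_ne_zero, nlNorm_sq]
  exact le_self_add

theorem nlNorm_lt_top_iff (u : L2 Ω) : nlNorm s Ω u < ⊤ ↔ nlSemiSq s Ω u < ⊤ := by
  constructor
  · intro h
    exact (nlSemiSq_le_nlNorm_sq _).trans_lt (ENNReal.pow_lt_top h)
  · intro h
    unfold nlNorm
    refine ENNReal.rpow_lt_top_of_nonneg (by norm_num) (ENNReal.add_lt_top.2 ⟨?_, h⟩).ne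
    exact ENNReal.pow_lt_top (Lp.eLpNorm_lt_top u)

/-- The gauge may be infinite on `L²(Ω)`. One Lipschitz approximant at distance below `1` has finite
gauge, and the triangle inequality with factor `2` transfers this to `u`. -/
theorem nlNorm_lt_top_of_mem_nlClosure (hd : 2 ≤ d) (hs1 : s < 1) (hΩ : IsOpen Ω)
    (hb : Bornology.IsBounded Ω) {D : Submodule ℝ (E d → ℝ)}
    (hD : ∀ g ∈ D, ∃ L : ℝ≥0, LipschitzOnWith L g Ω) {u : L2 Ω} (hu : u ∈ nlClosure s Ω D) :
    nlNorm s Ω u < ⊤ := by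
  obtain ⟨g, ⟨g₀, hg₀, hgg⟩, hN⟩ := hu 1 one_pos
  obtain ⟨L, hL⟩ := hD g₀ hg₀
  have h1 : nlNorm s Ω g < ⊤ := by
    rw [nlNorm_lt_top_iff, nlSemiSq_congr hgg]
    exact nlSemiSq_lt_top_of_lipschitz hd hs1 hΩ hb hL
  have h2 := nlNorm_add_le (s := s) (u - g) g
  rw [sub_add_cancel] at h2
  exact h2.trans_lt (ENNReal.mul_lt_top (by simp)
    (ENNReal.add_lt_top.2 ⟨hN.trans (by simp), h1⟩))

theorem nlSemiSq_lt_top_of_mem_nlSpace (hd : 2 ≤ d) (hs1 : s < 1) (hΩ : IsOpen Ω)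
    (hb : Bornology.IsBounded Ω) (u : nlSpace s Ω) : nlSemiSq s Ω (u : L2 Ω) < ⊤ :=
  (nlNorm_lt_top_iff _).1 <| nlNorm_lt_top_of_mem_nlClosure hd hs1 hΩ hb
    (D := lipschitzCc (closure Ω)) (fun _ ⟨⟨L, hL⟩, _⟩ => ⟨L, hL.mono subset_closure⟩) u.2

theorem nlNorm_neg (u : L2 Ω) : nlNorm s Ω (-u : L2 Ω) = nlNorm s Ω u := by
  have := nlNorm_smul (s := s) (-1) u
  simpa using this

theorem mem_nlClosure_of_forall {D : Submodule ℝ (E d → ℝ)} {w : L2 Ω}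
    (h : ∀ ε : ℝ≥0∞, 0 < ε → ∃ u ∈ nlClosure s Ω D, nlNorm s Ω (w - u : L2 Ω) ≤ ε) :
    w ∈ nlClosure s Ω D := by
  intro ε hε
  -- The triangle inequality with factor `2` gives `4` times the tolerance; `5` leaves room for
  -- strictness, and the minimum with `1` keeps it finite when `ε = ⊤`.
  have hε' : 0 < min 1 (ε / 5) := lt_min one_pos (ENNReal.div_pos hε.ne' (by simp))
  have ht : min 1 (ε / 5) ≠ ⊤ := ((min_le_left _ _).trans_lt (by simp)).ne
  obtain ⟨u, hu, hN⟩ := h _ hε'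
  obtain ⟨g, hg, hN'⟩ := hu _ hε'
  refine ⟨g, hg, ?_⟩
  have h1 := nlNorm_add_le (s := s) (w - u) (u - g)
  rw [sub_add_sub_cancel] at h1
  refine h1.trans_lt ?_
  calc _ ≤ 2 * (min 1 (ε / 5) + min 1 (ε / 5)) := by gcongr
    _ = 4 * min 1 (ε / 5) := by ring
    _ < 5 * min 1 (ε / 5) := ENNReal.mul_lt_mul_left hε'.ne' ht (by norm_num)
    _ ≤ 5 * (ε / 5) := by gcongr; exact min_le_right _ _
    _ = ε := ENNReal.mul_div_cancel (by simp) (by simp)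

/-- Fatou's lemma on the product space: lower semicontinuity under almost everywhere convergence. -/
theorem nlSemiSq_le_of_tendsto {u : ℕ → E d → ℝ} {w : E d → ℝ} (hu : ∀ n, Measurable (u n))
    (hw : Measurable w) (hlim : ∀ᵐ x ∂(volume.restrict Ω), Tendsto (fun n => u n x) atTop (𝓝 (w x)))
    {C : ℝ≥0∞} (hC : ∀ᶠ n in atTop, nlSemiSq s Ω (u n) ≤ C) : nlSemiSq s Ω w ≤ C := by
  have hk := measurable_pairKernel (s := s) (Ω := Ω)
  rw [nlSemiSq_eq hw]
  calc _ = ∫⁻ q, liminf (fun n => ENNReal.ofReal (pairKernel s Ω q * (u n q.2 - u n q.1) ^ 2)) atTop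
        ∂(pairMeasure Ω) := by
        refine lintegral_congr_ae ?_
        filter_upwards [ae_pair hlim] with q hq
        refine (Tendsto.liminf_eq ?_).symm
        exact (ENNReal.continuous_ofReal.tendsto _).comp (((hq.2.sub hq.1).pow 2).const_mul _)
    _ ≤ liminf (fun n => ∫⁻ q, ENNReal.ofReal (pairKernel s Ω q * (u n q.2 - u n q.1) ^ 2)
        ∂(pairMeasure Ω)) atTop := by
        refine lintegral_liminf_le fun n => ?_
        have := hu n
        fun_prop
    _ ≤ C := by
        refine liminf_le_of_frequently_le' (Eventually.frequently ?_)
        filter_upwards [hC] with n hn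
        rwa [← nlSemiSq_eq (hu n)]

/-- Completeness of `L²(Ω)` functions with respect to `nlNorm`. -/
theorem exists_nlNorm_limit (v : ℕ → L2 Ω)
    (hc : ∀ ε : ℝ≥0∞, 0 < ε → ∃ n₀, ∀ n ≥ n₀, ∀ m ≥ n₀, nlNorm s Ω (v n - v m : L2 Ω) < ε) :
    ∃ w : L2 Ω, (∀ ε : ℝ≥0∞, 0 < ε → ∃ n₀, ∀ n ≥ n₀, nlNorm s Ω (v n - w : L2 Ω) ≤ ε) ∧
      ∃ ns : ℕ → ℕ, StrictMono ns ∧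
        ∀ᵐ x ∂(volume.restrict Ω), Tendsto (fun n => v (ns n) x) atTop (𝓝 (w x)) := by
  have hcau : CauchySeq v := by
    rw [EMetric.cauchySeq_iff]
    intro ε hε
    obtain ⟨n₀, h⟩ := hc ε hε
    refine ⟨n₀, fun n hn m hm => ?_⟩
    rw [Lp.edist_def, ← eLpNorm_congr_ae (Lp.coeFn_sub _ _)]
    exact (eLpNorm_le_nlNorm _).trans_lt (h n hn m hm)
  obtain ⟨w, hw⟩ := cauchySeq_tendsto_of_complete hcau
  obtain ⟨ns, hns, hae⟩ := (tendstoInMeasure_of_tendsto_Lp hw).exists_seq_tendsto_ae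
  refine ⟨w, fun ε hε => ?_, ns, hns, hae⟩
  obtain ⟨n₀, h⟩ := hc (ε / 2) (ENNReal.half_pos hε.ne')
  refine ⟨n₀, fun n hn => ?_⟩
  -- With `n` fixed, the Cauchy bound passes to the limit in `k`: by Fatou for the seminorm, by
  -- continuity of the norm for the `L²` part.
  have hev : ∀ᶠ k in atTop, nlNorm s Ω (v n - v (ns k) : L2 Ω) ≤ ε / 2 := by
    filter_upwards [hns.tendsto_atTop.eventually_ge_atTop n₀] with k hk using (h n hn _ hk).le
  have h1 : nlSemiSq s Ω (v n - w : L2 Ω) ≤ (ε / 2) ^ 2 := by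
    rw [nlSemiSq_congr (Lp.coeFn_sub _ _)]
    refine nlSemiSq_le_of_tendsto (u := fun k => ⇑(v n) - ⇑(v (ns k)))
      (fun k => (measurable_coe _).sub (measurable_coe _))
      ((measurable_coe _).sub (measurable_coe _)) ?_ ?_
    · filter_upwards [hae] with x hx using hx.const_sub _
    · filter_upwards [hev] with k hk
      rw [← nlSemiSq_congr (Lp.coeFn_sub _ _)]
      exact (nlSemiSq_le_nlNorm_sq _).trans (by gcongr)
  have h2 : eLpNorm (v n - w : L2 Ω) 2 (volume.restrict Ω) ≤ ε / 2 := by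
    have h3 : Tendsto (fun k => ‖v n - v (ns k)‖ₑ) atTop (𝓝 ‖v n - w‖ₑ) :=
      ((hw.comp hns.tendsto_atTop).const_sub (v n)).enorm
    rw [← Lp.enorm_def]
    refine le_of_tendsto h3 ?_
    filter_upwards [hev] with k hk
    rw [Lp.enorm_def]
    exact (eLpNorm_le_nlNorm _).trans hk
  rw [← ENNReal.pow_le_pow_left_iff two_ne_zero, nlNorm_sq]
  calc _ ≤ (ε / 2) ^ 2 + (ε / 2) ^ 2 := by gcongr
    _ ≤ (ε / 2) ^ 2 + (ε / 2) ^ 2 + 2 * (ε / 2) * (ε / 2) := le_self_add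
    _ = (ε / 2 + ε / 2) ^ 2 := by ring
    _ = ε ^ 2 := by rw [ENNReal.add_halves]

theorem nlClosure_mono {D D' : Submodule ℝ (E d → ℝ)}
    (h : ∀ g ∈ D, ∃ g' ∈ D', EqOn g g' Ω) (hΩ : IsOpen Ω) : nlClosure s Ω D ≤ nlClosure s Ω D' := by
  intro u hu ε hε
  obtain ⟨g, ⟨g₀, hg₀, hgg⟩, hN⟩ := hu ε hε
  obtain ⟨g', hg', he⟩ := h g₀ hg₀
  refine ⟨g, ⟨g', hg', hgg.trans ?_⟩, hN⟩
  filter_upwards [ae_restrict_mem hΩ.measurableSet] with x hx using he hx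

theorem lipschitz_mem_lipschitzCc_closure (hb : Bornology.IsBounded Ω) {g : E d → ℝ} {L : ℝ≥0}
    (hg : LipschitzWith L g) : g ∈ lipschitzCc (closure Ω) :=
  ⟨⟨L, hg.lipschitzOnWith⟩, closure Ω, hb.isCompact_closure, subset_rfl,
    fun _ hx h => absurd hx h⟩

/-- A function Lipschitz on `Ω` may have arbitrary values on `∂Ω`; a Lipschitz extension to the
whole space replaces them, and compactness of `closure Ω` supplies the support condition. -/
theorem nlSpaceZero_le (hΩ : IsOpen Ω) (hb : Bornology.IsBounded Ω) :
    nlSpaceZero s Ω ≤ nlSpace s Ω := by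
  refine nlClosure_mono (fun g hg => ?_) hΩ
  obtain ⟨⟨L, hL⟩, -⟩ := hg
  obtain ⟨g', hg', he⟩ := hL.extend_real
  exact ⟨g', lipschitz_mem_lipschitzCc_closure hb hg', he⟩

end Space

/-! ### Boundary charts, interior cones and vertical scaling. -/

section Geometry
open Filter Topology

variable {d : ℕ} {s : ℝ} {Ω : Set (E d)}

/-- A Lipschitz height function `H` with vertical direction `e`, describing `Ω` in the ball
`B(p, r)` around the boundary point `p` as `{H > 0}`. -/
structure IsHeight (Ω : Set (E d)) (p : E d) (H : E d → ℝ) (e : E d) (M r : ℝ) : Prop where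
  one_le : 1 ≤ M
  pos : 0 < r
  norm_dir : ‖e‖ = 1
  lip : ∀ x y, |H x - H y| ≤ M * ‖x - y‖
  shift : ∀ x (t : ℝ), H (x + t • e) = H x + t
  mem_iff : ∀ x ∈ ball p r, x ∈ Ω ↔ 0 < H x
  map_base : H p = 0

/-- In graph coordinates `H(x) = x_d - ζ(x')`: it has Lipschitz constant `1 + L`, and a vertical
shift by `t` adds exactly `t`. -/
theorem IsLipschitzDomain.exists_isHeight (hΩ : IsLipschitzDomain Ω) {p : E d}
    (hp : p ∈ frontier Ω) : ∃ H e M r, IsHeight Ω p H e M r := by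
  obtain ⟨hop, -, N, O, U, hO, hcov, hU, hΩU⟩ := hΩ
  obtain ⟨j, hj⟩ := mem_iUnion.1 (hcov hp)
  obtain ⟨T, ζ, L, hζ, hUj⟩ := hU j
  obtain ⟨r, hr, hball⟩ := Metric.isOpen_iff.1 (hO j).1 p hj
  set H : E d → ℝ := fun x => (T.symm x).snd - ζ (T.symm x).fst with hH
  have hlip : ∀ x y, |H x - H y| ≤ (1 + L) * ‖x - y‖ := by
    intro x y
    have h1 : ‖T.symm x - T.symm y‖ = ‖x - y‖ := by
      rw [← dist_eq_norm, ← dist_eq_norm, T.symm.dist_map]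
    have h2 : |(T.symm x).snd - (T.symm y).snd| ≤ ‖x - y‖ := by
      rw [← h1]
      refine abs_le_of_sq_le_sq ?_ (norm_nonneg _)
      rw [WithLp.prod_norm_sq_eq_of_L2, WithLp.sub_snd, Real.norm_eq_abs, sq_abs]
      exact le_add_of_nonneg_left (sq_nonneg _)
    have h3 : |ζ (T.symm x).fst - ζ (T.symm y).fst| ≤ L * ‖x - y‖ := by
      refine (hζ.dist_le_mul _ _).trans ?_
      rw [← h1, dist_eq_norm]
      gcongr
      refine (pow_le_pow_iff_left₀ (norm_nonneg _) (norm_nonneg _) two_ne_zero).1 ?_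
      rw [WithLp.prod_norm_sq_eq_of_L2, WithLp.sub_fst]
      exact le_add_of_nonneg_right (sq_nonneg _)
    calc |H x - H y| = |((T.symm x).snd - (T.symm y).snd) -
          (ζ (T.symm x).fst - ζ (T.symm y).fst)| := by congr 1; simp only [hH]; ring
      _ ≤ _ := abs_sub _ _
      _ ≤ _ := by linarith
  have hmem : ∀ x ∈ ball p r, x ∈ Ω ↔ 0 < H x := by
    intro x hx
    have h1 : x ∈ Ω ↔ x ∈ U j := by
      have := Set.ext_iff.1 (hΩU j) x
      simpa [hball hx] using this
    rw [h1, hUj]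
    constructor
    · rintro ⟨z, hz, rfl⟩
      simpa [hH] using hz
    · intro h
      exact ⟨T.symm x, by simpa [hH] using h, by simp⟩
  have hcont : Continuous H := by
    refine (LipschitzWith.of_dist_le_mul (K := 1 + L) fun x y => ?_).continuous
    rw [Real.dist_eq, dist_eq_norm]
    simpa using hlip x y
  refine ⟨H, T.linearIsometryEquiv (WithLp.toLp 2 (0, 1)), 1 + L, r, by simp, hr, ?_, hlip, ?_,
    hmem, ?_⟩
  · rw [LinearIsometryEquiv.norm_map]
    simp
  · intro x t
    have h : T.symm (x + t • T.linearIsometryEquiv (WithLp.toLp 2 (0, 1))) =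
        T.symm x + t • WithLp.toLp 2 (0, 1) := by
      apply T.injective
      rw [T.apply_symm_apply, add_comm (T.symm x), ← vadd_eq_add (_ : WithLp 2 (E (d - 1) × ℝ)),
        T.map_vadd, T.apply_symm_apply, map_smul, vadd_eq_add, add_comm]
    simp only [hH, h]
    simp
    ring
  -- `H p ≤ 0` because `p ∉ Ω`, and `H p ≥ 0` because `p` is a limit of points of `Ω` in the chart.
  · rw [hop.frontier_eq] at hp
    refine le_antisymm (not_lt.1 fun h => hp.2 ((hmem p (mem_ball_self hr)).2 h)) ?_
    have h1 : p ∈ closure (Ω ∩ ball p r) := by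
      rw [inter_comm]
      exact isOpen_ball.inter_closure ⟨mem_ball_self hr, hp.1⟩
    have h2 : closure (Ω ∩ ball p r) ⊆ {x | 0 ≤ H x} :=
      closure_minimal (fun x hx => ((hmem x hx.2).1 hx.1).le) (isClosed_le continuous_const hcont)
    exact h2 h1

namespace IsHeight

variable {p : E d} {H : E d → ℝ} {e : E d} {M r : ℝ}

theorem continuous (h : IsHeight Ω p H e M r) : Continuous H := by
  refine (LipschitzWith.of_dist_le_mul (K := M.toNNReal) fun x y => ?_).continuous
  rw [Real.dist_eq, dist_eq_norm, Real.coe_toNNReal _ (zero_le_one.trans h.one_le)]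
  exact h.lip x y

theorem abs_le (h : IsHeight Ω p H e M r) (x : E d) : |H x| ≤ M * ‖x - p‖ := by
  have := h.lip x p
  rwa [h.map_base, sub_zero] at this

/-- The boundary point below `x`. -/
theorem foot_mem_frontier (h : IsHeight Ω p H e M r) (hΩ : IsOpen Ω) {x : E d}
    (hx : (1 + M) * ‖x - p‖ < r) : x - H x • e ∈ frontier Ω := by
  have hfoot : H (x - H x • e) = 0 := by
    rw [sub_eq_add_neg, ← neg_smul, h.shift]
    ring
  have hball : x - H x • e ∈ ball p r := by
    rw [mem_ball, dist_eq_norm, sub_right_comm]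
    refine (norm_sub_le _ _).trans_lt ?_
    rw [norm_smul, h.norm_dir, mul_one, Real.norm_eq_abs]
    have := h.abs_le x
    linarith
  set z := x - H x • e
  rw [hΩ.frontier_eq]
  refine ⟨?_, fun hz => by simpa [hfoot] using (h.mem_iff _ hball).1 hz⟩
  -- Points slightly above the foot have positive height and so lie in `Ω`; hence the foot is in the
  -- closure.
  have h1 : Tendsto (fun t : ℝ => z + t • e) (𝓝[>] 0) (𝓝 z) := by
    have : Tendsto (fun t : ℝ => z + t • e) (𝓝 0) (𝓝 (z + (0 : ℝ) • e)) :=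
      (by fun_prop : Continuous fun t : ℝ => z + t • e).tendsto 0
    simpa using this.mono_left nhdsWithin_le_nhds
  refine mem_closure_of_tendsto h1 ?_
  filter_upwards [h1.eventually (isOpen_ball.mem_nhds hball), self_mem_nhdsWithin] with t ht ht0
  rw [h.mem_iff _ ht, h.shift, hfoot, zero_add]
  exact ht0

theorem bdist_le (h : IsHeight Ω p H e M r) (hΩ : IsOpen Ω) {x : E d}
    (hx : (1 + M) * ‖x - p‖ < r) (hx0 : 0 ≤ H x) : bdist Ω x ≤ H x := by
  refine (infDist_le_dist_of_mem (h.foot_mem_frontier hΩ hx)).trans_eq ?_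
  rw [dist_eq_norm, sub_sub_cancel, norm_smul, h.norm_dir, mul_one, Real.norm_eq_abs,
    abs_of_nonneg hx0]

/-- A boundary point in the chart has nonpositive height, so the Lipschitz bound applies. One
outside the chart is farther from `x` than `M ‖x - p‖`, which already bounds `H x`. -/
theorem le_bdist (h : IsHeight Ω p H e M r) (hΩ : IsOpen Ω) (hpf : p ∈ frontier Ω) {x : E d}
    (hx : (1 + M) * ‖x - p‖ < r) : H x ≤ M * bdist Ω x := by
  have hM := h.one_le
  rw [← div_le_iff₀' (by linarith)]
  refine (le_infDist ⟨p, hpf⟩).2 fun q hq => ?_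
  rw [div_le_iff₀' (by linarith), dist_eq_norm]
  by_cases hqb : q ∈ ball p r
  · have hq0 : H q ≤ 0 := by
      rw [hΩ.frontier_eq] at hq
      exact not_lt.1 fun h0 => hq.2 ((h.mem_iff q hqb).2 h0)
    have := h.lip x q
    have := le_abs_self (H x - H q)
    linarith
  · rw [mem_ball, not_lt, dist_eq_norm] at hqb
    have h1 : ‖q - p‖ ≤ ‖x - q‖ + ‖x - p‖ := by
      have := norm_sub_le_norm_sub_add_norm_sub q x p
      rwa [norm_sub_rev q x] at this
    have h2 := h.abs_le x
    have h3 := le_abs_self (H x)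
    have h4 : ‖x - p‖ ≤ ‖x - q‖ := by nlinarith [norm_nonneg (x - p)]
    nlinarith

end IsHeight

/-- The uniform interior cone property. -/
def HasInteriorCone (Ω : Set (E d)) (p : E d) : Prop :=
  ∃ (e : E d) (c r t₀ : ℝ), 0 < c ∧ 0 < r ∧ 0 < t₀ ∧
    ∀ x ∈ Ω ∩ ball p r, ∀ t ∈ Ioo 0 t₀, ∀ τ ∈ closedBall (t • e) (c * t), x + τ ∈ Ω

/-- At a boundary point, shifting by `t e` raises the height by `t`, while an error of size `t/(2M)`
lowers it by at most `t/2`. At an interior point the cone degenerates to balls around the origin,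
with direction `0`. -/
theorem IsLipschitzDomain.hasInteriorCone (hΩ : IsLipschitzDomain Ω) {p : E d}
    (hp : p ∈ closure Ω) : HasInteriorCone Ω p := by
  by_cases hpΩ : p ∈ Ω
  · obtain ⟨r, hr, hball⟩ := Metric.isOpen_iff.1 hΩ.1 p hpΩ
    refine ⟨0, 1, r / 2, r / 2, one_pos, by positivity, by positivity, ?_⟩
    rintro x ⟨-, hx⟩ t ht τ hτ
    refine hball ?_
    rw [mem_closedBall, smul_zero, dist_zero_right] at hτ
    rw [mem_ball, dist_eq_norm] at hx ⊢
    have := norm_add_le (x - p) τ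
    rw [sub_add_eq_add_sub] at this
    linarith [ht.2]
  · have hpf : p ∈ frontier Ω := by
      rw [hΩ.1.frontier_eq]
      exact ⟨hp, hpΩ⟩
    obtain ⟨H, e, M, r, h⟩ := hΩ.exists_isHeight hpf
    have hM := h.one_le
    have hM0 : 0 < M := by linarith
    refine ⟨e, 1 / (2 * M), r / 2, r / 4, by positivity, half_pos h.pos, by linarith [h.pos], ?_⟩
    rintro x ⟨hxΩ, hx⟩ t ht τ hτ
    rw [mem_closedBall, dist_eq_norm] at hτ
    rw [mem_ball, dist_eq_norm] at hx
    have hc : 1 / (2 * M) * t ≤ t / 2 := by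
      rw [div_mul_eq_mul_div, one_mul, div_le_div_iff₀ (by positivity) two_pos]
      nlinarith [ht.1]
    have hτn : ‖τ‖ ≤ 3 / 2 * t := by
      have h1 := norm_add_le (τ - t • e) (t • e)
      rw [sub_add_cancel, norm_smul, h.norm_dir, Real.norm_eq_abs, abs_of_pos ht.1] at h1
      linarith
    have hxb : x ∈ ball p r := by
      rw [mem_ball, dist_eq_norm]
      linarith [h.pos]
    refine (h.mem_iff _ ?_).2 ?_
    · rw [mem_ball, dist_eq_norm]
      have := norm_add_le (x - p) τ
      rw [sub_add_eq_add_sub] at this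
      linarith [ht.2, h.pos]
    · have h1 := (h.mem_iff x hxb).1 hxΩ
      have h2 := h.lip (x + τ) (x + t • e)
      rw [h.shift, add_sub_add_left_eq_sub] at h2
      have h3 := neg_abs_le (H (x + τ) - (H x + t))
      have h4 : M * ‖τ - t • e‖ ≤ M * (1 / (2 * M) * t) := by gcongr
      have h5 : M * (1 / (2 * M) * t) = t / 2 := by field_simp
      linarith [ht.1]

/-- Contraction towards `{H = 0}` along `e` by the factor `c` scales volume by `c`. -/
theorem lintegral_comp_vertical_scaling {H : E d → ℝ} {e : E d} (hH : Continuous H)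
    (hshift : ∀ x (t : ℝ), H (x + t • e) = H x + t) {c : ℝ} (hc : 0 < c)
    {f : E d → ℝ≥0∞} (hf : Measurable f) :
    ∫⁻ x, f (x + ((c - 1) * H x) • e) = ENNReal.ofReal c⁻¹ * ∫⁻ x, f x := by
  -- A weight of total mass one on the line. Inserting `∫ k(H x - t) dt = 1` and translating by `t
  -- e` writes the integral as one over vertical lines, so only the scaling of one real variable is
  -- needed and no Jacobian of a Lipschitz map.
  set k : ℝ → ℝ≥0∞ := (Icc (0 : ℝ) 1).indicator 1 with hk
  have hkm : Measurable k := measurable_one.indicator measurableSet_Icc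
  have hHm := hH.measurable
  have hk1 : ∀ a : ℝ, ∫⁻ t, k (a - t) = 1 := by
    intro a
    rw [lintegral_sub_left_eq_self (fun t => k t) a, hk, lintegral_indicator_one measurableSet_Icc]
    simp
  have hexp : ∀ g : E d → ℝ≥0∞, Measurable g →
      ∫⁻ x, g x = ∫⁻ x, k (H x) * ∫⁻ t : ℝ, g (x + t • e) := by
    intro g hg
    calc ∫⁻ x, g x = ∫⁻ x, ∫⁻ t, g x * k (H x - t) := by
          refine lintegral_congr fun x => ?_
          rw [lintegral_const_mul _ (by fun_prop), hk1, mul_one]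
      _ = ∫⁻ t : ℝ, ∫⁻ x, g x * k (H x - t) := lintegral_lintegral_swap (by fun_prop)
      _ = ∫⁻ t : ℝ, ∫⁻ x, g (x + t • e) * k (H x) := by
          refine lintegral_congr fun t => ?_
          rw [← lintegral_add_right_eq_self _ (t • e)]
          simp only [hshift, add_sub_cancel_right]
      _ = ∫⁻ x, ∫⁻ t : ℝ, g (x + t • e) * k (H x) := lintegral_lintegral_swap (by fun_prop)
      _ = _ := by
          refine lintegral_congr fun x => ?_
          rw [lintegral_mul_const _ (by fun_prop), mul_comm]
  rw [hexp _ (by fun_prop), hexp f hf, ← lintegral_const_mul _ (by fun_prop)]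
  refine lintegral_congr fun x => ?_
  rw [mul_left_comm]
  congr 1
  have e1 : ∀ t : ℝ, x + t • e + ((c - 1) * H (x + t • e)) • e =
      x + ((c - 1) * H x + c * t) • e := by
    intro t
    rw [hshift]
    module
  simp only [e1]
  have hg : Measurable fun t : ℝ => f (x + t • e) := by fun_prop
  have e2 : ∫⁻ t : ℝ, f (x + ((c - 1) * H x + t) • e) = ∫⁻ t : ℝ, f (x + t • e) :=
    lintegral_add_left_eq_self (fun t : ℝ => f (x + t • e)) ((c - 1) * H x)
  have e3 := lintegral_map (μ := volume) (f := fun t : ℝ => f (x + ((c - 1) * H x + t) • e))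
    (by fun_prop) (measurable_const_mul c)
  rw [Real.map_volume_mul_left hc.ne', lintegral_smul_measure, abs_of_pos (inv_pos.2 hc),
    smul_eq_mul] at e3
  rw [← e2, e3]

end Geometry

/-! ### Elementary inequalities for squares, and absorption. -/

section Jensen
open Filter Topology

theorem eLpNorm_two_sq {α : Type*} [MeasurableSpace α] {μ : Measure α} (f : α → ℝ) :
    eLpNorm f 2 μ ^ 2 = ∫⁻ x, ENNReal.ofReal (f x ^ 2) ∂μ := by
  rw [eLpNorm_eq_lintegral_rpow_enorm_toReal two_ne_zero (by norm_num), ← ENNReal.rpow_natCast,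
    ← ENNReal.rpow_mul]
  simp only [ENNReal.toReal_ofNat, Nat.cast_ofNat, one_div, ne_eq, OfNat.ofNat_ne_zero,
    not_false_eq_true, inv_mul_cancel₀, ENNReal.rpow_one]
  refine lintegral_congr fun x => ?_
  rw [← ofReal_norm, ENNReal.ofReal_rpow_of_nonneg (norm_nonneg _) (by norm_num)]
  simp

/-- Jensen's inequality as `L¹ ≤ L²` on a probability space; integrability of `f` is not required.
-/
theorem ofReal_sq_integral_le {α : Type*} [MeasurableSpace α] {μ : Measure α}
    [IsProbabilityMeasure μ] {f : α → ℝ} (hf : AEStronglyMeasurable f μ) :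
    ENNReal.ofReal ((∫ x, f x ∂μ) ^ 2) ≤ ∫⁻ x, ENNReal.ofReal (f x ^ 2) ∂μ := by
  rw [← eLpNorm_two_sq, ← sq_abs, ENNReal.ofReal_pow (abs_nonneg _), ← Real.norm_eq_abs, ofReal_norm]
  gcongr
  refine (enorm_integral_le_lintegral_enorm f).trans ?_
  rw [← eLpNorm_one_eq_lintegral_enorm]
  exact eLpNorm_le_eLpNorm_of_exponent_le (by norm_num) hf

theorem ofReal_add_sq_le (a b : ℝ) : ENNReal.ofReal ((a + b) ^ 2) ≤
    2 * ENNReal.ofReal (a ^ 2) + 2 * ENNReal.ofReal (b ^ 2) := by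
  rw [← mul_add, ← ENNReal.ofReal_add (sq_nonneg _) (sq_nonneg _),
    show (2 : ℝ≥0∞) = ENNReal.ofReal 2 by simp, ← ENNReal.ofReal_mul two_pos.le]
  exact ENNReal.ofReal_le_ofReal add_sq_le

/-- The factor of `a²` can be brought close to `1`, so that a contraction factor below `1` survives
the splitting. -/
theorem ofReal_add_sq_le_of_pos (a b : ℝ) {η : ℝ} (hη : 0 < η) : ENNReal.ofReal ((a + b) ^ 2) ≤
    ENNReal.ofReal (1 + η) * ENNReal.ofReal (a ^ 2) +
      ENNReal.ofReal (1 + η⁻¹) * ENNReal.ofReal (b ^ 2) := by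
  rw [← ENNReal.ofReal_mul (by positivity), ← ENNReal.ofReal_mul (by positivity),
    ← ENNReal.ofReal_add (by positivity) (by positivity)]
  refine ENNReal.ofReal_le_ofReal ?_
  have h : (1 + η) * a ^ 2 + (1 + η⁻¹) * b ^ 2 - (a + b) ^ 2 = η⁻¹ * (η * a - b) ^ 2 := by
    field_simp
    ring
  have : 0 ≤ η⁻¹ * (η * a - b) ^ 2 := by positivity
  linarith

theorem le_of_le_mul_add_of_lt_one {I X : ℝ≥0∞} {θ : ℝ} (hθ0 : 0 ≤ θ) (hθ : θ < 1) (hI : I ≠ ⊤)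
    (h : I ≤ ENNReal.ofReal θ * I + X) : I ≤ ENNReal.ofReal (1 - θ)⁻¹ * X := by
  have h1 : 0 < 1 - θ := by linarith
  rw [ENNReal.ofReal_inv_of_pos h1, mul_comm, ← div_eq_mul_inv,
    ENNReal.le_div_iff_mul_le (Or.inl (by simpa using hθ)) (Or.inl ENNReal.ofReal_ne_top),
    ENNReal.ofReal_sub _ hθ0, ENNReal.ofReal_one, ENNReal.mul_sub (fun _ _ => hI), mul_one]
  refine tsub_le_iff_left.2 ?_
  rwa [mul_comm I]

end Jensen

/-! ### Comparison of a function with its averages. -/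

section Poincare
open Filter Topology

variable {d : ℕ} {s : ℝ} {Ω : Set (E d)}

/-- Bounded measurable functions with compact support in `Ω`. -/
def IsTest (Ω : Set (E d)) (u : E d → ℝ) : Prop :=
  Measurable u ∧ (∃ B, ∀ x, |u x| ≤ B) ∧ ∃ K, IsCompact K ∧ K ⊆ Ω ∧ ∀ x ∉ K, u x = 0

/-- The Poincaré inequality with left side restricted to `S`. -/
def PoincareOn (s : ℝ) (Ω S : Set (E d)) : Prop :=
  ∃ C : ℝ≥0∞, C ≠ ⊤ ∧ ∀ u, IsTest Ω u → nlSemiSq s Ω u ≠ ⊤ →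
    ∫⁻ x in S ∩ Ω, ENNReal.ofReal (u x ^ 2) ≤ C * nlSemiSq s Ω u

/-- The inner integral of the seminorm. -/
def density (s : ℝ) (Ω : Set (E d)) (u : E d → ℝ) (x : E d) : ℝ≥0∞ :=
  ∫⁻ y in Ω ∩ ball x (bdist Ω x),
    ENNReal.ofReal (|u y - u x| ^ 2 / bdist Ω x ^ ((d : ℝ) + 2 * s))

theorem setLIntegral_sq_eq_density {u : E d → ℝ} {x : E d} (hδ : 0 < bdist Ω x) :
    ∫⁻ y in Ω ∩ ball x (bdist Ω x), ENNReal.ofReal ((u x - u y) ^ 2) =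
      ENNReal.ofReal (bdist Ω x ^ ((d : ℝ) + 2 * s)) * density s Ω u x := by
  unfold density
  rw [← lintegral_const_mul' _ _ ENNReal.ofReal_ne_top]
  refine lintegral_congr fun y => ?_
  have := Real.rpow_pos_of_pos hδ ((d : ℝ) + 2 * s)
  rw [← ENNReal.ofReal_mul this.le]
  congr 1
  rw [sq_abs]
  field_simp
  ring

/-- Jensen for the normalized measure on the small ball, followed by enlarging the domain to `B(x,
δ(x))`. The radius bound `κ δ(x) ≤ ρ` limits the loss in normalization to `κ^(-d)`. -/
theorem ofReal_sq_sub_average_le (hΩ : IsOpen Ω) {u : E d → ℝ} (hu : Measurable u) {B : ℝ}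
    (hB : ∀ x, |u x| ≤ B) {x c : E d} (hx : x ∈ Ω) (hδ : 0 < bdist Ω x) {κ ρ : ℝ} (hκ : 0 < κ)
    (hρ : κ * bdist Ω x ≤ ρ) (hball : ball c ρ ⊆ ball x (bdist Ω x)) :
    ENNReal.ofReal ((u x - ⨍ y in ball c ρ, u y) ^ 2) ≤
      ENNReal.ofReal (κ⁻¹ ^ (d : ℝ) * bdist Ω x ^ (2 * s)) * (volume (ball (0 : E d) 1))⁻¹ *
        density s Ω u x := by
  have hρ0 : 0 < ρ := (mul_pos hκ hδ).trans_le hρ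
  have hv0 : volume (ball c ρ) ≠ 0 := (measure_ball_pos _ _ hρ0).ne'
  have hvt : volume (ball c ρ) ≠ ⊤ := measure_ball_lt_top.ne
  have hw0 : volume (ball (0 : E d) 1) ≠ 0 := (measure_ball_pos _ _ one_pos).ne'
  have hwt : volume (ball (0 : E d) 1) ≠ ⊤ := measure_ball_lt_top.ne
  set ν : Measure (E d) := (volume.restrict (ball c ρ) univ)⁻¹ • volume.restrict (ball c ρ) with hν
  have hνp : IsProbabilityMeasure ν := ⟨by
    rw [hν, Measure.smul_apply, smul_eq_mul, Measure.restrict_apply_univ]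
    exact ENNReal.inv_mul_cancel hv0 hvt⟩
  have hint : Integrable u ν := Integrable.of_bound hu.aestronglyMeasurable B
    (Eventually.of_forall hB)
  have h1 : u x - ⨍ y in ball c ρ, u y = ∫ y, (u x - u y) ∂ν := by
    rw [integral_sub (integrable_const _) hint, integral_const, probReal_univ, one_smul]
    rfl
  have hbΩ : ball c ρ ⊆ Ω ∩ ball x (bdist Ω x) :=
    subset_inter (hball.trans (ball_bdist_subset hΩ hx)) hball
  rw [h1]
  calc _ ≤ ∫⁻ y, ENNReal.ofReal ((u x - u y) ^ 2) ∂ν :=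
        ofReal_sq_integral_le (by fun_prop)
    _ = (volume (ball c ρ))⁻¹ * ∫⁻ y in ball c ρ, ENNReal.ofReal ((u x - u y) ^ 2) := by
        rw [hν, lintegral_smul_measure, Measure.restrict_apply_univ, smul_eq_mul]
    _ ≤ (ENNReal.ofReal ((κ * bdist Ω x) ^ (d : ℝ)) * volume (ball (0 : E d) 1))⁻¹ *
        ∫⁻ y in Ω ∩ ball x (bdist Ω x), ENNReal.ofReal ((u x - u y) ^ 2) := by
        rw [volume_ball c hρ0]
        gcongr
    _ = _ := by
        rw [setLIntegral_sq_eq_density (s := s) hδ, ENNReal.mul_inv (Or.inr hwt) (Or.inr hw0),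
          ← ENNReal.ofReal_inv_of_pos (by positivity)]
        rw [show ∀ a b c e : ℝ≥0∞, a * b * (c * e) = a * c * b * e by intros; ring,
          ← ENNReal.ofReal_mul (by positivity)]
        congr 3
        rw [Real.mul_rpow hκ.le hδ.le, Real.rpow_add hδ, Real.inv_rpow hκ.le]
        have := Real.rpow_pos_of_pos hδ (d : ℝ)
        have := Real.rpow_pos_of_pos hκ (d : ℝ)
        field_simp

theorem measurable_average_ball {u : E d → ℝ} (hu : Measurable u) {ρ : E d → ℝ}
    (hρ : Measurable ρ) : Measurable fun x => ⨍ y in ball x (ρ x), u y := by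
  have hS : MeasurableSet {q : E d × E d | dist q.2 q.1 < ρ q.1} :=
    measurableSet_lt (by fun_prop) (by fun_prop)
  have h1 : Measurable fun x => volume (ball x (ρ x)) := measurable_measure_prodMk_left hS
  have h2 : Measurable fun x => ∫ y in ball x (ρ x), u y := by
    have h3 : StronglyMeasurable fun q : E d × E d =>
        {q : E d × E d | dist q.2 q.1 < ρ q.1}.indicator (fun q => u q.2) q :=
      (Measurable.indicator (by fun_prop) hS).stronglyMeasurable
    have h4 := (h3.integral_prod_right' (ν := (volume : Measure (E d)))).measurable
    convert h4 using 2 with x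
    rw [← integral_indicator measurableSet_ball]
    rfl
  simp only [setAverage_eq, smul_eq_mul]
  exact (h1.ennreal_toReal.inv).mul h2

end Poincare

/-! ### The Hardy type inequality at the boundary. -/

section Poincare
open Filter Topology

variable {d : ℕ} {s : ℝ} {Ω : Set (E d)}

theorem measurable_density {u : E d → ℝ} (hu : Measurable u) : Measurable (density s Ω u) :=
  measurable_kernel hu

theorem setLIntegral_density (u : E d → ℝ) : ∫⁻ x in Ω, density s Ω u x = nlSemiSq s Ω u := rfl

theorem IsTest.exists_le_bdist (hd : 2 ≤ d) (hΩ : IsOpen Ω) (hb : Bornology.IsBounded Ω)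
    {u : E d → ℝ} (hu : IsTest Ω u) :
    ∃ δ₁ > 0, ∀ x, u x ≠ 0 → x ∈ Ω ∧ δ₁ ≤ bdist Ω x := by
  obtain ⟨-, -, K, hK, hKΩ, h0⟩ := hu
  obtain ⟨δ₁, hδ₁, h⟩ := hK.exists_forall_le' (f := bdist Ω) (a := 0)
    (continuous_infDist_pt _).continuousOn fun x hx => bdist_pos hd hΩ hb (hKΩ hx)
  refine ⟨δ₁, hδ₁, fun x hx => ?_⟩
  have hxK : x ∈ K := by
    by_contra hxK
    exact hx (h0 x hxK)
  exact ⟨hKΩ hxK, h x hxK⟩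

set_option maxHeartbeats 1000000 in
/-- Hardy type inequality in a boundary chart. -/
theorem IsHeight.poincareOn (hd : 2 ≤ d) (hs : 1 < 2 * s) (hΩ : IsOpen Ω)
    (hb : Bornology.IsBounded Ω) {p : E d} (hp : p ∈ frontier Ω) {H : E d → ℝ} {e : E d} {M r : ℝ}
    (h : IsHeight Ω p H e M r) : ∃ V ∈ 𝓝 p, PoincareOn s Ω V := by
  have hM := h.one_le
  have hM0 : 0 < M := by linarith
  have hr := h.pos
  -- Points of the box `Q` below satisfy `‖x - p‖ < 2b`, so this size keeps `H` and `δ` comparable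
  -- on `Q`; `b ≤ 1` makes the weight at least `1`.
  set b : ℝ := min 1 (r / (4 * (1 + M))) with hbdef
  have hb0 : 0 < b := lt_min one_pos (by positivity)
  have hb1 : b ≤ 1 := min_le_left _ _
  have hbr : (1 + M) * (2 * b) < r := by
    have : b ≤ r / (4 * (1 + M)) := min_le_right _ _
    rw [le_div_iff₀ (by positivity)] at this
    linarith
  set Q : Set (E d) := {x | 0 < H x ∧ H x < b ∧ ‖x - H x • e - p‖ < b} with hQ
  have hHc := h.continuous
  have hHm := hHc.measurable
  have hQm : MeasurableSet Q := by
    have : IsOpen Q := by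
      refine (isOpen_lt continuous_const hHc).inter ((isOpen_lt hHc continuous_const).inter
        (isOpen_lt
        ((continuous_id.sub (hHc.smul continuous_const)).sub continuous_const).norm
        continuous_const))
    exact this.measurableSet
  have hQr : ∀ x ∈ Q, (1 + M) * ‖x - p‖ < r := by
    rintro x ⟨h0, h1, h2⟩
    refine lt_of_le_of_lt ?_ hbr
    have : ‖x - p‖ ≤ ‖x - H x • e - p‖ + ‖H x • e‖ := by
      refine le_trans (le_of_eq ?_) (norm_add_le _ _)
      congr 1
      abel
    rw [norm_smul, h.norm_dir, mul_one, Real.norm_eq_abs, abs_of_pos h0] at this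
    gcongr
    linarith
  have hQΩ : ∀ x ∈ Q, x ∈ Ω := by
    intro x hx
    have h1 := hQr x hx
    refine (h.mem_iff x ?_).2 hx.1
    rw [mem_ball, dist_eq_norm]
    nlinarith [norm_nonneg (x - p)]
  have hδ0 : ∀ x ∈ Q, 0 < bdist Ω x := fun x hx => bdist_pos hd hΩ hb (hQΩ x hx)
  have hδH : ∀ x ∈ Q, bdist Ω x ≤ H x := fun x hx => h.bdist_le hΩ (hQr x hx) hx.1.le
  have hHδ : ∀ x ∈ Q, H x ≤ M * bdist Ω x := fun x hx => h.le_bdist hΩ hp (hQr x hx)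
  -- Since `H ≤ M δ`, both the averaging radius `ε H` and the displacement `‖T x - x‖ = ε H` are at
  -- most `δ/2`. Thus the averaging balls at `x` and at `T x` lie in `B(x, δ(x))`.
  set ε : ℝ := 1 / (2 * M) with hε
  have hε0 : 0 < ε := by positivity
  have hε2 : ε ≤ 1 / 2 := by
    rw [hε, div_le_div_iff₀ (by positivity) two_pos]
    linarith
  have hεM : ε * M = 1 / 2 := by rw [hε]; field_simp
  set c : ℝ := 1 - ε with hc
  have hc0 : 0 < c := by linarith
  have hc1 : c < 1 := by linarith
  set T : E d → E d := fun x => x + ((c - 1) * H x) • e with hT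
  have hTm : Measurable T := by fun_prop
  have hHT : ∀ x, H (T x) = c * H x := by
    intro x
    rw [hT, h.shift]
    ring
  have hTQ : ∀ x ∈ Q, T x ∈ Q := by
    rintro x ⟨h0, h1, h2⟩
    refine ⟨by rw [hHT]; positivity, by rw [hHT]; nlinarith, ?_⟩
    rw [hHT]
    convert h2 using 3
    simp only [hT]
    module
  -- The radius at `T x` is `ε c H ≥ ε H / 2 ≥ κ δ`, since `c ≥ 1/2` and `H ≥ δ`.
  set κ : ℝ := ε / 2 with hκ
  have hκ0 : 0 < κ := by positivity
  set K₀ : ℝ≥0∞ := ENNReal.ofReal (κ⁻¹ ^ (d : ℝ)) * (volume (ball (0 : E d) 1))⁻¹ with hK₀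
  have hK₀t : K₀ ≠ ⊤ := ENNReal.mul_ne_top ENNReal.ofReal_ne_top
    (ENNReal.inv_ne_top.2 (measure_ball_pos _ _ one_pos).ne')
  set W : E d → ℝ≥0∞ := fun x => ENNReal.ofReal (H x ^ (-(2 * s))) with hW
  have hWm : Measurable W := by fun_prop
  -- The weight contributes `c^(2s)` and the change of variables `c⁻¹`. Here `2s > 1` makes the
  -- factor less than `1`.
  set q : ℝ := c ^ (2 * s - 1) with hq
  have hq0 : 0 < q := Real.rpow_pos_of_pos hc0 _
  have hq1 : q < 1 := Real.rpow_lt_one hc0.le hc1 (by linarith)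
  set η : ℝ := (1 - q) / 2 with hη
  have hη0 : 0 < η := by linarith
  set θ : ℝ := (1 + η) * q with hθ
  have hθ0 : 0 ≤ θ := by positivity
  have hθ1 : θ < 1 := by rw [hθ, hη]; nlinarith
  set K₁ : ℝ≥0∞ := ENNReal.ofReal (1 + η⁻¹) * (4 * K₀) with hK₁
  have hK₁t : K₁ ≠ ⊤ := ENNReal.mul_ne_top ENNReal.ofReal_ne_top (ENNReal.mul_ne_top (by simp) hK₀t)
  refine ⟨ball p (b / (1 + M)), ball_mem_nhds _ (by positivity),
    2 * K₀ + 2 * (ENNReal.ofReal (1 - θ)⁻¹ * K₁),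
    ENNReal.add_ne_top.2 ⟨ENNReal.mul_ne_top (by simp) hK₀t, ENNReal.mul_ne_top (by simp)
      (ENNReal.mul_ne_top ENNReal.ofReal_ne_top hK₁t)⟩, ?_⟩
  intro u hu hfin
  obtain ⟨δ₁, hδ₁, hsupp⟩ := hu.exists_le_bdist hd hΩ hb
  obtain ⟨hum, ⟨B, hB⟩, -⟩ := hu
  have hDm := measurable_density (s := s) (Ω := Ω) hum
  -- The seminorm does not control `u(x) - u(T x)` pointwise, but it controls the difference of
  -- averages, since each is compared with `u(x)`.
  set U : E d → ℝ := fun x => ⨍ y in ball x (ε * H x), u y with hU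
  have hUm : Measurable U := measurable_average_ball hum (by fun_prop)
  have hWle : ∀ x ∈ Q, ∀ z : ℝ, ENNReal.ofReal (z ^ 2) ≤
      ENNReal.ofReal (κ⁻¹ ^ (d : ℝ) * bdist Ω x ^ (2 * s)) * (volume (ball (0 : E d) 1))⁻¹ *
        density s Ω u x → W x * ENNReal.ofReal (z ^ 2) ≤ K₀ * density s Ω u x := by
    intro x hx z hz
    calc W x * ENNReal.ofReal (z ^ 2) ≤ W x * (ENNReal.ofReal (κ⁻¹ ^ (d : ℝ) * bdist Ω x ^ (2 * s)) *
          (volume (ball (0 : E d) 1))⁻¹ * density s Ω u x) := by gcongr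
      _ = W x * ENNReal.ofReal (κ⁻¹ ^ (d : ℝ) * bdist Ω x ^ (2 * s)) *
          (volume (ball (0 : E d) 1))⁻¹ * density s Ω u x := by ring
      _ ≤ _ := by
        rw [hK₀]
        gcongr
        rw [hW, ← ENNReal.ofReal_mul (Real.rpow_nonneg hx.1.le _)]
        refine ENNReal.ofReal_le_ofReal ?_
        have h1 : bdist Ω x ^ (2 * s) ≤ H x ^ (2 * s) :=
          Real.rpow_le_rpow (hδ0 x hx).le (hδH x hx) (by linarith)
        have h2 := Real.rpow_pos_of_pos hx.1 (2 * s)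
        rw [Real.rpow_neg hx.1.le]
        calc _ ≤ (H x ^ (2 * s))⁻¹ * (κ⁻¹ ^ (d : ℝ) * H x ^ (2 * s)) := by gcongr
          _ = _ := by field_simp
  have hA : ∀ x ∈ Q, W x * ENNReal.ofReal ((u x - U x) ^ 2) ≤ K₀ * density s Ω u x := by
    intro x hx
    refine hWle x hx _ (ofReal_sq_sub_average_le hΩ hum hB (hQΩ x hx) (hδ0 x hx) hκ0 ?_ ?_)
    · have := hδH x hx
      have := hx.1
      rw [hκ]
      nlinarith [hδ0 x hx]
    · refine ball_subset_ball ?_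
      have := mul_le_mul_of_nonneg_left (hHδ x hx) hε0.le
      rw [← mul_assoc, hεM] at this
      linarith [hδ0 x hx]
  have hA' : ∀ x ∈ Q, W x * ENNReal.ofReal ((u x - U (T x)) ^ 2) ≤ K₀ * density s Ω u x := by
    intro x hx
    refine hWle x hx _ (ofReal_sq_sub_average_le hΩ hum hB (hQΩ x hx) (hδ0 x hx) hκ0 ?_ ?_)
    · have h1 := hδH x hx
      have := hx.1
      rw [hκ, hHT]
      have h2 : 1 / 2 * H x ≤ c * H x := by gcongr; linarith
      have h3 : ε * (1 / 2 * H x) ≤ ε * (c * H x) := by gcongr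
      nlinarith
    · refine ball_subset_ball' ?_
      have h1 := mul_le_mul_of_nonneg_left (hHδ x hx) hε0.le
      rw [← mul_assoc, hεM] at h1
      have h2 : dist (T x) x = ε * H x := by
        rw [dist_eq_norm, hT, add_sub_cancel_left, norm_smul, h.norm_dir, mul_one, hc,
          Real.norm_eq_abs, abs_mul, abs_of_pos hx.1]
        congr 1
        rw [sub_sub_cancel_left, abs_neg, abs_of_pos hε0]
      rw [h2, hHT]
      have h3 : ε * (c * H x) ≤ ε * H x := by
        have := hx.1
        gcongr
        nlinarith
      linarith
  have hdiff : ∀ x ∈ Q, W x * ENNReal.ofReal ((U x - U (T x)) ^ 2) ≤ 4 * K₀ * density s Ω u x := by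
    intro x hx
    have h1 := ofReal_add_sq_le (u x - U (T x)) (-(u x - U x))
    rw [neg_sq, show u x - U (T x) + -(u x - U x) = U x - U (T x) by ring] at h1
    calc _ ≤ W x * (2 * ENNReal.ofReal ((u x - U (T x)) ^ 2) +
          2 * ENNReal.ofReal ((u x - U x) ^ 2)) := by gcongr
      _ = 2 * (W x * ENNReal.ofReal ((u x - U (T x)) ^ 2)) +
          2 * (W x * ENNReal.ofReal ((u x - U x) ^ 2)) := by ring
      _ ≤ 2 * (K₀ * density s Ω u x) + 2 * (K₀ * density s Ω u x) := by
          exact add_le_add (mul_le_mul' le_rfl (hA' x hx)) (mul_le_mul' le_rfl (hA x hx))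
      _ = _ := by ring
  set F : E d → ℝ≥0∞ := Q.indicator fun x => W x * ENNReal.ofReal (U x ^ 2) with hF
  have hFm : Measurable F := Measurable.indicator (by fun_prop) hQm
  have hWT : ∀ x ∈ Q, W x = ENNReal.ofReal (c ^ (2 * s)) * W (T x) := by
    intro x hx
    have h2 := Real.rpow_pos_of_pos hc0 (2 * s)
    simp only [hW, hHT]
    rw [← ENNReal.ofReal_mul h2.le, Real.mul_rpow hc0.le hx.1.le, Real.rpow_neg hc0.le]
    congr 1
    field_simp
  have hpt : ∀ x, F x ≤ ENNReal.ofReal ((1 + η) * c ^ (2 * s)) * F (T x) +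
      K₁ * Q.indicator (density s Ω u) x := by
    intro x
    by_cases hx : x ∈ Q
    · simp only [hF, indicator_of_mem hx, indicator_of_mem (hTQ x hx)]
      have h1 := ofReal_add_sq_le_of_pos (U (T x)) (U x - U (T x)) hη0
      rw [add_sub_cancel] at h1
      calc _ ≤ W x * (ENNReal.ofReal (1 + η) * ENNReal.ofReal (U (T x) ^ 2) +
            ENNReal.ofReal (1 + η⁻¹) * ENNReal.ofReal ((U x - U (T x)) ^ 2)) := by gcongr
        _ = ENNReal.ofReal (1 + η) * (W x * ENNReal.ofReal (U (T x) ^ 2)) +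
            ENNReal.ofReal (1 + η⁻¹) * (W x * ENNReal.ofReal ((U x - U (T x)) ^ 2)) := by ring
        _ ≤ ENNReal.ofReal (1 + η) * (W x * ENNReal.ofReal (U (T x) ^ 2)) +
            ENNReal.ofReal (1 + η⁻¹) * (4 * K₀ * density s Ω u x) := by
            exact add_le_add le_rfl (mul_le_mul' le_rfl (hdiff x hx))
        _ = _ := by
            rw [hWT x hx, ENNReal.ofReal_mul (by positivity), hK₁]
            ring
    · simp only [hF, indicator_of_notMem hx, zero_le]
  set I := ∫⁻ x, F x with hI
  have hQint : ∫⁻ x, Q.indicator (density s Ω u) x ≤ nlSemiSq s Ω u := by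
    rw [lintegral_indicator hQm, ← setLIntegral_density]
    exact lintegral_mono_set fun x hx => hQΩ x hx
  have hIle : I ≤ ENNReal.ofReal θ * I + K₁ * nlSemiSq s Ω u := by
    calc I ≤ ∫⁻ x, (ENNReal.ofReal ((1 + η) * c ^ (2 * s)) * F (T x) +
          K₁ * Q.indicator (density s Ω u) x) := lintegral_mono hpt
      _ = ENNReal.ofReal ((1 + η) * c ^ (2 * s)) * (∫⁻ x, F (T x)) +
          K₁ * ∫⁻ x, Q.indicator (density s Ω u) x := by
          rw [lintegral_add_left (by fun_prop), lintegral_const_mul _ (by fun_prop),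
            lintegral_const_mul _ (hDm.indicator hQm)]
      _ ≤ ENNReal.ofReal ((1 + η) * c ^ (2 * s)) * (ENNReal.ofReal c⁻¹ * I) +
          K₁ * nlSemiSq s Ω u := by
          exact add_le_add (mul_le_mul' le_rfl
            (lintegral_comp_vertical_scaling hHc h.shift hc0 hFm).le) (mul_le_mul' le_rfl hQint)
      _ = _ := by
          rw [← mul_assoc, ← ENNReal.ofReal_mul (by positivity), hθ, hq, Real.rpow_sub_one hc0.ne']
          congr 3
          ring
  -- Finiteness, required for absorption, comes from the compact support: where `u ≠ 0` the height
  -- is at least `δ₁`, so `W u²` is bounded, and `W (u - U)²` is controlled by the density.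
  have hIt : I ≠ ⊤ := by
    have h1 : ∀ x, F x ≤ Q.indicator (fun _ => 2 * ENNReal.ofReal (δ₁ ^ (-(2 * s)) * B ^ 2)) x +
        2 * K₀ * Q.indicator (density s Ω u) x := by
      intro x
      by_cases hx : x ∈ Q
      · simp only [hF, indicator_of_mem hx]
        have h1 := ofReal_add_sq_le (u x) (-(u x - U x))
        rw [neg_sq, show u x + -(u x - U x) = U x by ring] at h1
        have h2 : W x * ENNReal.ofReal (u x ^ 2) ≤ ENNReal.ofReal (δ₁ ^ (-(2 * s)) * B ^ 2) := by
          by_cases hux : u x = 0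
          · simp [hux]
          · rw [hW, ← ENNReal.ofReal_mul (Real.rpow_nonneg hx.1.le _)]
            refine ENNReal.ofReal_le_ofReal ?_
            refine mul_le_mul ?_ ?_ (sq_nonneg _) (Real.rpow_nonneg hδ₁.le _)
            · exact Real.rpow_le_rpow_of_nonpos hδ₁ ((hsupp x hux).2.trans (hδH x hx)) (by linarith)
            · rw [← sq_abs (u x)]
              gcongr
              exact hB x
        calc _ ≤ W x * (2 * ENNReal.ofReal (u x ^ 2) + 2 * ENNReal.ofReal ((u x - U x) ^ 2)) := by
              gcongr
          _ = 2 * (W x * ENNReal.ofReal (u x ^ 2)) + 2 * (W x * ENNReal.ofReal ((u x - U x) ^ 2)) := by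
              ring
          _ ≤ 2 * ENNReal.ofReal (δ₁ ^ (-(2 * s)) * B ^ 2) + 2 * (K₀ * density s Ω u x) := by
              exact add_le_add (mul_le_mul' le_rfl h2) (mul_le_mul' le_rfl (hA x hx))
          _ = _ := by ring
      · simp only [hF, indicator_of_notMem hx, zero_le]
    refine ((lintegral_mono h1).trans_lt ?_).ne
    rw [lintegral_add_left (measurable_const.indicator hQm),
      lintegral_const_mul _ (hDm.indicator hQm), lintegral_indicator hQm, lintegral_const,
      Measure.restrict_apply_univ]
    refine ENNReal.add_lt_top.2 ⟨ENNReal.mul_lt_top (ENNReal.mul_lt_top (by simp)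
      ENNReal.ofReal_lt_top) ?_, ENNReal.mul_lt_top (ENNReal.mul_lt_top (by simp) hK₀t.lt_top)
      (hQint.trans_lt hfin.lt_top)⟩
    exact (measure_mono hQΩ).trans_lt hb.measure_lt_top
  have hIfin : I ≤ ENNReal.ofReal (1 - θ)⁻¹ * (K₁ * nlSemiSq s Ω u) :=
    le_of_le_mul_add_of_lt_one hθ0 hθ1 hIt hIle
  have hVQ : ball p (b / (1 + M)) ∩ Ω ⊆ Q := by
    rintro x ⟨hx, hxΩ⟩
    rw [mem_ball, dist_eq_norm, lt_div_iff₀' (by positivity)] at hx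
    have h0 : 0 < H x := by
      refine (h.mem_iff x ?_).1 hxΩ
      rw [mem_ball, dist_eq_norm]
      nlinarith [norm_nonneg (x - p)]
    have h1 := h.abs_le x
    rw [abs_of_pos h0] at h1
    refine ⟨h0, by nlinarith [norm_nonneg (x - p)], ?_⟩
    have h2 : ‖x - H x • e - p‖ ≤ ‖x - p‖ + ‖H x • e‖ := by
      rw [sub_right_comm]
      exact norm_sub_le _ _
    rw [norm_smul, h.norm_dir, mul_one, Real.norm_eq_abs, abs_of_pos h0] at h2
    linarith
  have hW1 : ∀ x ∈ Q, 1 ≤ W x := by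
    intro x hx
    rw [hW, ENNReal.one_le_ofReal]
    exact Real.one_le_rpow_of_pos_of_le_one_of_nonpos hx.1 (hx.2.1.le.trans hb1) (by linarith)
  calc ∫⁻ x in ball p (b / (1 + M)) ∩ Ω, ENNReal.ofReal (u x ^ 2)
      ≤ ∫⁻ x in Q, ENNReal.ofReal (u x ^ 2) := lintegral_mono_set hVQ
    _ = ∫⁻ x, Q.indicator (fun x => ENNReal.ofReal (u x ^ 2)) x := (lintegral_indicator hQm _).symm
    _ ≤ ∫⁻ x, (2 * K₀ * Q.indicator (density s Ω u) x + 2 * F x) := by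
        refine lintegral_mono fun x => ?_
        by_cases hx : x ∈ Q
        · simp only [hF, indicator_of_mem hx]
          have h1 := ofReal_add_sq_le (u x - U x) (U x)
          rw [sub_add_cancel] at h1
          refine h1.trans ?_
          rw [mul_assoc 2 K₀]
          refine add_le_add (mul_le_mul' le_rfl ?_) (mul_le_mul' le_rfl ?_)
          · exact le_trans (le_mul_of_one_le_left zero_le (hW1 x hx)) (hA x hx)
          · exact le_mul_of_one_le_left zero_le (hW1 x hx)
        · simp only [hF, indicator_of_notMem hx, zero_le]
    _ = 2 * K₀ * (∫⁻ x, Q.indicator (density s Ω u) x) + 2 * I := by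
        rw [lintegral_add_right _ (by fun_prop), lintegral_const_mul _ hFm,
          lintegral_const_mul _ (hDm.indicator hQm)]
    _ ≤ 2 * K₀ * nlSemiSq s Ω u + 2 * (ENNReal.ofReal (1 - θ)⁻¹ * (K₁ * nlSemiSq s Ω u)) := by
        gcongr
    _ = _ := by ring

end Poincare

/-! ### From the boundary to the whole domain. -/

section Poincare
open Filter Topology

variable {d : ℕ} {s : ℝ} {Ω : Set (E d)}

theorem PoincareOn.mono {S S' : Set (E d)} (h : PoincareOn s Ω S) (hS : S' ⊆ S) :
    PoincareOn s Ω S' := by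
  obtain ⟨C, hC, h⟩ := h
  exact ⟨C, hC, fun u hu hf =>
    (lintegral_mono_set (inter_subset_inter_left _ hS)).trans (h u hu hf)⟩

theorem PoincareOn.union {S S' : Set (E d)} (h : PoincareOn s Ω S) (h' : PoincareOn s Ω S') :
    PoincareOn s Ω (S ∪ S') := by
  obtain ⟨C, hC, h⟩ := h
  obtain ⟨C', hC', h'⟩ := h'
  refine ⟨C + C', ENNReal.add_ne_top.2 ⟨hC, hC'⟩, fun u hu hf => ?_⟩
  rw [union_inter_distrib_right, add_mul]
  exact (lintegral_union_le _ _ _).trans (add_le_add (h u hu hf) (h' u hu hf))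

/-- A small ball `S` around `z` lies in `B(ξ, δ(ξ))` for every `ξ` near `x`. Averaging `u(ξ)² ≤ 2
u(y)² + 2 (u(ξ) - u(y))²` over `y ∈ S` transfers the bound on `S` to a neighbourhood of `x`. -/
theorem PoincareOn.exists_of_dist_le (hd : 2 ≤ d) (hs0 : 0 < s) (hΩ : IsOpen Ω)
    (hb : Bornology.IsBounded Ω) {x z : E d} (hx : x ∈ Ω) (hz : dist z x ≤ bdist Ω x / 8)
    {V : Set (E d)} (hV : V ∈ 𝓝 z) (h : PoincareOn s Ω V) : ∃ V' ∈ 𝓝 x, PoincareOn s Ω V' := by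
  have hδ := bdist_pos hd hΩ hb hx
  set δ := bdist Ω x with hδdef
  obtain ⟨r, hr, hrV⟩ := Metric.mem_nhds_iff.1 hV
  obtain ⟨C, hC, hP⟩ := h
  set S := ball z (min r (δ / 8)) with hS
  have hS0 : volume S ≠ 0 := (measure_ball_pos _ _ (lt_min hr (by positivity))).ne'
  have hSt : volume S ≠ ⊤ := measure_ball_lt_top.ne
  have hSV : S ⊆ V := (ball_subset_ball (min_le_left _ _)).trans hrV
  have hSx : ∀ y ∈ S, dist y x < δ / 4 := by
    intro y hy
    have h1 : dist y z < δ / 8 := (mem_ball.1 hy).trans_le (min_le_right _ _)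
    linarith [dist_triangle y z x]
  have hSΩ : S ⊆ Ω := fun y hy => ball_bdist_subset hΩ hx (by
    rw [mem_ball]
    linarith [hSx y hy])
  -- For `ξ` within `δ/8` of `x`, `δ(ξ) ≤ 9δ/8 ≤ 2δ`.
  set K := ENNReal.ofReal ((2 * δ) ^ ((d : ℝ) + 2 * s)) with hK
  refine ⟨ball x (δ / 8), ball_mem_nhds _ (by positivity),
    (volume S)⁻¹ * (volume (ball x (δ / 8)) * (2 * C) + 2 * K),
    ENNReal.mul_ne_top (ENNReal.inv_ne_top.2 hS0) (ENNReal.add_ne_top.2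
      ⟨ENNReal.mul_ne_top measure_ball_lt_top.ne (ENNReal.mul_ne_top (by simp) hC),
        ENNReal.mul_ne_top (by simp) ENNReal.ofReal_ne_top⟩), fun u hu hf => ?_⟩
  have hum := hu.1
  have hPS : ∫⁻ y in S, ENNReal.ofReal (u y ^ 2) ≤ C * nlSemiSq s Ω u :=
    (lintegral_mono_set (subset_inter hSV hSΩ)).trans (hP u hu hf)
  have hpt : ∀ ξ ∈ ball x (δ / 8) ∩ Ω, volume S * ENNReal.ofReal (u ξ ^ 2) ≤
      2 * C * nlSemiSq s Ω u + 2 * K * density s Ω u ξ := by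
    rintro ξ ⟨hξ, hξΩ⟩
    rw [mem_ball] at hξ
    have hξδ := bdist_pos hd hΩ hb hξΩ
    have h1 : δ ≤ bdist Ω ξ + dist x ξ := bdist_le_add_dist x ξ
    have h2 : bdist Ω ξ ≤ δ + dist ξ x := bdist_le_add_dist ξ x
    rw [dist_comm] at h1
    have hSξ : S ⊆ Ω ∩ ball ξ (bdist Ω ξ) := fun y hy => ⟨hSΩ hy, by
      rw [mem_ball]
      linarith [hSx y hy, dist_triangle_right y ξ x]⟩
    calc volume S * ENNReal.ofReal (u ξ ^ 2) = ∫⁻ _ in S, ENNReal.ofReal (u ξ ^ 2) := by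
          rw [setLIntegral_const, mul_comm]
      _ ≤ ∫⁻ y in S, (2 * ENNReal.ofReal (u y ^ 2) + 2 * ENNReal.ofReal ((u ξ - u y) ^ 2)) := by
          refine lintegral_mono fun y => ?_
          have := ofReal_add_sq_le (u y) (u ξ - u y)
          rwa [add_sub_cancel] at this
      _ = 2 * (∫⁻ y in S, ENNReal.ofReal (u y ^ 2)) +
          2 * ∫⁻ y in S, ENNReal.ofReal ((u ξ - u y) ^ 2) := by
          rw [lintegral_add_left (by fun_prop), lintegral_const_mul _ (by fun_prop),
            lintegral_const_mul _ (by fun_prop)]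
      _ ≤ 2 * (C * nlSemiSq s Ω u) + 2 * (K * density s Ω u ξ) := by
          refine add_le_add (mul_le_mul' le_rfl hPS) (mul_le_mul' le_rfl ?_)
          refine (lintegral_mono_set hSξ).trans ?_
          rw [setLIntegral_sq_eq_density (s := s) hξδ, hK]
          gcongr
          linarith
      _ = _ := by ring
  have hmeas : MeasurableSet (ball x (δ / 8) ∩ Ω) := measurableSet_ball.inter hΩ.measurableSet
  have hDm := measurable_density (s := s) (Ω := Ω) hum
  have key : volume S * ∫⁻ ξ in ball x (δ / 8) ∩ Ω, ENNReal.ofReal (u ξ ^ 2) ≤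
      (volume (ball x (δ / 8)) * (2 * C) + 2 * K) * nlSemiSq s Ω u := by
    rw [← lintegral_const_mul _ (by fun_prop)]
    refine (setLIntegral_mono (by fun_prop) hpt).trans ?_
    rw [lintegral_add_left measurable_const, setLIntegral_const, lintegral_const_mul _ hDm, add_mul]
    refine add_le_add ?_ (mul_le_mul' le_rfl ?_)
    · calc _ ≤ 2 * C * nlSemiSq s Ω u * volume (ball x (δ / 8)) := by
            gcongr
            exact inter_subset_left
        _ = _ := by ring
    · exact lintegral_mono_set inter_subset_right
  calc _ = (volume S)⁻¹ * (volume S * ∫⁻ ξ in ball x (δ / 8) ∩ Ω, ENNReal.ofReal (u ξ ^ 2)) := by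
        rw [← mul_assoc, ENNReal.inv_mul_cancel hS0 hSt, one_mul]
    _ ≤ (volume S)⁻¹ * ((volume (ball x (δ / 8)) * (2 * C) + 2 * K) * nlSemiSq s Ω u) := by
        gcongr
    _ = _ := by ring

/-- The set of good points is open and contains `∂Ω`, hence a layer of width `δ₀`. Going an eighth
of the way to a nearest boundary point shrinks `δ` by the factor `7/8`, so each point of `Ω` reaches
the layer in finitely many steps. -/
theorem exists_poincareOn_nhds (hd : 2 ≤ d) (hs0 : 0 < s) (hs : 1 < 2 * s)
    (hb : Bornology.IsBounded Ω) (hΩ : IsLipschitzDomain Ω) {x : E d} (hx : x ∈ closure Ω) :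
    ∃ V ∈ 𝓝 x, PoincareOn s Ω V := by
  set G : Set (E d) := {x | ∃ V ∈ 𝓝 x, PoincareOn s Ω V} with hG
  have hGo : IsOpen G := by
    rw [isOpen_iff_mem_nhds]
    rintro y ⟨V, hV, hP⟩
    filter_upwards [eventually_mem_nhds_iff.2 hV] with z hz using ⟨V, hz, hP⟩
  have hfr : frontier Ω ⊆ G := fun p hp => by
    obtain ⟨H, e, M, r, h⟩ := hΩ.exists_isHeight hp
    exact h.poincareOn hd hs hΩ.1 hb hp
  by_cases hxΩ : x ∈ Ω
  swap
  · exact hfr (by rw [hΩ.1.frontier_eq]; exact ⟨hx, hxΩ⟩)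
  have hfne : (frontier Ω).Nonempty := frontier_nonempty hd hb ⟨x, hxΩ⟩
  obtain ⟨δ₀, hδ₀, hthick⟩ := hΩ.2.1.exists_thickening_subset_open hGo hfr
  have key : ∀ n : ℕ, ∀ y ∈ Ω, bdist Ω y < (8 / 7 : ℝ) ^ n * δ₀ → y ∈ G := by
    intro n
    induction n with
    | zero =>
      intro y _ hy
      refine hthick ((mem_thickening_iff_infDist_lt hfne).2 ?_)
      simpa [bdist] using hy
    | succ n ih =>
      intro y hy hlt
      obtain ⟨p, hp, hpd⟩ := hΩ.2.1.exists_infDist_eq_dist hfne y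
      have hδ := bdist_pos hd hΩ.1 hb hy
      have hpd' : bdist Ω y = dist y p := hpd
      set z : E d := y + (1 / 8 : ℝ) • (p - y) with hz
      have hzy : dist z y = bdist Ω y / 8 := by
        rw [hz, dist_eq_norm, add_sub_cancel_left, norm_smul, hpd', dist_comm y p, dist_eq_norm]
        norm_num
        ring
      have hzp : bdist Ω z ≤ 7 / 8 * bdist Ω y := by
        refine (infDist_le_dist_of_mem hp).trans_eq ?_
        have : z - p = (7 / 8 : ℝ) • (y - p) := by
          rw [hz]
          module
        rw [dist_eq_norm, this, norm_smul, hpd', dist_eq_norm]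
        norm_num
      have hzΩ : z ∈ Ω := ball_bdist_subset hΩ.1 hy (by rw [mem_ball, hzy]; linarith)
      obtain ⟨V, hV, hP⟩ := ih z hzΩ (by
        rw [pow_succ] at hlt
        linarith)
      exact hP.exists_of_dist_le hd hs0 hΩ.1 hb hy hzy.le hV
  obtain ⟨n, hn⟩ := pow_unbounded_of_one_lt (bdist Ω x / δ₀) (show (1 : ℝ) < 8 / 7 by norm_num)
  exact key n x hxΩ ((div_lt_iff₀ hδ₀).1 hn)

/-- Poincaré inequality for functions with compact support. -/
theorem exists_poincare (hd : 2 ≤ d) (hs0 : 0 < s) (hs : 1 < 2 * s)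
    (hb : Bornology.IsBounded Ω) (hΩ : IsLipschitzDomain Ω) : PoincareOn s Ω (closure Ω) := by
  refine hb.isCompact_closure.induction_on (p := PoincareOn s Ω) ⟨0, by simp, by simp⟩
    (fun _ _ h h' => h'.mono h) (fun _ _ h h' => h.union h') fun x hx => ?_
  obtain ⟨V, hV, hP⟩ := exists_poincareOn_nhds hd hs0 hs hb hΩ hx
  exact ⟨V, mem_nhdsWithin_of_mem_nhds hV, hP⟩

/-- Poincaré inequality on the nonlocal space with zero boundary values. -/
theorem exists_nlNorm_sq_le_of_mem_nlSpaceZero (hd : 2 ≤ d) (hs0 : 0 < s) (hs1 : s < 1)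
    (hs : 1 < 2 * s) (hb : Bornology.IsBounded Ω) (hΩ : IsLipschitzDomain Ω) :
    ∃ C : ℝ≥0∞, C ≠ ⊤ ∧ ∀ w ∈ nlSpaceZero s Ω, nlNorm s Ω (w : L2 Ω) ^ 2 ≤ C * nlSemiSq s Ω w := by
  obtain ⟨C, hC, hP⟩ := exists_poincare (s := s) hd hs0 hs hb hΩ
  have hg : ∀ g : L2 Ω, (∃ g₀ ∈ lipschitzCc Ω, g =ᵐ[volume.restrict Ω] g₀) →
      eLpNorm g 2 (volume.restrict Ω) ^ 2 ≤ C * nlSemiSq s Ω g := by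
    rintro g ⟨g₀, ⟨⟨L, hL⟩, K, hK, hKΩ, h0⟩, hgg⟩
    -- The values of `g₀` outside `Ω` are arbitrary; cutting them off makes it a test function.
    set u : E d → ℝ := Ω.indicator g₀ with hu
    have hug : g =ᵐ[volume.restrict Ω] u := by
      filter_upwards [hgg, ae_restrict_mem hΩ.1.measurableSet] with x hx hxΩ
      rw [hx, hu, indicator_of_mem hxΩ]
    have huL : LipschitzOnWith L u Ω := fun x hx y hy => by
      rw [hu, indicator_of_mem hx, indicator_of_mem hy]
      exact hL hx hy
    have hu0 : ∀ x ∉ K, u x = 0 := fun x hx => by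
      by_cases hxΩ : x ∈ Ω
      · rw [hu, indicator_of_mem hxΩ, h0 x hxΩ hx]
      · rw [hu, indicator_of_notMem hxΩ]
    have hum : Measurable u := by
      obtain ⟨g', hg', he⟩ := hL.extend_real
      rw [hu, indicator_congr he]
      exact hg'.continuous.measurable.indicator hΩ.1.measurableSet
    have hub : ∃ B, ∀ x, |u x| ≤ B := by
      obtain ⟨B, hB⟩ := hK.exists_bound_of_continuousOn (huL.continuousOn.mono hKΩ)
      refine ⟨max B 0, fun x => ?_⟩
      by_cases hxK : x ∈ K
      · exact (hB x hxK).trans (le_max_left _ _)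
      · simp [hu0 x hxK]
    have hfin : nlSemiSq s Ω u ≠ ⊤ := (nlSemiSq_lt_top_of_lipschitz hd hs1 hΩ.1 hb huL).ne
    have := hP u ⟨hum, hub, K, hK, hKΩ, hu0⟩ hfin
    rw [inter_eq_self_of_subset_right subset_closure, ← eLpNorm_two_sq] at this
    rwa [eLpNorm_congr_ae hug, nlSemiSq_congr hug]
  refine ⟨4 * C + 1, ENNReal.add_ne_top.2 ⟨ENNReal.mul_ne_top (by simp) hC, by simp⟩, ?_⟩
  intro w hw
  rw [nlNorm_sq, add_mul, one_mul]
  refine add_le_add ?_ le_rfl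
  -- Poincaré for an approximant `g`, with both sides compared to `w`; the error in `w - g` tends to
  -- zero and the constant `4C` remains.
  have hsq : ∀ g : L2 Ω, (∃ g₀ ∈ lipschitzCc Ω, g =ᵐ[volume.restrict Ω] g₀) →
      eLpNorm w 2 (volume.restrict Ω) ^ 2 ≤
        (2 + 4 * C) * nlNorm s Ω (w - g : L2 Ω) ^ 2 + 4 * C * nlSemiSq s Ω w := by
    intro g hgD
    have h1 : eLpNorm w 2 (volume.restrict Ω) ^ 2 ≤
        2 * eLpNorm (w - g : L2 Ω) 2 (volume.restrict Ω) ^ 2 +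
          2 * eLpNorm g 2 (volume.restrict Ω) ^ 2 := by
      simp only [eLpNorm_two_sq]
      have hm := measurable_coe (w - g)
      have hm' := measurable_coe g
      rw [← lintegral_const_mul _ (by fun_prop), ← lintegral_const_mul _ (by fun_prop),
        ← lintegral_add_left (by fun_prop)]
      refine lintegral_mono_ae ?_
      filter_upwards [Lp.coeFn_sub w g] with x hx
      have := ofReal_add_sq_le ((w - g : L2 Ω) x) (g x)
      rw [hx, Pi.sub_apply, sub_add_cancel] at this
      rwa [hx, Pi.sub_apply]
    have h2 : nlSemiSq s Ω g ≤ 2 * (nlSemiSq s Ω w + nlSemiSq s Ω (w - g : L2 Ω)) := by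
      have hm := measurable_coe (w - g)
      have h3 := nlSemiSq_add_le (s := s) (Ω := Ω) (measurable_coe w) (v := (-1 : ℝ) • ⇑(w - g))
        (hm.const_smul _)
      rw [nlSemiSq_smul, show ENNReal.ofReal ((-1) ^ 2) = 1 by norm_num, one_mul] at h3
      refine le_trans (le_of_eq (nlSemiSq_congr ?_)) h3
      filter_upwards [Lp.coeFn_sub w g] with x hx
      rw [Pi.add_apply, Pi.smul_apply, hx, Pi.sub_apply, smul_eq_mul]
      ring
    calc _ ≤ 2 * nlNorm s Ω (w - g : L2 Ω) ^ 2 + 2 * (C * (2 * (nlSemiSq s Ω w +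
          nlNorm s Ω (w - g : L2 Ω) ^ 2))) := by
          refine h1.trans (add_le_add ?_ ?_)
          · gcongr
            exact eLpNorm_le_nlNorm _
          · refine mul_le_mul' le_rfl ((hg g hgD).trans (mul_le_mul' le_rfl (h2.trans ?_)))
            gcongr
            exact nlSemiSq_le_nlNorm_sq _
      _ = _ := by ring
  have hCt : (2 + 4 * C) ≠ ⊤ := ENNReal.add_ne_top.2 ⟨by simp, ENNReal.mul_ne_top (by simp) hC⟩
  have hlim : Tendsto (fun ε : ℝ≥0∞ => (2 + 4 * C) * ε ^ 2 + 4 * C * nlSemiSq s Ω w) (𝓝[>] 0)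
      (𝓝 (4 * C * nlSemiSq s Ω w)) := by
    have h1 : Tendsto (fun ε : ℝ≥0∞ => (2 + 4 * C) * ε ^ 2) (𝓝 0) (𝓝 ((2 + 4 * C) * 0 ^ 2)) :=
      ENNReal.Tendsto.const_mul ((ENNReal.continuous_pow 2).tendsto 0) (Or.inr hCt)
    have h2 := h1.add_const (4 * C * nlSemiSq s Ω w)
    simp only [ne_eq, OfNat.ofNat_ne_zero, not_false_eq_true, zero_pow, mul_zero, zero_add] at h2
    exact h2.mono_left nhdsWithin_le_nhds
  refine ge_of_tendsto hlim (eventually_nhdsWithin_of_forall fun ε hε => ?_)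
  obtain ⟨g, hgD, hN⟩ := hw ε hε
  refine (hsq g hgD).trans ?_
  gcongr

end Poincare

/-! ### Mollification into an interior cone. -/

section Approximation
open Filter Topology

/-- Continuity of translations in `L²`. The parametrized shift `σ` covers the diagonal shifts `(τ,
τ)` of the product space, which preserve `y - x`. -/
theorem tendsto_eLpNorm_translate {Z G : Type*} [TopologicalSpace Z] [NormedAddCommGroup G]
    [MeasurableSpace G] [BorelSpace G] {μ : Measure G} [μ.IsAddRightInvariant]
    [μ.InnerRegularCompactLTTop] [IsLocallyFiniteMeasure μ] {f : G → ℝ}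
    (hf : MemLp f 2 μ) {σ : Z → G} (hσ : Continuous σ) {z : Z} (hz : σ z = 0) :
    Tendsto (fun τ => eLpNorm (fun x => f (x - σ τ) - f x) 2 μ) (𝓝 z) (𝓝 0) := by
  set g : C(Z, C(G, G)) :=
    (ContinuousMap.mk (fun q : Z × G => q.2 - σ q.1) (by fun_prop)).curry with hg
  have hgm : ∀ τ, MeasurePreserving (g τ) μ μ := fun τ => measurePreserving_sub_right μ (σ τ)
  have h1 := Filter.Tendsto.compMeasurePreservingLp (l := 𝓝 z)
    (tendsto_const_nhds (x := hf.toLp f)) (g.continuous.tendsto z) hgm (hgm z)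
    (by norm_num : (2 : ℝ≥0∞) ≠ ⊤)
  have h2 := tendsto_iff_edist_tendsto_0.1 h1
  refine h2.congr fun τ => ?_
  rw [Lp.edist_def]
  refine eLpNorm_congr_ae ?_
  filter_upwards [Lp.coeFn_compMeasurePreserving (hf.toLp f) (hgm τ),
    Lp.coeFn_compMeasurePreserving (hf.toLp f) (hgm z),
    (hgm τ).quasiMeasurePreserving.ae hf.coeFn_toLp,
    (hgm z).quasiMeasurePreserving.ae hf.coeFn_toLp] with x h1 h2 h3 h4
  rw [Pi.sub_apply, h1, h2]
  simp only [Function.comp]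
  rw [h3, h4]
  simp [hg, hz]

/-- Jensen in the inner integral, then Tonelli: averaging over a probability measure preserves a
uniform `L²` bound. -/
theorem lintegral_sq_integral_le {X Y : Type*} [MeasurableSpace X] [MeasurableSpace Y]
    {μ : Measure X} [SFinite μ] {ν : Measure Y} [IsProbabilityMeasure ν] {f : X → Y → ℝ}
    (hf : Measurable (Function.uncurry f)) {C : ℝ≥0∞}
    (hC : ∀ᵐ y ∂ν, ∫⁻ x, ENNReal.ofReal (f x y ^ 2) ∂μ ≤ C) :
    ∫⁻ x, ENNReal.ofReal ((∫ y, f x y ∂ν) ^ 2) ∂μ ≤ C := by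
  calc _ ≤ ∫⁻ x, ∫⁻ y, ENNReal.ofReal (f x y ^ 2) ∂ν ∂μ := by
        refine lintegral_mono fun x => ofReal_sq_integral_le ?_
        exact hf.of_uncurry_left.aestronglyMeasurable
    _ = ∫⁻ y, ∫⁻ x, ENNReal.ofReal (f x y ^ 2) ∂μ ∂ν := by
        refine lintegral_lintegral_swap ?_
        have : Measurable (Function.uncurry fun x y => ENNReal.ofReal (f x y ^ 2)) := by
          have h := (hf.pow_const 2).ennreal_ofReal
          exact h
        exact this.aemeasurable
    _ ≤ ∫⁻ _, C ∂ν := lintegral_mono_ae hC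
    _ = C := by simp

variable {d : ℕ} {s : ℝ} {Ω : Set (E d)}

theorem ofReal_rpow_half_sq (a : ℝ) {r : ℝ} (hr : 0 ≤ r) (P : ℝ) :
    (a / r ^ (P / 2)) ^ 2 = a ^ 2 / r ^ P := by
  rw [div_pow, ← Real.rpow_mul_natCast hr]
  congr 2
  norm_num

/-- Approximation of a function of finite Gagliardo energy by smooth functions, near a point of
the closure at which the interior cone property holds. -/
theorem HasInteriorCone.exists_contDiff_approx (hΩ : IsOpen Ω) (hb : Bornology.IsBounded Ω)
    {p : E d} (hp : HasInteriorCone Ω p) {φ : L2 Ω} (hφ : MemFracSobolev s Ω φ) :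
    ∃ r > 0, ∀ ε : ℝ≥0∞, 0 < ε → ∃ g : E d → ℝ, ContDiff ℝ 1 g ∧
      ∫⁻ x in Ω, ENNReal.ofReal ((g x - φ x) ^ 2) ≤ ε ∧
      ∫⁻ q in (Ω ∩ ball p r) ×ˢ (Ω ∩ ball p r),
        ENNReal.ofReal (((g q.2 - φ q.2) - (g q.1 - φ q.1)) ^ 2 /
          ‖q.2 - q.1‖ ^ ((d : ℝ) + 2 * s)) ≤ ε := by
  obtain ⟨e, c, r, t₀, hc, hr, ht₀, hcone⟩ := hp
  refine ⟨r, hr, fun ε hε => ?_⟩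
  have hφm := measurable_coe φ
  have hΩm := hΩ.measurableSet
  set P : ℝ := (d : ℝ) + 2 * s with hP
  set φ₀ : E d → ℝ := Ω.indicator φ with hφ₀
  have hφ₀m : Measurable φ₀ := hφm.indicator hΩm
  have hφ₀L : MemLp φ₀ 2 volume := (memLp_indicator_iff_restrict hΩm).2 (Lp.memLp φ)
  have hφ₀i : Integrable φ₀ volume := by
    refine (integrable_indicator_iff hΩm).2 ?_
    have : IsFiniteMeasure (volume.restrict Ω) := ⟨by simpa using hb.measure_lt_top⟩
    exact (Lp.memLp φ).integrable (by norm_num)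
  -- The difference quotient whose `L²` norm on the product is the Gagliardo seminorm. Its diagonal
  -- translates approximate it in `L²`, so the singular denominator never has to be estimated.
  set F : E d × E d → ℝ := (Ω ×ˢ Ω).indicator
    (fun q => (φ q.2 - φ q.1) / ‖q.2 - q.1‖ ^ (P / 2)) with hF
  have hFm : Measurable F := Measurable.indicator (by fun_prop) (hΩm.prod hΩm)
  have hFL : MemLp F 2 volume := by
    refine ⟨hFm.aestronglyMeasurable, ?_⟩
    have h1 : eLpNorm F 2 volume ^ 2 < ⊤ := by
      rw [eLpNorm_two_sq]
      have h2 : ∀ q, ENNReal.ofReal (F q ^ 2) = (Ω ×ˢ Ω).indicator (fun q => ENNReal.ofReal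
          (|φ q.2 - φ q.1| ^ 2 / ‖q.2 - q.1‖ ^ P)) q := by
        intro q
        by_cases hq : q ∈ Ω ×ˢ Ω
        · rw [hF, indicator_of_mem hq, indicator_of_mem hq,
            ofReal_rpow_half_sq _ (norm_nonneg _), sq_abs]
        · simp [hF, hq]
      simp only [h2]
      rw [lintegral_indicator (hΩm.prod hΩm), Measure.volume_eq_prod, ← Measure.prod_restrict,
        lintegral_prod _ (by fun_prop)]
      exact hφ
    by_contra hcon
    rw [not_lt, top_le_iff] at hcon
    simp [hcon] at h1
  obtain ⟨ε', hε', hε'2⟩ : ∃ ε' : ℝ≥0∞, 0 < ε' ∧ ε' ^ 2 ≤ ε :=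
    ⟨min 1 ε, lt_min one_pos hε, by
      rw [sq]
      calc min 1 ε * min 1 ε ≤ 1 * ε := mul_le_mul' (min_le_left _ _) (min_le_right _ _)
        _ = ε := one_mul _⟩
  have hev1 := (tendsto_eLpNorm_translate hφ₀L continuous_id (z := 0) rfl).eventually
    (gt_mem_nhds hε')
  have : (volume : Measure (E d × E d)).IsAddRightInvariant :=
    inferInstanceAs ((volume : Measure (E d)).prod (volume : Measure (E d))).IsAddRightInvariant
  have hev2 := (tendsto_eLpNorm_translate hFL (σ := fun τ : E d => (τ, τ)) (by fun_prop)
    (z := 0) rfl).eventually (gt_mem_nhds hε')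
  obtain ⟨η, hη, hηb⟩ := Metric.eventually_nhds_iff.1 (hev1.and hev2)
  obtain ⟨t, ht0, htt, htη⟩ : ∃ t : ℝ, 0 < t ∧ t < t₀ ∧ t * (‖e‖ + c) < η := by
    have hpos : 0 < ‖e‖ + c := by positivity
    refine ⟨min (t₀ / 2) (η / (2 * (‖e‖ + c))), by positivity,
      (min_le_left _ _).trans_lt (by linarith), ?_⟩
    calc _ ≤ η / (2 * (‖e‖ + c)) * (‖e‖ + c) := by gcongr; exact min_le_right _ _
      _ = η / 2 := by field_simp
      _ < η := by linarith
  -- The bump is centred at `-t e` because convolution samples `φ₀` at `x - τ`: for `τ` in the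
  -- support, `-τ` lies in the ball of radius `c t` around `t e`, so `x - τ ∈ Ω` by the cone
  -- property.
  let ρ : ContDiffBump (-(t • e)) := ⟨c * t / 2, c * t, by positivity, by
    have : 0 < c * t := by positivity
    linarith⟩
  set k : E d → ℝ := ρ.normed volume with hk
  have hk0 : ∀ x, 0 ≤ k x := ρ.nonneg_normed
  have hkc : Continuous k := ρ.continuous_normed
  have hksupp : ∀ τ, k τ ≠ 0 → dist τ (-(t • e)) < c * t := by
    intro τ hτ
    have : τ ∈ Function.support k := hτ
    rw [hk, ρ.support_normed_eq] at this
    exact this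
  set ν : Measure (E d) := volume.withDensity fun τ => ENNReal.ofReal (k τ) with hν
  have hνp : IsProbabilityMeasure ν := ⟨by
    rw [hν, withDensity_apply _ MeasurableSet.univ, Measure.restrict_univ,
      ← ofReal_integral_eq_lintegral_ofReal ρ.integrable_normed (Eventually.of_forall hk0),
      ρ.integral_normed, ENNReal.ofReal_one]⟩
  have hνae : ∀ᵐ τ ∂ν, dist τ (-(t • e)) < c * t := by
    rw [hν, ae_withDensity_iff (by fun_prop)]
    refine Eventually.of_forall fun τ hτ => hksupp τ fun h => hτ ?_
    simp [h]
  have hνint : ∀ h : E d → ℝ, ∫ τ, h τ ∂ν = ∫ τ, k τ * h τ := by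
    intro h
    rw [hν, integral_withDensity_eq_integral_toReal_smul (by fun_prop)
      (Eventually.of_forall fun _ => ENNReal.ofReal_lt_top)]
    refine integral_congr_ae (Eventually.of_forall fun τ => ?_)
    simp [hk0 τ]
  have hνi : ∀ x, Integrable (fun τ => φ₀ (x - τ)) ν := by
    intro x
    rw [hν, integrable_withDensity_iff_integrable_smul' (by fun_prop)
      (Eventually.of_forall fun _ => ENNReal.ofReal_lt_top)]
    obtain ⟨B, hB⟩ := ρ.hasCompactSupport_normed.exists_bound_of_continuous (f := k) hkc
    refine ((hφ₀i.comp_sub_left x).bdd_mul hkc.aestronglyMeasurable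
      (Eventually.of_forall hB)).congr (Eventually.of_forall fun τ => ?_)
    simp [hk0 τ]
  set g : E d → ℝ := fun x => ∫ τ, φ₀ (x - τ) ∂ν with hg
  have hgC : ContDiff ℝ 1 g := by
    have h1 := ρ.hasCompactSupport_normed.contDiff_convolution_left (𝕜 := ℝ) (μ := volume)
      (ContinuousLinearMap.lsmul ℝ ℝ) (n := 1) (f := k) ρ.contDiff_normed hφ₀i.locallyIntegrable
    have h2 : g = convolution k φ₀ (ContinuousLinearMap.lsmul ℝ ℝ) volume :=
      funext fun x => hνint _
    rw [h2]
    exact_mod_cast h1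
  have hwint : ∀ x, g x - φ₀ x = ∫ τ, (φ₀ (x - τ) - φ₀ x) ∂ν := by
    intro x
    rw [integral_sub (hνi x) (integrable_const _), integral_const, probReal_univ, one_smul]
  have hτη : ∀ᵐ τ ∂ν, dist τ 0 < η := by
    filter_upwards [hνae] with τ hτ
    refine lt_of_le_of_lt ?_ htη
    rw [dist_zero_right]
    rw [dist_eq_norm, sub_neg_eq_add] at hτ
    have h1 := norm_sub_le (τ + t • e) (t • e)
    rw [add_sub_cancel_right, norm_smul, Real.norm_eq_abs, abs_of_pos ht0] at h1
    linarith
  have hmemΩ : ∀ᵐ τ ∂ν, ∀ x ∈ Ω ∩ ball p r, x - τ ∈ Ω := by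
    filter_upwards [hνae] with τ hτ x hx
    have := hcone x hx t ⟨ht0, htt⟩ (-τ) (by
      rw [mem_closedBall, ← dist_neg_neg, neg_neg]
      exact hτ.le)
    rwa [← sub_eq_add_neg] at this
  refine ⟨g, hgC, ?_, ?_⟩
  · calc _ = ∫⁻ x in Ω, ENNReal.ofReal ((∫ τ, (φ₀ (x - τ) - φ₀ x) ∂ν) ^ 2) := by
          refine setLIntegral_congr_fun hΩm fun x hx => ?_
          beta_reduce
          rw [← hwint x, hφ₀, indicator_of_mem hx]
      _ ≤ ∫⁻ x, ENNReal.ofReal ((∫ τ, (φ₀ (x - τ) - φ₀ x) ∂ν) ^ 2) := setLIntegral_le_lintegral _ _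
      _ ≤ ε := by
          refine lintegral_sq_integral_le (f := fun x τ => φ₀ (x - τ) - φ₀ x) ?_ ?_
          · exact (hφ₀m.comp (measurable_fst.sub measurable_snd)).sub (hφ₀m.comp measurable_fst)
          · filter_upwards [hτη] with τ hτ
            rw [← eLpNorm_two_sq]
            refine le_trans ?_ hε'2
            gcongr
            exact (hηb hτ).1.le
  · have hBm : MeasurableSet ((Ω ∩ ball p r) ×ˢ (Ω ∩ ball p r)) :=
      (hΩm.inter measurableSet_ball).prod (hΩm.inter measurableSet_ball)
    calc _ = ∫⁻ q in (Ω ∩ ball p r) ×ˢ (Ω ∩ ball p r),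
          ENNReal.ofReal ((∫ τ, (F (q - (τ, τ)) - F q) ∂ν) ^ 2) := by
          refine setLIntegral_congr_fun hBm fun q hq => ?_
          have h1 : ∫ τ, (F (q - (τ, τ)) - F q) ∂ν =
              ((g q.2 - φ q.2) - (g q.1 - φ q.1)) / ‖q.2 - q.1‖ ^ (P / 2) := by
            -- Both pairs of points stay in `Ω × Ω`, so the cut-off in `F` is inactive and the
            -- denominators agree.
            have h2 : ∀ᵐ τ ∂ν, F (q - (τ, τ)) - F q =
                ((φ₀ (q.2 - τ) - φ₀ q.2) - (φ₀ (q.1 - τ) - φ₀ q.1)) / ‖q.2 - q.1‖ ^ (P / 2) := by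
              filter_upwards [hmemΩ] with τ hτ
              have m1 : q - (τ, τ) ∈ Ω ×ˢ Ω := ⟨hτ _ hq.1, hτ _ hq.2⟩
              have m2 : q ∈ Ω ×ˢ Ω := ⟨hq.1.1, hq.2.1⟩
              have m3 := hτ _ hq.1
              have m4 := hτ _ hq.2
              simp only [hF, indicator_of_mem m1, indicator_of_mem m2, hφ₀, indicator_of_mem m3,
                indicator_of_mem m4, indicator_of_mem hq.1.1, indicator_of_mem hq.2.1,
                Prod.fst_sub, Prod.snd_sub, sub_sub_sub_cancel_right]
              ring
            have h3 : ∫ τ, ((φ₀ (q.2 - τ) - φ₀ q.2) - (φ₀ (q.1 - τ) - φ₀ q.1)) ∂ν =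
                (g q.2 - φ₀ q.2) - (g q.1 - φ₀ q.1) := by
              rw [hwint, hwint]
              exact integral_sub ((hνi _).sub (integrable_const _))
                ((hνi _).sub (integrable_const _))
            rw [integral_congr_ae h2, integral_div, h3]
            simp only [hφ₀, indicator_of_mem hq.1.1, indicator_of_mem hq.2.1]
          simp only [h1]
          rw [ofReal_rpow_half_sq _ (norm_nonneg _)]
      _ ≤ ∫⁻ q, ENNReal.ofReal ((∫ τ, (F (q - (τ, τ)) - F q) ∂ν) ^ 2) :=
          setLIntegral_le_lintegral _ _
      _ ≤ ε := by
          refine lintegral_sq_integral_le (f := fun q τ => F (q - (τ, τ)) - F q) ?_ ?_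
          · exact (hFm.comp (measurable_fst.sub (measurable_snd.prodMk measurable_snd))).sub
              (hFm.comp measurable_fst)
          · filter_upwards [hτη] with τ hτ
            rw [← eLpNorm_two_sq]
            refine le_trans ?_ hε'2
            gcongr
            exact (hηb hτ).2.le

end Approximation

/-! ### Sobolev functions and compactly supported functions in the nonlocal spaces. -/

section Density
open Filter Topology Manifold

variable {d : ℕ} {s : ℝ} {Ω : Set (E d)}

theorem lintegral_lintegral_sq_add_sq {κ : ℝ} (hκ : 0 ≤ κ) {w : E d → ℝ} (hw : Measurable w) :
    ∫⁻ x in Ω, ∫⁻ y in Ω, ENNReal.ofReal (κ * (2 * w x ^ 2 + 2 * w y ^ 2)) =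
      ENNReal.ofReal (4 * κ) * volume Ω * ∫⁻ x in Ω, ENNReal.ofReal (w x ^ 2) := by
  have h1 : ∀ x y, ENNReal.ofReal (κ * (2 * w x ^ 2 + 2 * w y ^ 2)) =
      ENNReal.ofReal (2 * κ) * (ENNReal.ofReal (w x ^ 2) + ENNReal.ofReal (w y ^ 2)) := by
    intro x y
    rw [← ENNReal.ofReal_add (sq_nonneg _) (sq_nonneg _), ← ENNReal.ofReal_mul (by positivity)]
    congr 1
    ring
  have h4 : ENNReal.ofReal (4 * κ) = 2 * ENNReal.ofReal (2 * κ) := by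
    rw [show (2 : ℝ≥0∞) = ENNReal.ofReal 2 by simp, ← ENNReal.ofReal_mul two_pos.le]
    congr 1
    ring
  have h2 : ∀ x, ∫⁻ y in Ω, ENNReal.ofReal (κ * (2 * w x ^ 2 + 2 * w y ^ 2)) =
      ENNReal.ofReal (2 * κ) * (ENNReal.ofReal (w x ^ 2) * volume Ω +
        ∫⁻ y in Ω, ENNReal.ofReal (w y ^ 2)) := by
    intro x
    simp only [h1]
    rw [lintegral_const_mul _ (by fun_prop), lintegral_add_left measurable_const, setLIntegral_const]
  simp only [h2]
  rw [lintegral_const_mul _ (by fun_prop), lintegral_add_left (by fun_prop), setLIntegral_const,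
    lintegral_mul_const _ (by fun_prop), h4]
  ring

/-- The Gagliardo energy on `S × S`. -/
def gagliardo (s : ℝ) (S : Set (E d)) (w : E d → ℝ) : ℝ≥0∞ :=
  ∫⁻ q in S ×ˢ S, ENNReal.ofReal ((w q.2 - w q.1) ^ 2 / ‖q.2 - q.1‖ ^ ((d : ℝ) + 2 * s))

theorem sq_mul_sub_mul_le {a b u v : ℝ} (ha : |a| ≤ 1) :
    (a * u - b * v) ^ 2 ≤ 2 * (u - v) ^ 2 + 2 * ((a - b) ^ 2 * v ^ 2) := by
  have h1 : (a * u - b * v) ^ 2 ≤ 2 * ((a * (u - v)) ^ 2 + ((a - b) * v) ^ 2) := by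
    have := add_sq_le (a := a * (u - v)) (b := (a - b) * v)
    calc _ = (a * (u - v) + (a - b) * v) ^ 2 := by ring
      _ ≤ _ := this
  have h2 : a ^ 2 ≤ 1 := by
    rw [← sq_abs]
    exact pow_le_one₀ (abs_nonneg _) ha
  nlinarith [mul_le_mul_of_nonneg_right h2 (sq_nonneg (u - v)), mul_pow a (u - v) 2,
    mul_pow (a - b) v 2]

theorem sq_mul_sub_mul_le' {a b u v : ℝ} (ha : |a| ≤ 1) (hb : |b| ≤ 1) :
    (a * u - b * v) ^ 2 ≤ 2 * v ^ 2 + 2 * u ^ 2 := by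
  have h1 : a ^ 2 ≤ 1 := by
    rw [← sq_abs]
    exact pow_le_one₀ (abs_nonneg _) ha
  have h2 : b ^ 2 ≤ 1 := by
    rw [← sq_abs]
    exact pow_le_one₀ (abs_nonneg _) hb
  nlinarith [mul_le_mul_of_nonneg_right h1 (sq_nonneg u), mul_le_mul_of_nonneg_right h2 (sq_nonneg v),
    sq_nonneg (a * u + b * v)]

/-- Multiplication by a Lipschitz cut-off function. -/
theorem exists_nlSemiSq_cutoff_le (hd : 2 ≤ d) (hs0 : 0 < s) (hs1 : s < 1) (hΩ : IsOpen Ω)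
    (hb : Bornology.IsBounded Ω) {p : E d} {r : ℝ} (hr : 0 < r) {ψ : E d → ℝ} {L : ℝ≥0}
    (hψL : LipschitzWith L ψ) (hψ1 : ∀ x, |ψ x| ≤ 1) (hψ0 : ∀ x ∉ ball p (r / 2), ψ x = 0) :
    ∃ C : ℝ≥0∞, C ≠ ⊤ ∧ ∀ w : E d → ℝ, Measurable w →
      nlSemiSq s Ω (fun x => ψ x * w x) ≤
        2 * gagliardo s (Ω ∩ ball p r) w + C * ∫⁻ x in Ω, ENNReal.ofReal (w x ^ 2) := by
  obtain ⟨D, hD0, hD⟩ := exists_bdist_le hb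
  have hΩm := hΩ.measurableSet
  set P : ℝ := (d : ℝ) + 2 * s with hP
  have hP0 : 0 ≤ P := by positivity
  set κ : ℝ := ((r / 2) ^ P)⁻¹ with hκ
  have hκ0 : 0 ≤ κ := by positivity
  set C₁ : ℝ≥0∞ := ENNReal.ofReal (2 * (L : ℝ) ^ 2 * D ^ (2 - 2 * s)) * volume (ball (0 : E d) 1)
    with hC₁
  have hC₁t : C₁ ≠ ⊤ := ENNReal.mul_ne_top ENNReal.ofReal_ne_top measure_ball_lt_top.ne
  refine ⟨C₁ + ENNReal.ofReal (4 * κ) * volume Ω, ENNReal.add_ne_top.2 ⟨hC₁t,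
    ENNReal.mul_ne_top ENNReal.ofReal_ne_top hb.measure_lt_top.ne⟩, fun w hw => ?_⟩
  set S : Set (E d) := Ω ∩ ball p r with hS
  have hSm : MeasurableSet (S ×ˢ S) :=
    (hΩm.inter measurableSet_ball).prod (hΩm.inter measurableSet_ball)
  set Z : E d × E d → ℝ≥0∞ := (S ×ˢ S).indicator fun q =>
    ENNReal.ofReal ((w q.2 - w q.1) ^ 2 / ‖q.2 - q.1‖ ^ P) with hZ
  have hZm : Measurable Z := Measurable.indicator (by fun_prop) hSm
  have hpt : ∀ x ∈ Ω, ∀ y ∈ Ω ∩ ball x (bdist Ω x),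
      ENNReal.ofReal (|ψ y * w y - ψ x * w x| ^ 2 / bdist Ω x ^ P) ≤
        2 * Z (x, y) + (ENNReal.ofReal (2 * (L : ℝ) ^ 2 * w x ^ 2 * bdist Ω x ^ 2 / bdist Ω x ^ P) +
          ENNReal.ofReal (κ * (2 * w x ^ 2 + 2 * w y ^ 2))) := by
    rintro x hx y ⟨hy, hyx⟩
    have hδ := bdist_pos hd hΩ hb hx
    have hδP := Real.rpow_pos_of_pos hδ P
    rw [mem_ball] at hyx
    rw [sq_abs]
    -- For close points, either both cut-off values vanish or both points lie in `B(p, r)`; there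
    -- the product rule applies and `δ(x) > ‖y - x‖` bounds the kernel by the Gagliardo one. For far
    -- points `δ(x) > r/2`, so the kernel is at most `κ`.
    rcases lt_or_ge (dist y x) (r / 2) with hclose | hfar
    · by_cases hzero : ψ y = 0 ∧ ψ x = 0
      · simp [hzero.1, hzero.2]
      have hmem : x ∈ ball p r ∧ y ∈ ball p r := by
        rw [mem_ball, mem_ball]
        by_cases hψy : ψ y = 0
        · have hψx : ψ x ≠ 0 := fun h => hzero ⟨hψy, h⟩
          have h1 : dist x p < r / 2 := by
            by_contra h
            exact hψx (hψ0 x h)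
          have := dist_triangle y x p
          constructor <;> linarith
        · have h1 : dist y p < r / 2 := by
            by_contra h
            exact hψy (hψ0 y h)
          have := dist_triangle_left x p y
          constructor <;> linarith
      rcases eq_or_ne y x with rfl | hne
      · simp
      have hq : (x, y) ∈ S ×ˢ S := ⟨⟨hx, hmem.1⟩, ⟨hy, hmem.2⟩⟩
      have hdist : 0 < ‖y - x‖ := norm_pos_iff.2 (sub_ne_zero.2 hne)
      have hdP := Real.rpow_pos_of_pos hdist P
      have h1 := sq_mul_sub_mul_le (a := ψ y) (b := ψ x) (u := w y) (v := w x) (hψ1 y)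
      have h2 : (ψ y - ψ x) ^ 2 ≤ (L : ℝ) ^ 2 * bdist Ω x ^ 2 := by
        rw [← mul_pow, ← sq_abs (ψ y - ψ x)]
        gcongr
        have := hψL.dist_le_mul y x
        rw [Real.dist_eq] at this
        exact this.trans (by gcongr)
      have h3 : ‖y - x‖ ^ P ≤ bdist Ω x ^ P := by
        refine Real.rpow_le_rpow hdist.le ?_ hP0
        rw [← dist_eq_norm]
        exact hyx.le
      rw [← add_assoc]
      refine le_add_of_le_of_nonneg ?_ zero_le
      simp only [hZ, indicator_of_mem hq]
      have e2 : ∀ a : ℝ, 2 * ENNReal.ofReal a = ENNReal.ofReal (2 * a) := fun a => by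
        rw [ENNReal.ofReal_mul two_pos.le, ENNReal.ofReal_ofNat]
      rw [e2,
        ← ENNReal.ofReal_add (by positivity) (by positivity)]
      refine ENNReal.ofReal_le_ofReal ?_
      calc _ ≤ (2 * (w y - w x) ^ 2 + 2 * ((ψ y - ψ x) ^ 2 * w x ^ 2)) / bdist Ω x ^ P := by gcongr
        _ = 2 * ((w y - w x) ^ 2 / bdist Ω x ^ P) +
            2 * ((ψ y - ψ x) ^ 2 * w x ^ 2) / bdist Ω x ^ P := by ring
        _ ≤ 2 * ((w y - w x) ^ 2 / ‖y - x‖ ^ P) +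
            2 * (((L : ℝ) ^ 2 * bdist Ω x ^ 2) * w x ^ 2) / bdist Ω x ^ P := by gcongr
        _ = _ := by ring
    · rw [← add_assoc, add_comm]
      refine le_add_of_le_of_nonneg (ENNReal.ofReal_le_ofReal ?_) zero_le
      rw [div_eq_inv_mul]
      refine mul_le_mul ?_ (sq_mul_sub_mul_le' (hψ1 y) (hψ1 x)) (sq_nonneg _) hκ0
      rw [hκ]
      gcongr
      linarith
  have hA : ∫⁻ x in Ω, ∫⁻ y in Ω ∩ ball x (bdist Ω x), 2 * Z (x, y) ≤ 2 * gagliardo s S w := by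
    calc _ ≤ ∫⁻ x, ∫⁻ y, 2 * Z (x, y) :=
          (setLIntegral_le_lintegral _ _).trans
            (lintegral_mono fun x => setLIntegral_le_lintegral _ _)
      _ = 2 * gagliardo s S w := by
          rw [← lintegral_prod (fun q => 2 * Z q) (by fun_prop), lintegral_const_mul _ hZm, hZ,
            lintegral_indicator hSm]
          rfl
  have hBt : ∀ x ∈ Ω, ∫⁻ y in Ω ∩ ball x (bdist Ω x),
      ENNReal.ofReal (2 * (L : ℝ) ^ 2 * w x ^ 2 * bdist Ω x ^ 2 / bdist Ω x ^ P) ≤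
        C₁ * ENNReal.ofReal (w x ^ 2) := by
    intro x hx
    refine (setLIntegral_ball_le hs1 (bdist_pos hd hΩ hb hx) (hD x hx)
      (w := fun _ => 2 * (L : ℝ) ^ 2 * w x ^ 2 * bdist Ω x ^ 2) (fun _ _ => le_rfl)).trans_eq ?_
    rw [abs_of_nonneg (by positivity), hC₁, mul_right_comm (ENNReal.ofReal _),
      ← ENNReal.ofReal_mul (by positivity)]
    congr 2
    ring
  have hinner : ∀ x ∈ Ω, density s Ω (fun x => ψ x * w x) x ≤
      (∫⁻ y in Ω ∩ ball x (bdist Ω x), 2 * Z (x, y)) + (C₁ * ENNReal.ofReal (w x ^ 2) +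
        ∫⁻ y in Ω, ENNReal.ofReal (κ * (2 * w x ^ 2 + 2 * w y ^ 2))) := by
    intro x hx
    have hm : MeasurableSet (Ω ∩ ball x (bdist Ω x)) := hΩm.inter measurableSet_ball
    refine (setLIntegral_mono' hm (hpt x hx)).trans ?_
    rw [lintegral_add_left (by fun_prop), lintegral_add_left measurable_const]
    exact add_le_add le_rfl (add_le_add (hBt x hx) (lintegral_mono_set inter_subset_left))
  calc nlSemiSq s Ω (fun x => ψ x * w x)
      ≤ ∫⁻ x in Ω, ((∫⁻ y in Ω ∩ ball x (bdist Ω x), 2 * Z (x, y)) +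
        (C₁ * ENNReal.ofReal (w x ^ 2) +
        ∫⁻ y in Ω, ENNReal.ofReal (κ * (2 * w x ^ 2 + 2 * w y ^ 2)))) := setLIntegral_mono' hΩm hinner
    _ = (∫⁻ x in Ω, ∫⁻ y in Ω ∩ ball x (bdist Ω x), 2 * Z (x, y)) +
        (C₁ * (∫⁻ x in Ω, ENNReal.ofReal (w x ^ 2)) +
        ∫⁻ x in Ω, ∫⁻ y in Ω, ENNReal.ofReal (κ * (2 * w x ^ 2 + 2 * w y ^ 2))) := by
        have hm : Measurable fun x => ∫⁻ y in Ω, ENNReal.ofReal (κ * (2 * w x ^ 2 + 2 * w y ^ 2)) := by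
          have : Measurable fun q : E d × E d =>
              ENNReal.ofReal (κ * (2 * w q.1 ^ 2 + 2 * w q.2 ^ 2)) := by fun_prop
          exact this.lintegral_prod_right'
        rw [lintegral_add_right _ (by fun_prop), lintegral_add_left (by fun_prop),
          lintegral_const_mul _ (by fun_prop)]
    _ ≤ _ := by
        rw [lintegral_lintegral_sq_add_sq hκ0 hw, add_mul]
        exact add_le_add hA le_rfl

theorem exists_pos_mul_lt_of_pos {C η : ℝ≥0∞} (hC : C ≠ ⊤) (hη : 0 < η) :
    ∃ ε : ℝ≥0∞, 0 < ε ∧ C * ε < η := by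
  have h : Tendsto (fun ε : ℝ≥0∞ => C * ε) (𝓝[>] 0) (𝓝 0) := by
    have : Tendsto (fun ε : ℝ≥0∞ => C * ε) (𝓝 0) (𝓝 (C * 0)) :=
      ENNReal.Tendsto.const_mul tendsto_id (Or.inr hC)
    rw [mul_zero] at this
    exact this.mono_left nhdsWithin_le_nhds
  obtain ⟨ε, h1, h2⟩ := ((h.eventually (gt_mem_nhds hη)).and self_mem_nhdsWithin).exists
  exact ⟨ε, h2, h1⟩

theorem lintegral_sq_cutoff_le {ψ w : E d → ℝ} (hψ1 : ∀ x, |ψ x| ≤ 1) :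
    ∫⁻ x in Ω, ENNReal.ofReal ((ψ x * w x) ^ 2) ≤ ∫⁻ x in Ω, ENNReal.ofReal (w x ^ 2) := by
  refine lintegral_mono fun x => ENNReal.ofReal_le_ofReal ?_
  rw [mul_pow, ← sq_abs (ψ x)]
  exact mul_le_of_le_one_left (sq_nonneg _) (pow_le_one₀ (abs_nonneg _) (hψ1 x))

/-- Localization of the density statement. -/
theorem HasInteriorCone.exists_cutoff_mem (hd : 2 ≤ d) (hs0 : 0 < s) (hs1 : s < 1) (hΩ : IsOpen Ω)
    (hb : Bornology.IsBounded Ω) {p : E d} (hp : HasInteriorCone Ω p) {φ : L2 Ω}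
    (hφ : MemFracSobolev s Ω φ) :
    ∃ r > 0, ∀ ψ : E d → ℝ, ContDiff ℝ 1 ψ → (∀ x, |ψ x| ≤ 1) → tsupport ψ ⊆ ball p r →
      ∀ v : L2 Ω, (v =ᵐ[volume.restrict Ω] fun x => ψ x * φ x) → v ∈ nlSpace s Ω := by
  obtain ⟨r, hr, happ⟩ := hp.exists_contDiff_approx hΩ hb hφ
  refine ⟨r / 2, by positivity, fun ψ hψ hψ1 hψs v hv => ?_⟩
  have hψc : HasCompactSupport ψ :=
    (isCompact_closedBall p (r / 2)).of_isClosed_subset (isClosed_tsupport ψ)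
      (hψs.trans ball_subset_closedBall)
  obtain ⟨L, hL⟩ := hψ.lipschitzWith_of_hasCompactSupport hψc one_ne_zero
  obtain ⟨C, hC, hcut⟩ := exists_nlSemiSq_cutoff_le (s := s) hd hs0 hs1 hΩ hb hr hL hψ1
    (fun x hx => image_eq_zero_of_notMem_tsupport fun h => hx (hψs h))
  intro η hη
  -- One `ε` comes from the `L²` part and `2 + C` from the cut-off estimate of the seminorm.
  obtain ⟨ε, hε, hεη⟩ := exists_pos_mul_lt_of_pos (C := 3 + C) (η := η ^ 2)
    (ENNReal.add_ne_top.2 ⟨by simp, hC⟩) (by positivity)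
  obtain ⟨g, hg, hg1, hg2⟩ := happ ε hε
  have hψg : ContDiff ℝ 1 fun x => ψ x * g x := hψ.mul hg
  have hψgc : HasCompactSupport fun x => ψ x * g x := hψc.mul_right
  obtain ⟨L', hL'⟩ := hψg.lipschitzWith_of_hasCompactSupport hψgc one_ne_zero
  have hmem : MemLp (fun x => ψ x * g x) 2 (volume.restrict Ω) :=
    hψg.continuous.memLp_of_hasCompactSupport hψgc
  refine ⟨hmem.toLp _, ⟨_, lipschitz_mem_lipschitzCc_closure hb hL', hmem.coeFn_toLp⟩, ?_⟩
  set w : E d → ℝ := fun x => φ x - g x with hw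
  have hwm : Measurable w := (measurable_coe φ).sub hg.continuous.measurable
  have hae : (v - hmem.toLp _ : L2 Ω) =ᵐ[volume.restrict Ω] fun x => ψ x * w x := by
    filter_upwards [Lp.coeFn_sub v (hmem.toLp _), hv, hmem.coeFn_toLp] with x h1 h2 h3
    rw [h1, Pi.sub_apply, h2, h3]
    ring
  have hW : ∫⁻ x in Ω, ENNReal.ofReal (w x ^ 2) ≤ ε := by
    refine le_trans (le_of_eq ?_) hg1
    refine lintegral_congr fun x => ?_
    rw [hw]
    congr 1
    ring
  have hG : gagliardo s (Ω ∩ ball p r) w ≤ ε := by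
    refine le_trans (le_of_eq ?_) hg2
    refine lintegral_congr fun q => ?_
    rw [hw]
    congr 2
    ring
  rw [nlNorm_congr hae, ← ENNReal.pow_lt_pow_left_iff two_ne_zero, nlNorm_sq, eLpNorm_two_sq]
  refine lt_of_le_of_lt ?_ hεη
  calc _ ≤ ε + (2 * ε + C * ε) := by
        refine add_le_add ((lintegral_sq_cutoff_le hψ1).trans hW) ((hcut w hwm).trans ?_)
        gcongr
    _ = _ := by ring

/-- Functions of finite Gagliardo energy belong to the nonlocal space. -/
theorem mem_nlSpace_of_memFracSobolev (hd : 2 ≤ d) (hs0 : 0 < s) (hs1 : s < 1)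
    (hΩ : IsLipschitzDomain Ω) (hb : Bornology.IsBounded Ω) {φ : L2 Ω}
    (hφ : MemFracSobolev s Ω φ) : φ ∈ nlSpace s Ω := by
  have hloc : ∀ p : E d, ∃ r > 0, p ∈ closure Ω → ∀ ψ : E d → ℝ, ContDiff ℝ 1 ψ →
      (∀ x, |ψ x| ≤ 1) → tsupport ψ ⊆ ball p r →
      ∀ v : L2 Ω, (v =ᵐ[volume.restrict Ω] fun x => ψ x * φ x) → v ∈ nlSpace s Ω := by
    intro p
    by_cases hp : p ∈ closure Ω
    · obtain ⟨r, hr, h⟩ := (hΩ.hasInteriorCone hp).exists_cutoff_mem hd hs0 hs1 hΩ.1 hb hφ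
      exact ⟨r, hr, fun _ => h⟩
    · exact ⟨1, one_pos, fun h => absurd h hp⟩
  choose r hr hmem using hloc
  obtain ⟨t, ht, hcov⟩ := hb.isCompact_closure.elim_nhds_subcover (fun p => ball p (r p))
    fun p _ => ball_mem_nhds p (hr p)
  obtain ⟨ψ, hψ⟩ := SmoothPartitionOfUnity.exists_isSubordinate 𝓘(ℝ, E d)
    (isClosed_closure (s := Ω)) (fun i : t => ball (i : E d) (r i)) (fun i => isOpen_ball)
    (by
      refine hcov.trans fun x hx => ?_
      obtain ⟨p, hp, hx⟩ := mem_iUnion₂.1 hx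
      exact mem_iUnion.2 ⟨⟨p, hp⟩, hx⟩)
  have hψ1 : ∀ i x, |ψ i x| ≤ 1 := fun i x => by
    rw [abs_of_nonneg (ψ.nonneg i x)]
    exact ψ.le_one i x
  have hsum : ∃ v ∈ nlSpace s Ω, v =ᵐ[volume.restrict Ω] ∑ i, fun x => ψ i x * φ x := by
    refine Finset.sum_induction _
      (fun f : E d → ℝ => ∃ v ∈ nlSpace s Ω, v =ᵐ[volume.restrict Ω] f) ?_ ?_ ?_
    · rintro f g ⟨v, hv, hvf⟩ ⟨v', hv', hvf'⟩
      exact ⟨v + v', add_mem hv hv', (Lp.coeFn_add v v').trans (hvf.add hvf')⟩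
    · exact ⟨0, zero_mem _, Lp.coeFn_zero _ _ _⟩
    · intro i _
      have hsm : ContDiff ℝ 1 (ψ i) :=
        (contMDiff_iff_contDiff.1 (ψ i).contMDiff).of_le (by exact_mod_cast le_top)
      have hL : MemLp (fun x => ψ i x * φ x) 2 (volume.restrict Ω) := by
        refine (Lp.memLp φ).of_le
          (hsm.continuous.aestronglyMeasurable.mul (Lp.aestronglyMeasurable φ))
          (Eventually.of_forall fun x => ?_)
        rw [norm_mul, Real.norm_eq_abs]
        exact mul_le_of_le_one_left (norm_nonneg _) (hψ1 i x)
      exact ⟨hL.toLp _, hmem i (ht i i.2) (ψ i) hsm (hψ1 i) (hψ i) _ hL.coeFn_toLp, hL.coeFn_toLp⟩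
  obtain ⟨v, hv, hvφ⟩ := hsum
  have : v = φ := by
    refine Lp.ext (hvφ.trans ?_)
    filter_upwards [ae_restrict_mem hΩ.1.measurableSet] with x hx
    have h1 := ψ.sum_eq_one (subset_closure hx)
    rw [finsum_eq_sum_of_fintype] at h1
    rw [Finset.sum_apply, ← Finset.sum_mul, h1, one_mul]
  exact this ▸ hv

/-- Square integrable functions vanishing outside a compact subset of `Ω` belong to the nonlocal
space with zero boundary values. -/
theorem mem_nlSpaceZero_of_ae_eq_zero (hd : 2 ≤ d) (hs0 : 0 < s) (hΩ : IsOpen Ω)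
    (hb : Bornology.IsBounded Ω) {K : Set (E d)} (hK : IsCompact K) (hKΩ : K ⊆ Ω) {w : L2 Ω}
    (hw : ∀ᵐ x ∂(volume.restrict Ω), x ∉ K → w x = 0) : w ∈ nlSpaceZero s Ω := by
  obtain ⟨K', hK', hKK', hK'Ω⟩ := exists_compact_between hK hΩ hKΩ
  obtain ⟨χ, hχ0, hχ1, hχ⟩ := exists_contMDiffMap_zero_one_of_isClosed (n := 1) 𝓘(ℝ, E d)
    (isOpen_interior (s := K')).isClosed_compl hK.isClosed
    (disjoint_compl_left_iff_subset.2 hKK')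
  have hχabs : ∀ x, |χ x| ≤ 1 := fun x => by
    rw [abs_of_nonneg (hχ x).1]
    exact (hχ x).2
  have hχK : ∀ x ∉ K', χ x = 0 := fun x hx => hχ0 fun h => hx (interior_subset h)
  have hχsm : ContDiff ℝ 1 χ := contMDiff_iff_contDiff.1 χ.contMDiff
  have hχc : HasCompactSupport χ := HasCompactSupport.intro hK' hχK
  obtain ⟨δ₁, hδ₁, hδK⟩ := hK'.exists_forall_le' (f := bdist Ω) (a := 0)
    (continuous_infDist_pt _).continuousOn fun x hx => bdist_pos hd hΩ hb (hK'Ω hx)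
  set P : ℝ := (d : ℝ) + 2 * s with hP
  have hP0 : 0 ≤ P := by positivity
  set κ : ℝ := ((δ₁ / 2) ^ P)⁻¹ with hκ
  have hκ0 : 0 ≤ κ := by positivity
  -- If `χ` is nonzero at `x` or at `y ∈ B(x, δ(x))`, then `δ(x) ≥ δ₁/2`, so the kernel is bounded
  -- by `κ`. On multiples of `χ` the `L²` norm thus controls the seminorm, and approximation in `L²`
  -- suffices.
  have hsemi : ∀ z : E d → ℝ, Measurable z →
      nlSemiSq s Ω (fun x => χ x * z x) ≤
        ENNReal.ofReal (4 * κ) * volume Ω * ∫⁻ x in Ω, ENNReal.ofReal (z x ^ 2) := by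
    intro z hz
    rw [← lintegral_lintegral_sq_add_sq hκ0 hz]
    refine lintegral_mono fun x => ?_
    refine le_trans (setLIntegral_mono' (hΩ.measurableSet.inter measurableSet_ball) ?_)
      (lintegral_mono_set inter_subset_left)
    rintro y ⟨-, hy⟩
    refine ENNReal.ofReal_le_ofReal ?_
    beta_reduce
    by_cases hzero : χ y = 0 ∧ χ x = 0
    · rw [hzero.1, hzero.2]
      simp only [zero_mul, sub_zero, abs_zero, ne_eq, OfNat.ofNat_ne_zero, not_false_eq_true,
        zero_pow, zero_div]
      positivity
    have hδx : δ₁ / 2 ≤ bdist Ω x := by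
      by_cases hχx : χ x = 0
      · have hyK : y ∈ K' := by
          by_contra h
          exact hzero ⟨hχK y h, hχx⟩
        have h1 := hδK y hyK
        have h2 := bdist_le_add_dist (Ω := Ω) y x
        rw [mem_ball] at hy
        linarith
      · have hxK : x ∈ K' := by
          by_contra h
          exact hχx (hχK x h)
        linarith [hδK x hxK]
    rw [sq_abs, div_eq_inv_mul]
    refine mul_le_mul ?_ (sq_mul_sub_mul_le' (hχabs y) (hχabs x)) (sq_nonneg _) hκ0
    rw [hκ]
    gcongr
  intro η hη
  obtain ⟨ε, hε, hεη⟩ := exists_pos_mul_lt_of_pos (C := 1 + ENNReal.ofReal (4 * κ) * volume Ω) (η := η ^ 2)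
    (ENNReal.add_ne_top.2 ⟨by simp, ENNReal.mul_ne_top ENNReal.ofReal_ne_top hb.measure_lt_top.ne⟩)
    (by positivity)
  obtain ⟨ε₁, hε₁, hε₁2⟩ : ∃ ε₁ : ℝ, 0 < ε₁ ∧ ENNReal.ofReal ε₁ ^ 2 ≤ ε := by
    by_cases hεt : ε = ⊤
    · exact ⟨1, one_pos, hεt ▸ le_top⟩
    · refine ⟨min 1 ε.toReal, lt_min one_pos (ENNReal.toReal_pos hε.ne' hεt), ?_⟩
      have h0 : 0 < min 1 ε.toReal := lt_min one_pos (ENNReal.toReal_pos hε.ne' hεt)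
      rw [← ENNReal.ofReal_pow h0.le]
      refine ENNReal.ofReal_le_of_le_toReal ?_
      rw [sq]
      calc _ ≤ 1 * ε.toReal := mul_le_mul (min_le_left _ _) (min_le_right _ _) h0.le zero_le_one
        _ = _ := one_mul _
  obtain ⟨g, hgc, hg, hgε⟩ := MemLp.exist_eLpNorm_sub_le (by norm_num) (by norm_num)
    (Lp.memLp w) hε₁
  have hχg : ContDiff ℝ 1 fun x => χ x * g x := hχsm.mul (hg.of_le (by exact_mod_cast le_top))
  have hχgc : HasCompactSupport fun x => χ x * g x := hχc.mul_right
  obtain ⟨L, hL⟩ := hχg.lipschitzWith_of_hasCompactSupport hχgc one_ne_zero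
  have hmem : MemLp (fun x => χ x * g x) 2 (volume.restrict Ω) :=
    hχg.continuous.memLp_of_hasCompactSupport hχgc
  refine ⟨hmem.toLp _, ⟨_, ⟨⟨L, hL.lipschitzOnWith⟩, K', hK', hK'Ω,
    fun x _ hx => by simp [hχK x hx]⟩, hmem.coeFn_toLp⟩, ?_⟩
  set z : E d → ℝ := w - g with hz
  have hzm : Measurable z := (measurable_coe w).sub hg.continuous.measurable
  -- `χ = 1` on `K` and `w = 0` off `K`, so `w = χ w`.
  have hae : (w - hmem.toLp _ : L2 Ω) =ᵐ[volume.restrict Ω] fun x => χ x * z x := by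
    filter_upwards [Lp.coeFn_sub w (hmem.toLp _), hw, hmem.coeFn_toLp] with x h1 h2 h3
    rw [h1, Pi.sub_apply, h3, hz, Pi.sub_apply, mul_sub]
    congr 1
    by_cases hx : x ∈ K
    · rw [hχ1 hx, Pi.one_apply, one_mul]
    · rw [h2 hx, mul_zero]
  have hZ : ∫⁻ x in Ω, ENNReal.ofReal (z x ^ 2) ≤ ε := by
    rw [← eLpNorm_two_sq]
    refine le_trans ?_ hε₁2
    gcongr
  rw [nlNorm_congr hae, ← ENNReal.pow_lt_pow_left_iff two_ne_zero, nlNorm_sq, eLpNorm_two_sq]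
  refine lt_of_le_of_lt ?_ hεη
  rw [add_mul, one_mul]
  refine add_le_add ((lintegral_sq_cutoff_le hχabs).trans hZ) ((hsemi z hzm).trans ?_)
  gcongr

end Density

/-! ### The admissible set: nonempty, convex, complete. -/

section Existence
open Filter Topology

variable {d : ℕ} {s : ℝ} {Ω Ω₀ : Set (E d)}

/-- The competitor is `φ + 1_{Ω₀}(|h| + |φ|)`, which dominates `h` on `Ω₀`. The added term needs no
smoothness, because it vanishes off a compact subset of `Ω`. -/
theorem admissible_nonempty (hd : 2 ≤ d) (hs0 : 0 < s) (hs1 : s < 1)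
    (hΩ : IsLipschitzDomain Ω) (hb : Bornology.IsBounded Ω) (hΩ₀ : IsOpen Ω₀)
    (hΩ₀c : IsCompact (closure Ω₀)) (hΩ₀Ω : closure Ω₀ ⊆ Ω) {φ : L2 Ω}
    (hφ : MemFracSobolev s Ω φ) (h : L2 Ω) : (admissible s Ω Ω₀ φ h).Nonempty := by
  have hmem : MemLp (Ω₀.indicator fun x => |h x| + |φ x|) 2 (volume.restrict Ω) :=
    ((Lp.memLp h).abs.add (Lp.memLp φ).abs).indicator hΩ₀.measurableSet
  set w : L2 Ω := hmem.toLp _ with hw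
  have hwae : w =ᵐ[volume.restrict Ω] Ω₀.indicator fun x => |h x| + |φ x| := hmem.coeFn_toLp
  have hw0 : w ∈ nlSpaceZero s Ω := by
    refine mem_nlSpaceZero_of_ae_eq_zero hd hs0 hΩ.1 hb hΩ₀c hΩ₀Ω ?_
    filter_upwards [hwae] with x hx hxK
    rw [hx, indicator_of_notMem fun h0 => hxK (subset_closure h0)]
  have hφm := mem_nlSpace_of_memFracSobolev hd hs0 hs1 hΩ hb hφ
  refine ⟨⟨φ + w, add_mem hφm (nlSpaceZero_le hΩ.1 hb hw0)⟩, ?_, ?_⟩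
  · filter_upwards [ae_restrict_of_ae_restrict_of_subset (subset_closure.trans hΩ₀Ω) hwae,
      ae_restrict_of_ae_restrict_of_subset (subset_closure.trans hΩ₀Ω) (Lp.coeFn_add φ w),
      ae_restrict_mem hΩ₀.measurableSet] with x h1 h2 h3
    rw [indicator_of_mem h3] at h1
    rw [h2, Pi.add_apply, h1]
    linarith [neg_abs_le (φ x), le_abs_self (h x)]
  · change φ + w - φ ∈ _
    rwa [add_sub_cancel_left]

theorem convex_admissible (hΩ₀Ω : Ω₀ ⊆ Ω) (φ h : L2 Ω) :
    Convex ℝ (admissible s Ω Ω₀ φ h) := by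
  rintro u ⟨hu1, hu2⟩ v ⟨hv1, hv2⟩ a b ha hb hab
  refine ⟨?_, ?_⟩
  · have e1 := ae_restrict_of_ae_restrict_of_subset hΩ₀Ω
      (Lp.coeFn_add (a • (u : L2 Ω)) (b • (v : L2 Ω)))
    have e2 := ae_restrict_of_ae_restrict_of_subset hΩ₀Ω (Lp.coeFn_smul a (u : L2 Ω))
    have e3 := ae_restrict_of_ae_restrict_of_subset hΩ₀Ω (Lp.coeFn_smul b (v : L2 Ω))
    filter_upwards [hu1, hv1, e1, e2, e3] with x h1 h2 h3 h4 h5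
    change h x ≤ (a • (u : L2 Ω) + b • (v : L2 Ω) : L2 Ω) x
    rw [h3, Pi.add_apply, h4, h5, Pi.smul_apply, Pi.smul_apply, smul_eq_mul, smul_eq_mul]
    calc h x = a * h x + b * h x := by rw [← add_mul, hab, one_mul]
      _ ≤ _ := by gcongr
  · change a • (u : L2 Ω) + b • (v : L2 Ω) - φ ∈ _
    have : a • (u : L2 Ω) + b • (v : L2 Ω) - φ = a • ((u : L2 Ω) - φ) + b • ((v : L2 Ω) - φ) := by
      rw [smul_sub, smul_sub, sub_add_sub_comm, ← add_smul, hab, one_smul]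
    rw [this]
    exact add_mem (Submodule.smul_mem _ _ hu2) (Submodule.smul_mem _ _ hv2)

theorem sub_mem_nlSpaceZero {φ h : L2 Ω} {u v : nlSpace s Ω} (hu : u ∈ admissible s Ω Ω₀ φ h)
    (hv : v ∈ admissible s Ω Ω₀ φ h) : ((u - v : nlSpace s Ω) : L2 Ω) ∈ nlSpaceZero s Ω := by
  have := sub_mem hu.2 hv.2
  rwa [sub_sub_sub_cancel_right] at this

theorem nlNorm_sub_comm (u v : L2 Ω) : nlNorm s Ω (u - v : L2 Ω) = nlNorm s Ω (v - u : L2 Ω) := by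
  rw [← neg_sub, nlNorm_neg]

/-- The obstacle condition passes to the limit along a subsequence converging almost everywhere; the
boundary condition passes because the zero space is closed for the gauge. -/
theorem exists_admissible_limit (hd : 2 ≤ d) (hs1 : s < 1) (hΩ : IsOpen Ω)
    (hb : Bornology.IsBounded Ω) (hΩ₀Ω : Ω₀ ⊆ Ω) {φ h : L2 Ω} (v : ℕ → nlSpace s Ω)
    (hv : ∀ n, v n ∈ admissible s Ω Ω₀ φ h)
    (hc : ∀ ε > 0, ∃ n₀, ∀ n ≥ n₀, ∀ m ≥ n₀,
      (nlNorm s Ω ((v n - v m : nlSpace s Ω) : L2 Ω)).toReal < ε) :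
    ∃ w ∈ admissible s Ω Ω₀ φ h,
      Tendsto (fun n => (nlNorm s Ω ((v n - w : nlSpace s Ω) : L2 Ω)).toReal) atTop (𝓝 0) := by
  have hfin : ∀ u : nlSpace s Ω, nlNorm s Ω (u : L2 Ω) ≠ ⊤ := fun u =>
    ((nlNorm_lt_top_iff _).2 (nlSemiSq_lt_top_of_mem_nlSpace hd hs1 hΩ hb u)).ne
  obtain ⟨w, hw, ns, hns, hae⟩ := exists_nlNorm_limit (s := s) (fun n => (v n : L2 Ω)) (by
    intro ε hε
    by_cases hεt : ε = ⊤
    · exact ⟨0, fun n _ m _ => hεt ▸ (hfin (v n - v m)).lt_top⟩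
    · obtain ⟨n₀, hn₀⟩ := hc ε.toReal (ENNReal.toReal_pos hε.ne' hεt)
      exact ⟨n₀, fun n hn m hm => (ENNReal.toReal_lt_toReal (hfin (v n - v m)) hεt).1
        (hn₀ n hn m hm)⟩)
  have hwmem : w ∈ nlSpace s Ω := mem_nlClosure_of_forall fun ε hε => by
    obtain ⟨n₀, hn₀⟩ := hw ε hε
    exact ⟨v n₀, (v n₀).2, by rw [nlNorm_sub_comm]; exact hn₀ n₀ le_rfl⟩
  refine ⟨⟨w, hwmem⟩, ⟨?_, ?_⟩, ?_⟩
  · have h1 : ∀ᵐ x ∂(volume.restrict Ω₀), ∀ n, h x ≤ (v n : L2 Ω) x :=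
      ae_all_iff.2 fun n => (hv n).1
    filter_upwards [h1, ae_restrict_of_ae_restrict_of_subset hΩ₀Ω hae] with x h2 h3
    exact ge_of_tendsto' h3 fun n => h2 _
  · refine mem_nlClosure_of_forall fun ε hε => ?_
    obtain ⟨n₀, hn₀⟩ := hw ε hε
    refine ⟨v n₀ - φ, (hv n₀).2, ?_⟩
    rw [sub_sub_sub_cancel_right, nlNorm_sub_comm]
    exact hn₀ n₀ le_rfl
  · rw [Metric.tendsto_atTop]
    intro ε hε
    obtain ⟨n₀, hn₀⟩ := hw (ENNReal.ofReal (ε / 2)) (by simpa using hε)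
    refine ⟨n₀, fun n hn => ?_⟩
    rw [Real.dist_eq, sub_zero, abs_of_nonneg ENNReal.toReal_nonneg]
    have := ENNReal.toReal_mono ENNReal.ofReal_ne_top (hn₀ n hn)
    rw [ENNReal.toReal_ofReal (by positivity)] at this
    exact this.trans_lt (by linarith)

end Existence

end NonlocalObstacle

end

/-! ### The obstacle problem. -/

open NonlocalObstacle in
theorem corollary1p4 (d : ℕ) (hd : 2 ≤ d) (s : ℝ) (hs0 : 0 < s) (hs1 : s < 1) (hs : 1 < 2 * s)
    (Ω : Set (E d)) (hΩb : Bornology.IsBounded Ω) (hΩ : IsLipschitzDomain Ω)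
    (Ω₀ : Set (E d)) (hΩ₀ : IsOpen Ω₀) (hΩ₀c : IsCompact (closure Ω₀)) (hΩ₀Ω : closure Ω₀ ⊆ Ω)
    (A : E d → E d → ℝ) (α₁ α₂ : ℝ) (hα₁ : 0 < α₁)
    (hAm : AEStronglyMeasurable (fun q : E d × E d => A q.1 q.2)
      ((volume.restrict Ω).prod (volume.restrict Ω)))
    (hAs : ∀ x ∈ Ω, ∀ y ∈ Ω, A x y = A y x)
    (hAe : ∀ x ∈ Ω, ∀ y ∈ Ω, α₁ ≤ A x y ∧ A x y ≤ α₂)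
    (φ : L2 Ω) (hφ : MemFracSobolev s Ω φ)
    (h : L2 Ω) (hh0 : ∀ᵐ x ∂(volume.restrict Ω), 0 ≤ h x) (hhW : ¬ MemFracSobolev s Ω h)
    (f : nlSpace s Ω →ₗ[ℝ] ℝ) (hf : IsBoundedFunctional f) :
    -- the integrals defining the energy and the bilinear form converge absolutely
    (∀ u : nlSpace s Ω, IntegrableOn
      (fun q : E d × E d => A q.1 q.2 / bdist Ω q.1 ^ ((d : ℝ) + 2 * s) *
        ((u : L2 Ω) q.2 - (u : L2 Ω) q.1) ^ 2)
      {q | q.1 ∈ Ω ∧ q.2 ∈ Ω ∩ ball q.1 (bdist Ω q.1)} (volume.prod volume)) ∧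
    (∀ u v : nlSpace s Ω, IntegrableOn
      (fun q : E d × E d => kernelG s Ω A q.1 q.2 *
        ((u : L2 Ω) q.1 - (u : L2 Ω) q.2) * ((v : L2 Ω) q.1 - (v : L2 Ω) q.2))
      (Ω ×ˢ Ω) (volume.prod volume)) ∧
    -- existence and uniqueness of the minimizer
    (∃! u : nlSpace s Ω, u ∈ admissible s Ω Ω₀ φ h ∧
      IsMinOn (fun v : nlSpace s Ω => energy s Ω A (fun t => t ^ 2) (v : L2 Ω) - f v)
        (admissible s Ω Ω₀ φ h) u) ∧
    -- characterization by the variational inequality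
    ∀ u ∈ admissible s Ω Ω₀ φ h,
      (IsMinOn (fun v : nlSpace s Ω => energy s Ω A (fun t => t ^ 2) (v : L2 Ω) - f v)
          (admissible s Ω Ω₀ φ h) u ↔
        ∀ v ∈ admissible s Ω Ω₀ φ h,
          2 * formB s Ω A (u : L2 Ω) ((v - u : nlSpace s Ω) : L2 Ω) ≥ f (v - u)) := by
  have hop := hΩ.1
  have hΩ₀s : Ω₀ ⊆ Ω := subset_closure.trans hΩ₀Ω
  have hsemi : ∀ u : nlSpace s Ω, nlSemiSq s Ω (u : L2 Ω) < ⊤ :=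
    nlSemiSq_lt_top_of_mem_nlSpace hd hs1 hop hΩb
  have hfin : ∀ u : nlSpace s Ω, nlNorm s Ω (u : L2 Ω) ≠ ⊤ := fun u =>
    ((nlNorm_lt_top_iff _).2 (hsemi u)).ne
  set a := bilinForm hsemi hop hAm hα₁ hAe with ha
  have haB : ∀ u v : nlSpace s Ω, formB s Ω A (u : L2 Ω) (v : L2 Ω) = a u v := fun u v =>
    (formB_eq_pairForm hop hAm hAs hα₁ hAe (measurable_coe _) (measurable_coe _)
      (hsemi u) (hsemi v)).2
  have haE : ∀ u : nlSpace s Ω, energy s Ω A (fun t => t ^ 2) (u : L2 Ω) = a u u := fun u =>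
    energy_eq_pairForm hop hAm hα₁ hAe (measurable_coe _) (hsemi u)
  have hsymm : ∀ u v, a u v = a v u := fun u v => pairForm_comm _ _
  have hbd : ∀ u : nlSpace s Ω, α₁ * (nlSemiSq s Ω (u : L2 Ω)).toReal ≤ a u u ∧
      a u u ≤ α₂ * (nlSemiSq s Ω (u : L2 Ω)).toReal := fun u =>
    pairForm_self_bounds hop hAm hα₁ hAe (measurable_coe _) (hsemi u)
  have hpos : ∀ u, 0 ≤ a u u := fun u =>
    (mul_nonneg hα₁.le ENNReal.toReal_nonneg).trans (hbd u).1
  have hconv : Convex ℝ (admissible s Ω Ω₀ φ h) := convex_admissible hΩ₀s φ h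
  obtain ⟨Cp, hCp, hpoin⟩ := exists_nlNorm_sq_le_of_mem_nlSpaceZero hd hs0 hs1 hs hΩb hΩ
  obtain ⟨Cf, hCf⟩ := hf
  set N : nlSpace s Ω → ℝ := fun u => (nlNorm s Ω (u : L2 Ω)).toReal with hN
  have hN0 : ∀ u, 0 ≤ N u := fun u => ENNReal.toReal_nonneg
  have hsN : ∀ u : nlSpace s Ω, (nlSemiSq s Ω (u : L2 Ω)).toReal ≤ N u ^ 2 := by
    intro u
    rw [hN, ← ENNReal.toReal_pow]
    exact ENNReal.toReal_mono (ENNReal.pow_ne_top (hfin u)) (nlSemiSq_le_nlNorm_sq _)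
  have hpoinN : ∀ u ∈ admissible s Ω Ω₀ φ h, ∀ v ∈ admissible s Ω Ω₀ φ h,
      N (u - v) ^ 2 ≤ Cp.toReal * (nlSemiSq s Ω ((u - v : nlSpace s Ω) : L2 Ω)).toReal := by
    intro u hu v hv
    rw [hN, ← ENNReal.toReal_pow, ← ENNReal.toReal_mul]
    exact ENNReal.toReal_mono (ENNReal.mul_ne_top hCp (hsemi _).ne)
      (hpoin _ (sub_mem_nlSpaceZero hu hv))
  -- Coercivity along the admissible set: Poincaré for the difference, then the lower bound `α₁` on
  -- `A`.
  have hpoina : ∀ u ∈ admissible s Ω Ω₀ φ h, ∀ v ∈ admissible s Ω Ω₀ φ h,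
      N (u - v) ^ 2 ≤ Cp.toReal / α₁ * a (u - v) (u - v) := by
    intro u hu v hv
    refine (hpoinN u hu v hv).trans ?_
    rw [div_mul_eq_mul_div, mul_div_assoc]
    refine mul_le_mul_of_nonneg_left ?_ ENNReal.toReal_nonneg
    rw [le_div_iff₀' hα₁]
    exact (hbd _).1
  have hN_zero : ∀ u : nlSpace s Ω, N u ^ 2 ≤ 0 → u = 0 := by
    intro u hu
    have h1 : N u = 0 := pow_eq_zero_iff two_ne_zero |>.1 (le_antisymm hu (sq_nonneg _))
    have h2 : nlNorm s Ω (u : L2 Ω) = 0 :=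
      ((ENNReal.toReal_eq_zero_iff _).1 h1).resolve_right (hfin u)
    have h3 : eLpNorm (u : L2 Ω) 2 (volume.restrict Ω) = 0 :=
      le_antisymm ((eLpNorm_le_nlNorm _).trans h2.le) zero_le
    have h4 : (u : L2 Ω) = 0 := by
      rw [← norm_eq_zero, Lp.norm_def, h3, ENNReal.toReal_zero]
    exact Subtype.ext h4
  -- One constant serves the bound on `f`, the upper bound on the form and the coercivity; the
  -- summand `1` makes it positive.
  set C : ℝ := Cf + |α₂| + Cp.toReal / α₁ + 1 with hC
  have hCp0 : 0 ≤ Cp.toReal / α₁ := div_nonneg ENNReal.toReal_nonneg hα₁.le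
  have hCf0 : (0 : ℝ) ≤ Cf := Cf.2
  have hC0 : 0 < C := by positivity
  have hfN : ∀ v, |f v| ≤ C * N v := by
    intro v
    have h1 := ENNReal.toReal_mono (ENNReal.mul_ne_top ENNReal.coe_ne_top (hfin v)) (hCf v)
    rw [ENNReal.toReal_ofReal (abs_nonneg _), ENNReal.toReal_mul, ENNReal.coe_toReal] at h1
    refine h1.trans (mul_le_mul_of_nonneg_right ?_ (hN0 v))
    linarith [abs_nonneg α₂]
  have haN : ∀ v, a v v ≤ C * N v ^ 2 := by
    intro v
    calc a v v ≤ α₂ * (nlSemiSq s Ω (v : L2 Ω)).toReal := (hbd v).2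
      _ ≤ |α₂| * (nlSemiSq s Ω (v : L2 Ω)).toReal :=
        mul_le_mul_of_nonneg_right (le_abs_self _) ENNReal.toReal_nonneg
      _ ≤ |α₂| * N v ^ 2 := mul_le_mul_of_nonneg_left (hsN v) (abs_nonneg _)
      _ ≤ C * N v ^ 2 := mul_le_mul_of_nonneg_right (by linarith) (sq_nonneg _)
  have hfun : (fun v : nlSpace s Ω => energy s Ω A (fun t => t ^ 2) (v : L2 Ω) - f v) =
      fun v => a v v - f v := funext fun v => by rw [haE]
  rw [hfun]
  refine ⟨fun u => integrableOn_energy hop hAm hα₁ hAe (measurable_coe _) (hsemi u),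
    fun u v => (formB_eq_pairForm hop hAm hAs hα₁ hAe (measurable_coe _) (measurable_coe _)
      (hsemi u) (hsemi v)).1, ?_, fun u hu => ?_⟩
  · obtain ⟨u, hu, hmin⟩ := exists_isMinOn_quadratic a hsymm hpos f N hconv
      (admissible_nonempty hd hs0 hs1 hΩ hΩb hΩ₀ hΩ₀c hΩ₀Ω hφ h) hC0 hfN haN
      (fun u hu v hv => (hpoina u hu v hv).trans
        (mul_le_mul_of_nonneg_right (by linarith [abs_nonneg α₂]) (hpos _)))
      (fun v hv hc => exists_admissible_limit hd hs1 hop hΩb hΩ₀s v hv hc)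
    refine ⟨u, ⟨hu, hmin⟩, fun v hv => ?_⟩
    refine isMinOn_quadratic_unique a hsymm hpos f hconv (fun u hu v hv huv => ?_) hv.1 hu hv.2 hmin
    refine sub_eq_zero.1 (hN_zero _ ((hpoina u hu v hv).trans ?_))
    exact mul_nonpos_of_nonneg_of_nonpos hCp0 huv
  · simp only [haB]
    exact isMinOn_quadratic_iff a hsymm hpos f hconv hu
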